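/- **Setting.** Fix $c,q>0$, $0<\delta<c/8$, $A>0$ and $m\in\mathbb N$. Put $U_\delta=\{|\Im z|<2\delta\}$, $K_A=\{|\Im z|\le\delta,\ |\Re z|\le A\}$ and, for $\beta_0\in\mathbb C$, $\widetilde U_{\beta_0}=\{\Re\beta_0\le\Re z\le 10\,\Re\beta_0,\ |\Im z|\le\Im\beta_0\}$. For a set $S$, $\mathcal O(S)$ is the set of functions holomorphic on an open neighbourhood of $S$ and $\|f\|_S=\sup_S|f|$. Let $$K(\lambda)=\frac{2c}{\lambda^2+c^2},\qquad \theta(\lambda)=i\ln\frac{ic+\lambda}{ic-\lambda}.$$ The dressed charge $Z$, the dressed phase $\phi(\cdot,\mu)$ and the shift function $F_\beta=F_\beta(\cdot\,|\,\{y_a\}_1^n,\{z_a\}_1^n)$ are the unique solutions of $f(\lambda)-\int_{-q}^qK(\lambda-\tau)f(\tau)\frac{d\tau}{2\pi}=g(\lambda)$ with respectively $g=1$, $g=\frac1{2\pi}\theta(\lambda-\mu)$, and $g=i\beta-\frac12-\frac1{2\pi}\theta(\lambda-q)-\frac1{2\pi}\sum_{a=1}^n[\theta(\lambda-y_a)-\theta(\lambda-z_a)]$.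 Set $$C[\nu](\lambda)=\int_{-q}^q\frac{d\mu}{2i\pi}\frac{\nu(\mu)}{\mu-\lambda},\qquad C_0[\nu]=-\int_{-q}^q\!\int_{-q}^q\frac{\nu(\lambda)\nu(\mu)}{(\lambda-\mu-ic)^2}\,d\lambda\,d\mu .$$ All loops are smooth Jordan curves oriented counterclockwise, $\det_{\mathscr C}[I+V]$ is the Fredholm determinant of the integral operator $f\mapsto\oint_{\mathscr C}V(\cdot,\omega')f(\omega')\,d\omega'$, and $\det[I-K/2\pi]$ acts on $[-q,q]$. For $\epsilon=\pm1$ and a function $f$ on $U_\delta$ put $$B^{\epsilon}_\gamma[f](\omega,\omega')=\frac{-\epsilon}{2\pi}\,\frac{\omega-q}{\omega-q+i\epsilon c}\;e^{C[2i\pi\gamma f](\omega)-C[2i\pi\gamma f](\omega+i\epsilon c)}\,K(\omega-\omega')\;\frac{\gamma}{e^{-2i\pi\epsilon\gamma f(\omega)}-1},$$ where the last factor is replaced by its limit $-1/(2i\pi\epsilon f(\omega))$ at $\gamma=0$. **Smooth part of the form factor.** For $y_a\in U_\delta$ and $z_a\in K_{q+\varepsilon}$ ($1\le a\le n$, $\varepsilon>0$),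 and a loop $\mathscr C_{q+\varepsilon}\subset U_\delta$ around $K_{q+\varepsilon}$, $$\mathcal G^{(\beta)}_{n;\gamma}\binom{\{y_a\}}{\{z_a\}}=e^{-2i\pi\sum_{\epsilon=\pm}C[\gamma F_\beta](q+i\epsilon c)}\prod_{a=1}^n\prod_{\epsilon=\pm}\Big\{\frac{z_a-q+i\epsilon c}{y_a-q+i\epsilon c}\,\frac{e^{2i\pi C[\gamma F_\beta](z_a+i\epsilon c)}}{e^{2i\pi C[\gamma F_\beta](y_a+i\epsilon c)}}\Big\}\,e^{C_0[\gamma F_\beta]}$$ $$\times\prod_{a,b=1}^n\frac{(y_a-z_b-ic)(z_a-y_b-ic)}{(y_a-y_b-ic)(z_a-z_b-ic)}\cdot\frac{\det_{\mathscr C_{q+\varepsilon}}[I+V^+]\,\det_{\mathscr C_{q+\varepsilon}}[I+V^-]}{\det^2[I-K/2\pi]},$$ $$V^\epsilon(\omega,\omega')=\prod_{a=1}^n\frac{(\omega-y_a)(\omega-z_a+i\epsilon c)}{(\omega-z_a)(\omega-y_a+i\epsilon c)}\;B^\epsilon_\gamma[F_\beta](\omega,\omega').$$ **Regular functionals.**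 Let $K\subset\mathrm{Int}(M)$ with $K,M\subset\mathbb C$ compact. A functional $\mathcal F$ is regular with respect to $(M,K)$, with constant of regularity $C_{\mathcal F}>0$, if (i) there is $C'>0$ such that $|\mathcal F[f]-\mathcal F[g]|\le C'\|f-g\|_K$ for all $f,g\in\mathcal O(M)$ with $\|f\|_K+\|g\|_K<C_{\mathcal F}$; (ii) for every $\ell\in\mathbb N$, every open neighbourhood $W$ of $0$ in $\mathbb C^{\ell}$ and every $\nu\in\mathcal O(M\times W)$ with $\|\nu\|_{K\times W}<C_{\mathcal F}$, the function $w\mapsto\mathcal F[\nu(*,w)]$ is holomorphic on $W$. **Lemma.** There exist nested loops $\mathscr C_{in}$, $\mathscr C(K_A)$, $\mathscr C_{out}$ in $U_\delta$ around $K_A$ (each one inside the next), and a loop $\mathscr C_A\subset U_\delta$ around $\mathscr C(K_A)$ and $[-q,q]$, such that: the region $M=M_{\mathscr G_A}$ delimited by $\mathscr C_{in}$ and $\mathscr C_{out}$ (boundary included) is a compact subset of $U_\delta$ with $\partial M=\mathscr C_{in}\cup\mathscr C_{out}$ and $\mathscr C(K_A)\subset\mathrm{Int}(M)$; and $1-z/\omega\notin(-\infty,0]$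 whenever $\omega\in\mathscr C_A$ and $z$ is on or inside $\mathscr C(K_A)$. For $\varpi\in\mathcal O(M)$ put $$G_\beta[\varpi](\lambda)=(i\beta-\tfrac12)Z(\lambda)-\phi(\lambda,q)-\oint_{\mathscr C(K_A)}\frac{dz}{2i\pi}\,\varpi(z)\,\phi(\lambda,z),$$ $$\mathscr V^\epsilon[\varpi](\omega,\omega')=\exp\Big\{\oint_{\mathscr C(K_A)}\frac{dz}{2i\pi}\,\varpi(z)\ln\frac{\omega-z}{\omega-z+i\epsilon c}\Big\}\,B^\epsilon_\gamma\big[G_\beta[\varpi]\big](\omega,\omega'),$$ where $\ln\frac{\omega-z}{\omega-z+i\epsilon c}$ stands for the determination $\ln\omega+\ln(1-z/\omega)-\ln(\omega-z+i\epsilon c)$, which is holomorphic for $z$ inside $\mathscr C(K_A)$ (all other logarithms are principal), and, with $G_\beta=G_\beta[\varpi]$, $$\mathscr G^{(\beta)}_{\gamma;A}[\varpi]=e^{C_0[\gamma G_\beta]}\prod_{\epsilon=\pm}\exp\Big\{-\oint_{\mathscr C(K_A)}\frac{dz}{2i\pi}\,\varpi(z)\big\{2i\pi C[\gamma G_\beta](z+i\epsilon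 c)+\ln(z-q+i\epsilon c)\big\}\Big\}$$ $$\times\exp\Big\{-\oint_{\mathscr C(K_A)}\frac{dy\,dz}{(2i\pi)^2}\,\varpi(y)\varpi(z)\ln(z-y-ic)\Big\}\;\frac{\det_{\mathscr C_A}[I+\mathscr V^+[\varpi]]\,\det_{\mathscr C_A}[I+\mathscr V^-[\varpi]]}{\det^2[I-K/2\pi]\,\exp\{2i\pi\sum_{\epsilon=\pm}C[\gamma G_\beta](q+i\epsilon c)\}} .$$ Then for every $\beta_0$ with $\Re\beta_0$ large enough and $\Im\beta_0>0$ small enough (the thresholds depending only on $c,q,\delta,A,m$ and the contours) there are $C_{\mathscr G_A}>0$ and $g>0$ such that, for every $0<\widetilde\gamma_0\le g$: 1. $\displaystyle C_{\mathscr G_A}\,\frac{\pi\, d(\partial M,\mathscr C(K_A))}{|\partial M|+2\pi\, d(\partial M,\mathscr C(K_A))}>A$, where $|\partial M|$ is the length of $\partial M$ and $d$ the distance between sets. 2. For all $0\le n\le m$ and $(\{y_a\}_1^n,\{z_a\}_1^n)\in K_A^n\times K_A^n$, the function $H(\lambda)=\sum_{a=1}^n\frac1{\lambda-y_a}-\frac1{\lambda-z_a}$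 belongs to $\mathcal O(M)$ and $\|H\|_{\mathscr C(K_A)}<C_{\mathscr G_A}$. 3. For all $\beta\in\widetilde U_{\beta_0}$ and $\varpi\in\mathcal O(M)$ with $\|\varpi\|_{\mathscr C(K_A)}\le C_{\mathscr G_A}$, one has $\|\widetilde\gamma_0G_\beta[\varpi]\|_{U_\delta}<\frac12$, and $G_\beta[\varpi]$ has no zero in $U_\delta$ (so that the kernels are well defined). 4. For all $\beta\in\widetilde U_{\beta_0}$ and $|\gamma|\le\widetilde\gamma_0$, the functional $\mathscr G^{(\beta)}_{\gamma;A}$ is regular with respect to $(M,\mathscr C(K_A))$, with constant of regularity $C_{\mathscr G_A}$. 5. For all $\beta\in\widetilde U_{\beta_0}$, $|\gamma|\le\widetilde\gamma_0$, $0\le n\le m$ and $(\{y_a\}_1^n,\{z_a\}_1^n)\in K_A^n\times K_A^n$, $$\mathcal G^{(\beta)}_{n;\gamma}\binom{\{y_a\}_1^n}{\{z_a\}_1^n}=\mathscr G^{(\beta)}_{\gamma;A}\big[H\big],$$ for every $\varepsilon>0$ with all $z_a\in K_{q+\varepsilon}$ and every loop $\mathscr C_{q+\varepsilon}\subset U_\delta$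 around $K_{q+\varepsilon}$ used on the left. -/

import Mathlib

open scoped ENNReal

noncomputable section

namespace NLS

/-! ### Domains in the complex plane -/

/-- The open strip `U_δ` of half-width `2 δ` around the real axis. -/
def strip (δ : ℝ) : Set ℂ := {z | |z.im| < 2 * δ}

/-- The compact rectangle `K_A`. -/
def rect (δ A : ℝ) : Set ℂ := {z | |z.im| ≤ δ ∧ |z.re| ≤ A}

/-- The real interval `[-q, q]`, as a subset of the complex plane. -/
def fermiZone (q : ℝ) : Set ℂ := (fun x : ℝ => (x : ℂ)) '' Set.Icc (-q) q

/-- The domain of the regularising parameter `β` attached to `β₀`. -/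
def betaDomain (β₀ : ℂ) : Set ℂ :=
  {z | β₀.re ≤ z.re ∧ z.re ≤ 10 * β₀.re ∧ |z.im| ≤ β₀.im}

/-- Supremum norm `‖f‖_S`, with values in `[0, ∞]`. -/
def supNorm {α : Type*} (S : Set α) (f : α → ℂ) : ℝ≥0∞ := ⨆ x ∈ S, ‖f x‖ₑ

/-- `f` is holomorphic on (an open neighbourhood of) the set `M`. -/
def HolomorphicOn (M : Set ℂ) (f : ℂ → ℂ) : Prop :=
  ∃ O : Set ℂ, IsOpen O ∧ M ⊆ O ∧ DifferentiableOn ℂ f O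

/-! ### Loops -/

/-- `Γ` is a smooth regular 1-periodic parametrisation of a Jordan curve. -/
structure IsSmoothLoop (Γ : ℝ → ℂ) : Prop where
  smooth : ContDiff ℝ (⊤ : ℕ∞) Γ
  periodic : Function.Periodic Γ 1
  simple : Set.InjOn Γ (Set.Ico 0 1)
  regular : ∀ t, deriv Γ t ≠ 0

/-- The contour integral of `f` along the loop `Γ`. -/
def loopInt (Γ : ℝ → ℂ) (f : ℂ → ℂ) : ℂ := ∫ t in (0 : ℝ)..1, f (Γ t) * deriv Γ t

/-- The length of a loop. -/
def loopLength (Γ : ℝ → ℂ) : ℝ := ∫ t in (0 : ℝ)..1, ‖deriv Γ t‖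

/-- The points around which `Γ` winds once counterclockwise; for a counterclockwise Jordan curve
this is the bounded component of its complement. -/
def inside (Γ : ℝ → ℂ) : Set ℂ :=
  {w | w ∉ Set.range Γ ∧ (2 * Real.pi * Complex.I)⁻¹ * loopInt Γ (fun z => (z - w)⁻¹) = 1}

/-- `Γ` is a counterclockwise smooth loop in `U` around the set `S`. -/
structure IsLoopAround (U S : Set ℂ) (Γ : ℝ → ℂ) : Prop where
  loop : IsSmoothLoop Γ
  subset : Set.range Γ ⊆ U
  around : S ⊆ inside Γ

/-- The closed region delimited by the outer loop `Γout` and the inner loop `Γin`. -/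
def annulus (Γin Γout : ℝ → ℂ) : Set ℂ := (Set.range Γout ∪ inside Γout) \ inside Γin

/-- The distance between two sets. -/
def setDist (S T : Set ℂ) : ℝ := sInf (Set.image2 dist S T)

/-! ### Regular functionals -/

/-- `F` is a regular functional with respect to the pair of compacts `(M, K)`, with constant of
regularity `C` (case of no auxiliary parameters). -/
structure IsRegularFunctional (M K : Set ℂ) (C : ℝ) (F : (ℂ → ℂ) → ℂ) : Prop where
  compact_left : IsCompact M
  compact_right : IsCompact K
  subset_interior : K ⊆ interior M
  pos : 0 < C
  lipschitz : ∃ C' : ℝ, 0 < C' ∧ ∀ f g : ℂ → ℂ, HolomorphicOn M f → HolomorphicOn M g →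
    supNorm K f + supNorm K g < ENNReal.ofReal C →
      ‖F f - F g‖ₑ ≤ ENNReal.ofReal C' * supNorm K (f - g)
  holomorphic : ∀ (ℓ : ℕ) (W : Set (Fin ℓ → ℂ)) (ν : ℂ → (Fin ℓ → ℂ) → ℂ),
    IsOpen W → (0 : Fin ℓ → ℂ) ∈ W →
    (∃ O : Set (ℂ × (Fin ℓ → ℂ)), IsOpen O ∧ M ×ˢ W ⊆ O ∧
      DifferentiableOn ℂ (fun p => ν p.1 p.2) O) →
    supNorm (K ×ˢ W) (fun p => ν p.1 p.2) < ENNReal.ofReal C →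
      DifferentiableOn ℂ (fun w => F (fun x => ν x w)) W

/-! ### Fredholm determinants -/

/-- Fredholm determinant `det [I + k]` of the integral operator on `L²([a, b])` with kernel `k`. -/
def fredholmDet (a b : ℝ) (k : ℝ → ℝ → ℂ) : ℂ :=
  ∑' n : ℕ, ((n.factorial : ℂ))⁻¹ *
    ∫ t in Set.univ.pi (fun _ : Fin n => Set.Icc a b),
      Matrix.det (Matrix.of fun i j : Fin n => k (t i) (t j))

/-- Fredholm determinant `det_Γ [I + V]` of the integral operator
`f ↦ (ω ↦ ∮_Γ V(ω, ω') f(ω') dω')` on the loop `Γ`. -/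
def loopFredholmDet (Γ : ℝ → ℂ) (V : ℂ → ℂ → ℂ) : ℂ :=
  fredholmDet 0 1 (fun s t => V (Γ s) (Γ t) * deriv Γ t)

/-! ### The Lieb kernel and the functions dressed by it -/

/-- The Lieb kernel `K = θ'`. -/
def liebK (c : ℝ) (x : ℂ) : ℂ := 2 * c / (x ^ 2 + (c : ℂ) ^ 2)

/-- The bare phase. -/
def bareTheta (c : ℝ) (x : ℂ) : ℂ :=
  Complex.I * Complex.log ((Complex.I * c + x) / (Complex.I * c - x))

/-- `f` solves `f(x) - ∫_{-q}^{q} K(x - τ) f(τ) dτ / 2π = g(x)` on `[-q, q]`, and in the strip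
`|Im x| < c` on which the kernel is holomorphic. -/
structure IsLiebSolution (c q : ℝ) (g f : ℂ → ℂ) : Prop where
  cont : ContinuousOn (fun x : ℝ => f x) (Set.Icc (-q) q)
  eqn : ∀ x : ℂ, |x.im| < c →
    f x - (∫ τ in (-q)..q, liebK c (x - τ) * f τ) / (2 * Real.pi) = g x

/-- The solution of the linear integral equation with driving term `g`; see `liebSolve_spec` and
`IsLiebSolution.unique` for existence and uniqueness. -/
def liebSolve (c q : ℝ) (g : ℂ → ℂ) : ℂ → ℂ := Classical.epsilon (IsLiebSolution c q g)

/-- The dressed charge `Z`. -/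
def dressedCharge (c q : ℝ) : ℂ → ℂ := liebSolve c q (fun _ => 1)

/-- The dressed phase `φ(x, y)`. -/
def dressedPhase (c q : ℝ) (x y : ℂ) : ℂ :=
  liebSolve c q (fun x' => bareTheta c (x' - y) / (2 * Real.pi)) x

/-- The thermodynamic limit `F_β` of the shift function, for particles at `y` and holes at `z`. -/
def shiftFunction (c q : ℝ) (β : ℂ) {n : ℕ} (y z : Fin n → ℂ) : ℂ → ℂ :=
  liebSolve c q (fun x => Complex.I * β - 1 / 2 - bareTheta c (x - q) / (2 * Real.pi)
    - (2 * Real.pi : ℂ)⁻¹ * ∑ a, (bareTheta c (x - y a) - bareTheta c (x - z a)))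

/-- `det [I - K / 2π]` on `[-q, q]`. -/
def liebDet (c q : ℝ) : ℂ :=
  fredholmDet (-q) q (fun s t => -(liebK c ((s : ℂ) - (t : ℂ)) / (2 * Real.pi)))

/-- The Cauchy transform on `[-q, q]`. -/
def cauchyT (q : ℝ) (ν : ℂ → ℂ) (x : ℂ) : ℂ :=
  (2 * Real.pi * Complex.I)⁻¹ * ∫ μ in (-q)..q, ν μ / (μ - x)

/-- The double integral `C₀[ν]`. -/
def cauchyC0 (c q : ℝ) (ν : ℂ → ℂ) : ℂ :=
  -∫ x in (-q)..q, ∫ y in (-q)..q, ν x * ν y / ((x : ℂ) - y - Complex.I * c) ^ 2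

/-- `γ / (exp (-2 i π ε γ x) - 1)`, extended continuously to `γ = 0`. -/
def expRatio (ε γ x : ℂ) : ℂ :=
  if γ = 0 then (-(2 * Real.pi * Complex.I * ε * x))⁻¹
  else γ / (Complex.exp (-(2 * Real.pi * Complex.I * ε * γ * x)) - 1)

/-- The factor common to all kernels: for `ε = 1` (resp. `ε = -1`) it is `γ` times the kernel
`𝒱[γ F]` (resp. its barred companion) without the factor that depends on the positions of the
particles and holes. -/
def baseKernel (c q : ℝ) (ε γ : ℂ) (F : ℂ → ℂ) (ω ω' : ℂ) : ℂ :=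
  -(ε / (2 * Real.pi)) * ((ω - q) / (ω - q + ε * Complex.I * c))
    * Complex.exp (2 * Real.pi * Complex.I * cauchyT q (fun x => γ * F x) ω
        - 2 * Real.pi * Complex.I * cauchyT q (fun x => γ * F x) (ω + ε * Complex.I * c))
    * liebK c (ω - ω') * expRatio ε γ (F ω)

/-! ### The smooth part of the form factor -/

/-- The kernel `γ 𝒱[γ F_β]` (`ε = 1`) and its barred companion (`ε = -1`). -/
def formFactorKernel (c q : ℝ) (ε γ β : ℂ) {n : ℕ} (y z : Fin n → ℂ) (ω ω' : ℂ) : ℂ :=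
  (∏ a, ((ω - y a) * (ω - z a + ε * Complex.I * c))
      / ((ω - z a) * (ω - y a + ε * Complex.I * c)))
    * baseKernel c q ε γ (shiftFunction c q β y z) ω ω'

/-- The thermodynamic smooth part `𝒢_{n;γ}^{(β)}` of the form factor, with particles at `y` and
holes at `z`; the Fredholm determinants act on the loop `Γ`. -/
def smoothPart (c q : ℝ) (Γ : ℝ → ℂ) (γ β : ℂ) {n : ℕ} (y z : Fin n → ℂ) : ℂ :=
  let ν : ℂ → ℂ := fun x => γ * shiftFunction c q β y z x
  let E : ℂ → ℂ := fun x => Complex.exp (2 * Real.pi * Complex.I * cauchyT q ν x)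
  let factor : ℂ → ℂ := fun ε =>
    ∏ a, ((z a - q + ε * Complex.I * c) / (y a - q + ε * Complex.I * c))
      * (E (z a + ε * Complex.I * c) / E (y a + ε * Complex.I * c))
  Complex.exp (-(2 * Real.pi * Complex.I)
      * (cauchyT q ν (q + Complex.I * c) + cauchyT q ν (q - Complex.I * c)))
    * (factor 1 * factor (-1))
    * Complex.exp (cauchyC0 c q ν)
    * (∏ a, ∏ b, ((y a - z b - Complex.I * c) * (z a - y b - Complex.I * c))
        / ((y a - y b - Complex.I * c) * (z a - z b - Complex.I * c)))
    * (loopFredholmDet Γ (formFactorKernel c q 1 γ β y z)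
        * loopFredholmDet Γ (formFactorKernel c q (-1) γ β y z))
    / liebDet c q ^ 2

/-! ### The functional of one function -/

/-- The function `H`. -/
def rationalH {n : ℕ} (y z : Fin n → ℂ) (x : ℂ) : ℂ :=
  ∑ a, (1 / (x - y a) - 1 / (x - z a))

/-- The functional `G_β[ϖ]`; `Γ` is the loop `𝒞(K_A)`. -/
def shiftFunctional (c q : ℝ) (Γ : ℝ → ℂ) (β : ℂ) (ϖ : ℂ → ℂ) (x : ℂ) : ℂ :=
  (Complex.I * β - 1 / 2) * dressedCharge c q x - dressedPhase c q x q
    - (2 * Real.pi * Complex.I)⁻¹ * loopInt Γ (fun z => ϖ z * dressedPhase c q x z)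

/-- The determination of `ln ((ω - z) / (ω - z + i ε c))` used in the kernels. If `1 - z / ω`
avoids `(-∞, 0]` for all `z` inside a loop, it is holomorphic in such `z`. -/
def kernelLog (c : ℝ) (ε ω z : ℂ) : ℂ :=
  Complex.log ω + Complex.log (1 - z / ω) - Complex.log (ω - z + ε * Complex.I * c)

/-- The kernel `γ 𝒱[γ G_β, ϖ]` (`ε = 1`) and its barred companion (`ε = -1`). -/
def functionalKernel (c q : ℝ) (Γ : ℝ → ℂ) (ε γ β : ℂ) (ϖ : ℂ → ℂ) (ω ω' : ℂ) : ℂ :=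
  Complex.exp ((2 * Real.pi * Complex.I)⁻¹ * loopInt Γ (fun z => ϖ z * kernelLog c ε ω z))
    * baseKernel c q ε γ (shiftFunctional c q Γ β ϖ) ω ω'

/-- The functional `𝒢_{γ;A}^{(β)}[ϖ]`; `Γ` is the loop `𝒞(K_A)` and `ΓA` is the loop `𝒞_A` on which
the Fredholm determinants act. -/
def smoothFunctional (c q : ℝ) (Γ ΓA : ℝ → ℂ) (γ β : ℂ) (ϖ : ℂ → ℂ) : ℂ :=
  let ν : ℂ → ℂ := fun x => γ * shiftFunctional c q Γ β ϖ x
  let factor : ℂ → ℂ := fun ε =>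
    Complex.exp (-((2 * Real.pi * Complex.I)⁻¹ * loopInt Γ (fun z => ϖ z *
      (2 * Real.pi * Complex.I * cauchyT q ν (z + ε * Complex.I * c)
        + Complex.log (z - q + ε * Complex.I * c)))))
  Complex.exp (cauchyC0 c q ν)
    * (factor 1 * factor (-1))
    * Complex.exp (-((2 * Real.pi * Complex.I)⁻¹ ^ 2 *
        loopInt Γ (fun y => loopInt Γ (fun z =>
          ϖ y * ϖ z * Complex.log (z - y - Complex.I * c)))))
    * (loopFredholmDet ΓA (functionalKernel c q Γ 1 γ β ϖ)
        * loopFredholmDet ΓA (functionalKernel c q Γ (-1) γ β ϖ))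
    / (liebDet c q ^ 2 * Complex.exp (2 * Real.pi * Complex.I
        * (cauchyT q ν (q + Complex.I * c) + cauchyT q ν (q - Complex.I * c))))

/-- The geometry of the contours: `Γin`, `Γ = 𝒞(K_A)`, `Γout` are nested loops in the strip around
`K_A`, the compact delimited by `Γin` and `Γout` contains `Γ` in its interior and has the hole
`inside Γin ⊇ K_A`, and `ΓA = 𝒞_A` is a loop in the strip around `Γ` (and the Fermi zone). -/
structure IsContourSystem (q δ A : ℝ) (Γin Γ Γout ΓA : ℝ → ℂ) : Prop where
  loop_in : IsLoopAround (strip δ) (rect δ A) Γin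
  loop_mid : IsLoopAround (strip δ) (Set.range Γin ∪ inside Γin) Γ
  loop_out : IsLoopAround (strip δ) (Set.range Γ ∪ inside Γ) Γout
  loop_A : IsLoopAround (strip δ) (Set.range Γ ∪ inside Γ ∪ fermiZone q) ΓA
  annulus_subset : annulus Γin Γout ⊆ strip δ
  annulus_compact : IsCompact (annulus Γin Γout)
  annulus_frontier : frontier (annulus Γin Γout) = Set.range Γin ∪ Set.range Γout
  mid_subset : Set.range Γ ⊆ interior (annulus Γin Γout)
  log_domain : ∀ s : ℝ, ∀ z ∈ Set.range Γ ∪ inside Γ, 1 - z / ΓA s ∈ Complex.slitPlane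

/-! ### Existence and uniqueness for the linear integral equation -/

lemma liebK_real (c : ℝ) (x y : ℝ) :
    liebK c ((x : ℂ) - (y : ℂ)) = ((2 * c / ((x - y) ^ 2 + c ^ 2) : ℝ) : ℂ) := by
  simp [liebK]

lemma integral_liebK_le {c q : ℝ} (hc : 0 < c) {x : ℝ} (hx : x ∈ Set.Icc (-q) q) :
    ∫ τ in (-q)..q, 2 * c / ((x - τ) ^ 2 + c ^ 2) ≤ 4 * Real.arctan (2 * q / c) := by
  have h1 : ∀ τ : ℝ, 2 * c / ((x - τ) ^ 2 + c ^ 2)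
      = (2 / c) * (fun u : ℝ => (1 + u ^ 2)⁻¹) (τ / c - x / c) := by
    intro τ
    have : (x - τ) ^ 2 + c ^ 2 ≠ 0 := by positivity
    have h2 : 1 + (τ / c - x / c) ^ 2 ≠ 0 := by positivity
    have h3 : c ^ 2 + (τ - x) ^ 2 ≠ 0 := by positivity
    simp only
    rw [show τ / c - x / c = (τ - x) / c by ring]
    rw [show 1 + ((τ - x) / c) ^ 2 = (c ^ 2 + (τ - x) ^ 2) / c ^ 2 by field_simp]
    field_simp
    ring
  simp_rw [h1]
  rw [intervalIntegral.integral_const_mul,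
    intervalIntegral.integral_comp_div_sub (fun u : ℝ => (1 + u ^ 2)⁻¹) hc.ne' (x / c)]
  rw [integral_inv_one_add_sq, smul_eq_mul, ← mul_assoc,
    show 2 / c * c = 2 by field_simp]
  have ha : Real.arctan (q / c - x / c) ≤ Real.arctan (2 * q / c) := by
    apply Real.arctan_mono
    rw [← sub_div]
    gcongr
    linarith [hx.1]
  have hb : - Real.arctan (-q / c - x / c) ≤ Real.arctan (2 * q / c) := by
    rw [← Real.arctan_neg]
    apply Real.arctan_mono
    rw [← sub_div, ← neg_div]
    gcongr
    linarith [hx.2]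
  linarith

lemma continuous_liebK_real {c : ℝ} (hc : 0 < c) :
    Continuous (fun p : ℝ × ℝ => liebK c ((p.1 : ℂ) - (p.2 : ℂ))) := by
  simp_rw [liebK_real]
  refine Complex.continuous_ofReal.comp (Continuous.div (by fun_prop) (by fun_prop) ?_)
  intro p
  positivity

/-- The integral operator contracts the supremum norm on `[-q, q]`. -/
lemma lieb_norm_le {c q : ℝ} (hc : 0 < c) (hq : 0 < q) {h : ℝ → ℂ} {B : ℝ}
    (hB : ∀ τ ∈ Set.Icc (-q) q, ‖h τ‖ ≤ B) {x : ℝ} (hx : x ∈ Set.Icc (-q) q) :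
    ‖(∫ τ in (-q)..q, liebK c ((x : ℂ) - (τ : ℂ)) * h τ) / (2 * Real.pi)‖
      ≤ 2 * Real.arctan (2 * q / c) / Real.pi * B := by
  have hq' : -q ≤ q := by linarith
  have hB0 : 0 ≤ B := (norm_nonneg _).trans (hB x hx)
  have hcont : Continuous fun τ : ℝ => 2 * c / ((x - τ) ^ 2 + c ^ 2) :=
    Continuous.div (by fun_prop) (by fun_prop) (fun τ => by positivity)
  have key : ‖∫ τ in (-q)..q, liebK c ((x : ℂ) - (τ : ℂ)) * h τ‖
      ≤ ∫ τ in (-q)..q, 2 * c / ((x - τ) ^ 2 + c ^ 2) * B := by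
    apply intervalIntegral.norm_integral_le_of_norm_le hq'
    · refine Filter.Eventually.of_forall fun τ hτ => ?_
      rw [norm_mul, liebK_real, Complex.norm_real, Real.norm_of_nonneg (by positivity)]
      gcongr
      exact hB τ ⟨hτ.1.le, hτ.2⟩
    · exact (hcont.mul continuous_const).intervalIntegrable _ _
  rw [intervalIntegral.integral_mul_const] at key
  have h4 := integral_liebK_le hc hx
  rw [norm_div]
  have h2pi : ‖(2 * Real.pi : ℂ)‖ = 2 * Real.pi := by
    rw [norm_mul, Complex.norm_real, Real.norm_of_nonneg Real.pi_pos.le]; simp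
  rw [h2pi, div_le_iff₀ (by positivity)]
  calc _ ≤ 4 * Real.arctan (2 * q / c) * B := key.trans (by gcongr)
    _ = _ := by field_simp; ring

lemma lieb_ratio {c q : ℝ} (hc : 0 < c) (hq : 0 < q) :
    0 ≤ 2 * Real.arctan (2 * q / c) / Real.pi ∧ 2 * Real.arctan (2 * q / c) / Real.pi < 1 := by
  have h0 : 0 ≤ Real.arctan (2 * q / c) := Real.arctan_nonneg.2 (by positivity)
  refine ⟨by positivity, ?_⟩
  rw [div_lt_one Real.pi_pos]
  linarith [Real.arctan_lt_pi_div_two (2 * q / c)]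

/-- Existence of the solution of the linear integral equation. -/
theorem liebSolve_spec {c q : ℝ} (hc : 0 < c) (hq : 0 < q) {g : ℂ → ℂ}
    (hg : ContinuousOn (fun x : ℝ => g x) (Set.Icc (-q) q)) :
    IsLiebSolution c q g (liebSolve c q g) := by
  refine Classical.epsilon_spec (p := IsLiebSolution c q g) ?_
  have hq' : -q ≤ q := by linarith
  let T : C(Set.Icc (-q) q, ℂ) → C(Set.Icc (-q) q, ℂ) := fun u =>
    { toFun := fun x => g (x : ℝ) + (∫ τ in (-q)..q, liebK c (((x : ℝ) : ℂ) - (τ : ℂ))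
        * u (Set.projIcc (-q) q hq' τ)) / (2 * Real.pi)
      continuous_toFun := by
        refine Continuous.add (continuousOn_iff_continuous_domRestrict.1 hg) ?_
        refine Continuous.div_const ?_ _
        apply intervalIntegral.continuous_parametric_intervalIntegral_of_continuous'
        refine Continuous.mul ?_ ?_
        · exact (continuous_liebK_real hc).comp
            (f := fun p : Set.Icc (-q) q × ℝ => ((p.1 : ℝ), p.2)) (by fun_prop)
        · exact u.continuous.comp (continuous_projIcc.comp continuous_snd) }
  obtain ⟨hr0, hr1⟩ := lieb_ratio hc hq
  have hint : ∀ (u : C(Set.Icc (-q) q, ℂ)) (x : ℝ), IntervalIntegrable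
      (fun τ : ℝ => liebK c ((x : ℂ) - (τ : ℂ)) * u (Set.projIcc (-q) q hq' τ))
      MeasureTheory.volume (-q) q := by
    intro u x
    refine Continuous.intervalIntegrable (Continuous.mul ?_ ?_) _ _
    · exact (continuous_liebK_real hc).comp (f := fun τ : ℝ => (x, τ)) (by fun_prop)
    · exact u.continuous.comp continuous_projIcc
  have hT : ContractingWith ⟨_, hr0⟩ T := by
    refine ⟨by exact_mod_cast hr1, LipschitzWith.of_dist_le_mul fun u v => ?_⟩
    rw [ContinuousMap.dist_le (by positivity)]
    intro x
    have e : T u x - T v x = (∫ τ in (-q)..q, liebK c (((x : ℝ) : ℂ) - (τ : ℂ))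
        * (u (Set.projIcc (-q) q hq' τ) - v (Set.projIcc (-q) q hq' τ))) / (2 * Real.pi) := by
      simp only [T, ContinuousMap.coe_mk, mul_sub]
      rw [intervalIntegral.integral_sub (hint u x) (hint v x)]
      ring
    rw [dist_eq_norm, e]
    refine lieb_norm_le hc hq (B := dist u v) (fun τ _ => ?_) x.2
    rw [← dist_eq_norm]
    exact ContinuousMap.dist_apply_le_dist _
  obtain ⟨u, hu⟩ : ∃ u, T u = u := ⟨_, hT.fixedPoint_isFixedPt⟩
  let f : ℂ → ℂ := fun x => g x + (∫ τ in (-q)..q, liebK c (x - (τ : ℂ))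
        * u (Set.projIcc (-q) q hq' τ)) / (2 * Real.pi)
  have hf : ∀ x (hx : x ∈ Set.Icc (-q) q), f ((x : ℝ) : ℂ) = u ⟨x, hx⟩ := by
    intro x hx
    conv_rhs => rw [← hu]
    rfl
  refine ⟨f, ?_, ?_⟩
  · rw [continuousOn_iff_continuous_domRestrict]
    convert u.continuous using 1
    funext x
    exact hf x x.2
  · intro x _
    have : (∫ τ in (-q)..q, liebK c (x - (τ : ℂ)) * f τ)
        = ∫ τ in (-q)..q, liebK c (x - (τ : ℂ)) * u (Set.projIcc (-q) q hq' τ) := by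
      refine intervalIntegral.integral_congr fun τ hτ => ?_
      rw [Set.uIcc_of_le hq'] at hτ
      rw [hf τ hτ, Set.projIcc_of_mem hq' hτ]
    rw [this]
    simp [f]

/-- Uniqueness of the solution of the linear integral equation. -/
theorem IsLiebSolution.unique {c q : ℝ} (hc : 0 < c) (hq : 0 < q) {g f₁ f₂ : ℂ → ℂ}
    (h₁ : IsLiebSolution c q g f₁) (h₂ : IsLiebSolution c q g f₂) {x : ℂ} (hx : |x.im| < c) :
    f₁ x = f₂ x := by
  have hq' : -q ≤ q := by linarith
  obtain ⟨hr0, hr1⟩ := lieb_ratio hc hq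
  have real_eq : ∀ τ ∈ Set.Icc (-q) q, f₁ ((τ : ℝ) : ℂ) = f₂ (τ : ℂ) := by
    have hcont : ContinuousOn (fun τ : ℝ => ‖f₁ τ - f₂ τ‖) (Set.Icc (-q) q) :=
      (h₁.cont.sub h₂.cont).norm
    obtain ⟨t, ht, hmax⟩ := isCompact_Icc.exists_isMaxOn (Set.nonempty_Icc.2 hq') hcont
    have hint : ∀ f : ℂ → ℂ, ContinuousOn (fun x : ℝ => f x) (Set.Icc (-q) q) →
        IntervalIntegrable (fun τ : ℝ => liebK c ((t : ℂ) - (τ : ℂ)) * f τ)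
          MeasureTheory.volume (-q) q := by
      intro f hf
      refine ContinuousOn.intervalIntegrable ?_
      rw [Set.uIcc_of_le hq']
      exact (((continuous_liebK_real hc).comp (f := fun τ : ℝ => (t, τ))
        (by fun_prop)).continuousOn).mul hf
    have e : f₁ t - f₂ t = (∫ τ in (-q)..q, liebK c ((t : ℂ) - (τ : ℂ))
        * (f₁ τ - f₂ τ)) / (2 * Real.pi) := by
      have a1 := h₁.eqn t (by simpa using hc)
      have a2 := h₂.eqn t (by simpa using hc)
      simp only [mul_sub]
      rw [intervalIntegral.integral_sub (hint _ h₁.cont) (hint _ h₂.cont), sub_div]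
      linear_combination a1 - a2
    have hb := lieb_norm_le hc hq (h := fun τ : ℝ => f₁ τ - f₂ τ) (B := ‖f₁ t - f₂ t‖)
      (fun τ hτ => hmax hτ) ht
    rw [← e] at hb
    have h0 : ‖f₁ t - f₂ t‖ = 0 := by
      by_contra hne
      have hpos : 0 < ‖f₁ t - f₂ t‖ := lt_of_le_of_ne (norm_nonneg _) (Ne.symm hne)
      nlinarith
    intro τ hτ
    have := hmax hτ
    simp only [Set.mem_ofPred_eq] at this
    rw [h0] at this
    exact sub_eq_zero.1 (norm_le_zero_iff.1 this)
  have e1 := h₁.eqn x hx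
  have e2 := h₂.eqn x hx
  have : (∫ τ in (-q)..q, liebK c (x - τ) * f₁ τ) = ∫ τ in (-q)..q, liebK c (x - τ) * f₂ τ := by
    refine intervalIntegral.integral_congr fun τ hτ => ?_
    rw [Set.uIcc_of_le hq'] at hτ
    rw [real_eq τ hτ]
  rw [this] at e1
  linear_combination e1 - e2

end NLS

end

/-! Contours. They are ellipses centred at the origin with semi-axes proportional to `A + q` and
`δ`, the scaling factors lying between √2 and 2. Above √2 they surround the rectangle of half-sides
`A + q` and `δ`, hence `K_A` and the Fermi zone; below 2 they stay in the strip. The gauge of the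
ellipse makes the geometry explicit, and `inside` is a winding number condition, so the Jordan curve
theorem plays no role.

Regularity. The functional is assembled from values of the density on the loop by sums, products,
exponentials, integrals and Fredholm determinants. Two properties pass through all these operations
(`IsTame`): a uniform bound on densities of norm at most `R`, and holomorphy along holomorphic
families of densities. The bound and holomorphy for integrals come from
`differentiableOn_integral_of_bounded`, and for determinants from Hadamard's inequality. Regularity
with constant `R / 2` follows: holomorphy is built in, and the Lipschitz estimate is Schwarz's lemma
on the complex line through two densities (`IsTame.isRegularFunctional`).

The gap. The one factor of the kernels that can be singular is `expRatio`, which requires the shift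
functional `G` to stay away from 0 and `γ G` to stay small. In the strip the real part of the Lieb
kernel is nonnegative, and a minimum principle gives `Z ≥ 0` on `[-q, q]`; hence `Re Z ≥ 1` in the
strip. The leading term `(iβ - 1/2) Z` has modulus at least `Re β`, while the rest of `G` is bounded
independently of `β`. A large `Re β` thus gives `|G| ≥ 1`, and a small `γ`, depending on `β₀`, gives
`|γ G| ≤ 1/16` (`isGapped_of_le`).

The identity. For `ϖ = H` every loop integral of `H f` is `∑ (f (y a) - f (z a))`, by Cauchy's
formula in a convex domain. With `f` the dressed phase this turns `G` into the shift function, by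
linearity and uniqueness for the Lieb equation; with `f` a logarithm, exponentiation gives the
finite products of the form factor. The determinants still live on different loops. The form factor
kernel is holomorphic in the strip deprived of a rectangle that contains the Fermi zone and all `z
a`, and there a holomorphic function has a primitive up to a multiple of `1 / z`. So all loops
around the rectangle give the same integrals, and, one variable at a time, the same Fredholm
coefficients (`loopInt_eq_loopInt`, `loopFredholmDet_eq`). -/

noncomputable section

namespace NLS

open MeasureTheory Filter Topology Metric

/-! ### Holomorphic dependence of integrals on parameters. -/

section Parametric

variable {E : Type*} [NormedAddCommGroup E] [NormedSpace ℂ E]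

/-- A holomorphic function bounded by `B` on a ball of radius `2 r` is Lipschitz on the concentric
ball of radius `r`. -/
lemma norm_sub_le_of_bounded_ball {f : E → ℂ} {w₀ : E} {r B : ℝ} (hr : 0 < r)
    (hd : DifferentiableOn ℂ f (ball w₀ (2 * r))) (hB : ∀ w ∈ ball w₀ (2 * r), ‖f w‖ ≤ B)
    {z w : E} (hz : z ∈ ball w₀ r) (hw : w ∈ ball w₀ r) :
    ‖f z - f w‖ ≤ 4 * B / r * ‖z - w‖ := by
  have hB0 : 0 ≤ B := (norm_nonneg _).trans (hB w₀ (mem_ball_self (by positivity)))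
  have aux : ∀ {z w : E}, w ∈ ball w₀ r → dist z w < r → ‖f z - f w‖ ≤ 2 * B / r * ‖z - w‖ := by
    intro z w hw hzw
    have hsub : ball w r ⊆ ball w₀ (2 * r) := by
      refine ball_subset_ball' ?_
      rw [mem_ball] at hw; linarith
    have := Complex.dist_le_div_mul_dist_of_mapsTo_ball (R₂ := 2 * B) (hd.mono hsub)
      (fun u hu => by
        rw [mem_closedBall, dist_eq_norm]
        refine (norm_sub_le _ _).trans ?_
        linarith [hB u (hsub hu), hB w (hsub (mem_ball_self hr))]) (mem_ball.2 hzw)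
    simpa [dist_eq_norm] using this
  rcases lt_or_ge (dist z w) r with h | h
  · refine (aux hw h).trans ?_
    gcongr
    linarith
  -- For points at distance at least `r` the trivial bound `2 B` is already of Lipschitz form.
  · have h1 : ball w₀ r ⊆ ball w₀ (2 * r) := ball_subset_ball (by linarith)
    have h2 : ‖f z - f w‖ ≤ 2 * B := (norm_sub_le _ _).trans (by linarith [hB z (h1 hz), hB w (h1 hw)])
    refine h2.trans ?_
    rw [dist_eq_norm] at h
    calc 2 * B ≤ 4 * B / r * r := by field_simp; linarith
      _ ≤ _ := by gcongr

variable [FiniteDimensional ℂ E]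

/-- The integral of a bounded family of holomorphic functions is holomorphic. -/
theorem differentiableOn_integral_of_bounded {α : Type*} [MeasurableSpace α] {μ : Measure α}
    [IsFiniteMeasure μ] {U : Set E} (hU : IsOpen U) {f : E → α → ℂ} {B : ℝ}
    (hm : ∀ w ∈ U, AEStronglyMeasurable (f w) μ)
    (hB : ∀ᵐ t ∂μ, ∀ w ∈ U, ‖f w t‖ ≤ B)
    (hd : ∀ᵐ t ∂μ, DifferentiableOn ℂ (fun w => f w t) U) :
    DifferentiableOn ℂ (fun w => ∫ t, f w t ∂μ) U := by
  intro w₀ hw₀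
  obtain ⟨r', hr', hsub'⟩ := Metric.isOpen_iff.1 hU w₀ hw₀
  obtain ⟨r, hr, rfl⟩ : ∃ r, 0 < r ∧ r' = 2 * r := ⟨r' / 2, by positivity, by ring⟩
  have hfd : ∀ᵐ t ∂μ, HasFDerivAt (fun w => f w t) (fderiv ℂ (fun w => f w t) w₀) w₀ := by
    filter_upwards [hd] with t ht
    exact (ht.differentiableAt (hU.mem_nhds hw₀)).hasFDerivAt
  -- The derivative is measurable in `t`: each directional derivative is a limit of difference
  -- quotients, and finitely many of them in a basis determine the derivative. The choice of `ρ`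
  -- keeps every sampled point `w₀ + (cn n)⁻¹ • v` inside the ball on which `f` is controlled.
  have hmeas : AEStronglyMeasurable (fun t => fderiv ℂ (fun w => f w t) w₀) μ := by
    let b := Module.finBasis ℂ E
    have hcomp : ∀ v : E, AEStronglyMeasurable (fun t => fderiv ℂ (fun w => f w t) w₀ v) μ := by
      intro v
      let ρ : ℝ := r / (‖v‖ + 1)
      have hρ : 0 < ρ := by positivity
      let cn : ℕ → ℂ := fun n => (((n : ℝ) + 1) / ρ : ℝ)
      have hcn : ∀ n, ‖cn n‖ = ((n : ℝ) + 1) / ρ := fun n => by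
        simp only [cn, Complex.norm_real]
        exact Real.norm_of_nonneg (by positivity)
      have hlim : ∀ᵐ t ∂μ, Tendsto (fun n : ℕ => cn n • (f (w₀ + (cn n)⁻¹ • v) t - f w₀ t)) atTop
          (𝓝 (fderiv ℂ (fun w => f w t) w₀ v)) := by
        filter_upwards [hfd] with t ht
        refine ht.lim v ?_
        simp_rw [hcn]
        exact (tendsto_natCast_atTop_atTop.atTop_add tendsto_const_nhds).atTop_div_const hρ
      refine aestronglyMeasurable_of_tendsto_ae atTop (fun n => ?_) hlim
      refine ((hm _ (hsub' ?_)).sub (hm _ hw₀)).const_smul (cn n)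
      rw [mem_ball, dist_eq_norm, add_sub_cancel_left, norm_smul, norm_inv, hcn, inv_div]
      have h1 : ρ / ((n : ℝ) + 1) ≤ ρ := div_le_self hρ.le (by linarith [n.cast_nonneg (α := ℝ)])
      calc ρ / ((n : ℝ) + 1) * ‖v‖ ≤ ρ * (‖v‖ + 1) := by gcongr; linarith
        _ = r := by simp only [ρ]; field_simp
        _ < 2 * r := by linarith
    have : (fun t => fderiv ℂ (fun w => f w t) w₀) = fun t => ∑ i,
        (fderiv ℂ (fun w => f w t) w₀ (b i)) • LinearMap.toContinuousLinearMap (b.coord i) := by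
      funext t
      ext v
      conv_lhs => rw [← b.sum_repr v, map_sum]
      simp [mul_comm]
    rw [this]
    refine Finset.aestronglyMeasurable_fun_sum _ fun i _ => ?_
    exact (hcomp (b i)).smul_const _
  have key := hasFDerivAt_integral_of_dominated_loc_of_lip (𝕜 := ℂ) (μ := μ) (F := f)
    (F' := fun t => fderiv ℂ (fun w => f w t) w₀) (x₀ := w₀) (s := ball w₀ r)
    (bound := fun _ => 4 * B / r) (ball_mem_nhds _ hr) ?_ ?_ hmeas ?_ (integrable_const _) hfd
  · exact key.2.differentiableAt.differentiableWithinAt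
  · filter_upwards [hU.mem_nhds hw₀] with w hw using hm w hw
  · refine Integrable.of_bound (hm _ hw₀) B ?_
    filter_upwards [hB] with t ht using ht _ hw₀
  · filter_upwards [hB, hd] with t h1 h2
    refine LipschitzOnWith.of_dist_le_mul fun z hz w hw => ?_
    rw [dist_eq_norm, dist_eq_norm]
    refine (norm_sub_le_of_bounded_ball hr (h2.mono hsub') (fun w hw => h1 w (hsub' hw)) hz hw).trans ?_
    gcongr
    exact le_abs_self _

theorem differentiableOn_intervalIntegral_of_bounded {a b : ℝ} (hab : a ≤ b)
    {U : Set E} (hU : IsOpen U) {f : E → ℝ → ℂ} {B : ℝ}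
    (hm : ∀ w ∈ U, AEStronglyMeasurable (f w) (volume.restrict (Set.Icc a b)))
    (hB : ∀ t ∈ Set.Icc a b, ∀ w ∈ U, ‖f w t‖ ≤ B)
    (hd : ∀ t ∈ Set.Icc a b, DifferentiableOn ℂ (fun w => f w t) U) :
    DifferentiableOn ℂ (fun w => ∫ t in a..b, f w t) U := by
  simp_rw [intervalIntegral.integral_of_le hab, ← integral_Icc_eq_integral_Ioc]
  refine differentiableOn_integral_of_bounded hU hm (B := B) ?_ ?_
  · filter_upwards [ae_restrict_mem measurableSet_Icc] with t ht using hB t ht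
  · filter_upwards [ae_restrict_mem measurableSet_Icc] with t ht using hd t ht

end Parametric

/-! ### Convergence and holomorphy of Fredholm determinants. -/

section Fredholm

open scoped ComplexOrder in
/-- Hadamard's inequality for matrices with bounded entries. -/
lemma sq_norm_det_le {n : ℕ} (M : Matrix (Fin n) (Fin n) ℂ) {B : ℝ} (hM : ∀ i j, ‖M i j‖ ≤ B) :
    ‖M.det‖ ^ 2 ≤ (n * B ^ 2) ^ n := by
  rcases n.eq_zero_or_pos with rfl | hn
  · simp
  -- The eigenvalues of `M M*` are nonnegative, their product is `|det M|²` and their sum is the sum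
  -- of the squared moduli of the entries; the arithmetic-geometric mean inequality compares the
  -- two.
  obtain ⟨ev, hnn, h1, h2⟩ : ∃ ev : Fin n → ℝ, (∀ i, 0 ≤ ev i) ∧
      (M * M.conjTranspose).det = ∏ i, (ev i : ℂ) ∧
      (M * M.conjTranspose).trace = ∑ i, (ev i : ℂ) :=
    have hG : (M * M.conjTranspose).PosSemidef := Matrix.posSemidef_self_mul_conjTranspose M
    ⟨_, hG.eigenvalues_nonneg, hG.isHermitian.det_eq_prod_eigenvalues,
      hG.isHermitian.trace_eq_sum_eigenvalues⟩
  have hdet : ‖M.det‖ ^ 2 = ∏ i, ev i := by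
    rw [Matrix.det_mul, Matrix.det_conjTranspose, RCLike.star_def, Complex.mul_conj'] at h1
    exact_mod_cast h1
  have htr : ∑ i, ev i = ∑ i, ∑ j, ‖M i j‖ ^ 2 := by
    have h3 : (M * M.conjTranspose).trace = ((∑ i, ∑ j, ‖M i j‖ ^ 2 : ℝ) : ℂ) := by
      simp [Matrix.trace, Matrix.mul_apply, Complex.mul_conj']
    rw [h3] at h2
    exact_mod_cast h2.symm
  have hle : ∑ i, ev i ≤ n * (n * B ^ 2) := by
    rw [htr]
    calc ∑ i, ∑ j, ‖M i j‖ ^ 2 ≤ ∑ _i : Fin n, ∑ _j : Fin n, B ^ 2 := by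
          gcongr with i _ j _; exact hM i j
      _ = _ := by simp
  have hn' : (0 : ℝ) < n := by exact_mod_cast hn
  have amgm := Real.geom_mean_le_arith_mean Finset.univ (fun _ => (1 : ℝ)) ev
    (fun _ _ => zero_le_one) (by simpa using hn) (fun i _ => hnn i)
  have hP : 0 ≤ ∏ i, ev i := Finset.prod_nonneg fun i _ => hnn i
  simp only [Real.rpow_one, one_mul, Finset.sum_const, Finset.card_univ, Fintype.card_fin,
    nsmul_eq_mul, mul_one] at amgm
  rw [hdet]
  calc ∏ i, ev i = ((∏ i, ev i) ^ ((n : ℝ)⁻¹)) ^ n :=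
        (Real.rpow_inv_natCast_pow hP hn.ne').symm
    _ ≤ ((∑ i, ev i) / n) ^ n := by gcongr
    _ ≤ _ := by
      gcongr
      · exact div_nonneg (Finset.sum_nonneg fun i _ => hnn i) hn'.le
      · rw [div_le_iff₀ hn']; linarith

/-- The bound for the `n`-th term of a Fredholm series with kernel bounded by `B`. -/
def fredholmBound (B : ℝ) (n : ℕ) : ℝ :=
  ((4 * (Real.exp 1 * B ^ 2)) ^ n / n.factorial + (1 / 4) ^ n) / 2

lemma summable_fredholmBound (B : ℝ) : Summable (fredholmBound B) :=
  ((Real.summable_pow_div_factorial _).add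
    (summable_geometric_of_lt_one (by norm_num) (by norm_num))).div_const 2

/-- Hadamard and `n ^ n ≤ n! e ^ n` bound the square of the left side by `(e B²) ^ n / n!`. The
square root is avoided by `x = (2 ^ n x) (2 ^ n)⁻¹ ≤ ((2 ^ n x)² + 4 ^ (-n)) / 2`, which explains
the two summands of `fredholmBound`. -/
lemma norm_fredholm_term_le {n : ℕ} (M : Matrix (Fin n) (Fin n) ℂ) {B : ℝ}
    (hM : ∀ i j, ‖M i j‖ ≤ B) : ‖M.det‖ / n.factorial ≤ fredholmBound B n := by
  have h := sq_norm_det_le M hM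
  have hf : (0 : ℝ) < n.factorial := by exact_mod_cast n.factorial_pos
  have h1 : (n : ℝ) ^ n ≤ n.factorial * Real.exp 1 ^ n := by
    have := Real.pow_div_factorial_le_exp (n : ℝ) n.cast_nonneg n
    rw [div_le_iff₀ hf] at this
    rw [← Real.exp_nat_mul, mul_one]
    linarith
  have h2 : (‖M.det‖ / n.factorial) ^ 2 ≤ (Real.exp 1 * B ^ 2) ^ n / n.factorial := by
    rw [div_pow, div_le_div_iff₀ (by positivity) hf]
    calc ‖M.det‖ ^ 2 * n.factorial ≤ (n * B ^ 2) ^ n * n.factorial := by gcongr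
      _ = (n : ℝ) ^ n * (B ^ 2) ^ n * n.factorial := by rw [mul_pow]
      _ ≤ (n.factorial * Real.exp 1 ^ n) * (B ^ 2) ^ n * n.factorial := by gcongr
      _ = _ := by rw [mul_pow]; ring
  set x := ‖M.det‖ / n.factorial
  set y := (Real.exp 1 * B ^ 2) ^ n / n.factorial with hy
  have hp : (0:ℝ) < 2 ^ n := by positivity
  have e1 : (4 * (Real.exp 1 * B ^ 2)) ^ n / n.factorial = (2 ^ n) ^ 2 * y := by
    rw [hy, mul_pow, ← pow_mul, mul_comm n 2, pow_mul]; norm_num; ring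
  have e2 : ((1 : ℝ) / 4) ^ n = ((2 ^ n)⁻¹) ^ 2 := by
    rw [← inv_pow, ← pow_mul, mul_comm n 2, pow_mul]; norm_num
  rw [fredholmBound, e1, e2]
  have h3 : (2 ^ n * x) ^ 2 ≤ (2 ^ n) ^ 2 * y := by rw [mul_pow]; gcongr
  have h4 : (2 ^ n * x) * ((2 : ℝ) ^ n)⁻¹ = x := by field_simp
  nlinarith [sq_nonneg (2 ^ n * x - ((2 : ℝ) ^ n)⁻¹)]

lemma norm_fredholm_integrand_le {k : ℝ → ℝ → ℂ} {B : ℝ}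
    (hk : ∀ s ∈ Set.Icc (0 : ℝ) 1, ∀ t ∈ Set.Icc (0 : ℝ) 1, ‖k s t‖ ≤ B) (n : ℕ) :
    ‖((n.factorial : ℂ))⁻¹ * ∫ t in Set.univ.pi (fun _ : Fin n => Set.Icc (0 : ℝ) 1),
      Matrix.det (Matrix.of fun i j : Fin n => k (t i) (t j))‖ ≤ fredholmBound B n := by
  have hv : volume (Set.univ.pi (fun _ : Fin n => Set.Icc (0 : ℝ) 1)) = 1 := by
    rw [volume_pi_pi]; simp
  have hf : (0 : ℝ) < n.factorial := by exact_mod_cast n.factorial_pos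
  have := norm_setIntegral_le_of_norm_le_const (C := n.factorial * fredholmBound B n)
    (μ := volume) (s := Set.univ.pi (fun _ : Fin n => Set.Icc (0 : ℝ) 1))
    (f := fun t => Matrix.det (Matrix.of fun i j : Fin n => k (t i) (t j))) (by rw [hv]; simp)
    (fun t ht => by
      have := norm_fredholm_term_le (Matrix.of fun i j : Fin n => k (t i) (t j)) (B := B)
        (fun i j => hk _ (ht i trivial) _ (ht j trivial))
      rw [div_le_iff₀ hf] at this
      linarith)
  rw [Measure.real, hv] at this
  rw [norm_mul, norm_inv, Complex.norm_natCast, inv_mul_le_iff₀ hf]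
  simpa using this

lemma norm_fredholmDet_le {k : ℝ → ℝ → ℂ} {B : ℝ}
    (hk : ∀ s ∈ Set.Icc (0 : ℝ) 1, ∀ t ∈ Set.Icc (0 : ℝ) 1, ‖k s t‖ ≤ B) :
    ‖fredholmDet 0 1 k‖ ≤ ∑' n, fredholmBound B n :=
  tsum_of_norm_bounded (summable_fredholmBound B).hasSum (norm_fredholm_integrand_le hk)

/-- Each term of the series is an integral of a bounded holomorphic family. The summable bound on
the terms becomes, on a smaller ball, a summable bound on their derivatives, so the series can be
differentiated termwise. -/
theorem differentiableOn_fredholmDet {E : Type*} [NormedAddCommGroup E] [NormedSpace ℂ E]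
    [FiniteDimensional ℂ E] {U : Set E} (hU : IsOpen U) {k : E → ℝ → ℝ → ℂ} {B : ℝ}
    (hm : ∀ w ∈ U, Measurable fun p : ℝ × ℝ => k w p.1 p.2)
    (hk : ∀ w ∈ U, ∀ s ∈ Set.Icc (0 : ℝ) 1, ∀ t ∈ Set.Icc (0 : ℝ) 1, ‖k w s t‖ ≤ B)
    (hd : ∀ s ∈ Set.Icc (0 : ℝ) 1, ∀ t ∈ Set.Icc (0 : ℝ) 1,
      DifferentiableOn ℂ (fun w => k w s t) U) :
    DifferentiableOn ℂ (fun w => fredholmDet 0 1 (k w)) U := by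
  have hmeas : ∀ w ∈ U, ∀ n : ℕ, Measurable fun t : Fin n → ℝ =>
      Matrix.det (Matrix.of fun i j : Fin n => k w (t i) (t j)) := by
    intro w hw n
    simp_rw [Matrix.det_apply]
    refine Finset.measurable_fun_sum _ fun σ _ => ?_
    refine Measurable.const_smul (Finset.measurable_fun_prod _ fun i _ => ?_) _
    exact (hm w hw).comp (f := fun t : Fin n → ℝ => (t (σ i), t i)) (by fun_prop)
  have hterm : ∀ n : ℕ, DifferentiableOn ℂ (fun w => ((n.factorial : ℂ))⁻¹ *
      ∫ t in Set.univ.pi (fun _ : Fin n => Set.Icc (0 : ℝ) 1),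
        Matrix.det (Matrix.of fun i j : Fin n => k w (t i) (t j))) U := by
    intro n
    have hf : (0 : ℝ) < n.factorial := by exact_mod_cast n.factorial_pos
    have hS : MeasurableSet (Set.univ.pi (fun _ : Fin n => Set.Icc (0 : ℝ) 1)) :=
      MeasurableSet.univ_pi fun _ => measurableSet_Icc
    have : IsFiniteMeasure (volume.restrict (Set.univ.pi (fun _ : Fin n => Set.Icc (0 : ℝ) 1))) :=
      ⟨by rw [Measure.restrict_apply_univ, volume_pi_pi]; simp⟩
    refine DifferentiableOn.const_mul (differentiableOn_integral_of_bounded hU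
      (B := n.factorial * fredholmBound B n)
      (fun w hw => (hmeas w hw n).aestronglyMeasurable) ?_ ?_) _
    · filter_upwards [ae_restrict_mem hS] with t ht w hw
      have := norm_fredholm_term_le (Matrix.of fun i j : Fin n => k w (t i) (t j)) (B := B)
        (fun i j => hk w hw _ (ht i trivial) _ (ht j trivial))
      rw [div_le_iff₀ hf] at this
      linarith
    · filter_upwards [ae_restrict_mem hS] with t ht
      simp_rw [Matrix.det_apply]
      refine DifferentiableOn.fun_sum fun σ _ => ?_
      refine DifferentiableOn.const_smul (fun w hw => ?_) _
      exact (HasFDerivWithinAt.finsetProd fun i _ =>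
        (hd _ (ht (σ i) trivial) _ (ht i trivial) w hw).hasFDerivWithinAt).differentiableWithinAt
  intro w₀ hw₀
  obtain ⟨r', hr', hsub'⟩ := Metric.isOpen_iff.1 hU w₀ hw₀
  obtain ⟨r, hr, rfl⟩ : ∃ r, 0 < r ∧ r' = 2 * r := ⟨r' / 2, by positivity, by ring⟩
  have hsub : ball w₀ r ⊆ ball w₀ (2 * r) := ball_subset_ball (by linarith)
  have hfd : ∀ (n : ℕ), ∀ w ∈ ball w₀ r, HasFDerivAt _ _ w := fun n w hw =>
    ((hterm n).differentiableAt (hU.mem_nhds (hsub' (hsub hw)))).hasFDerivAt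
  have := hasFDerivAt_tsum_of_isPreconnected (𝕜 := ℂ)
    (((summable_fredholmBound B).mul_left 4).div_const r) isOpen_ball
    (convex_ball w₀ r).isPreconnected hfd (fun n w hw => ?_) (mem_ball_self hr)
    (Summable.of_norm_bounded (summable_fredholmBound B)
      (norm_fredholm_integrand_le (hk w₀ hw₀))) (mem_ball_self hr)
  · exact this.differentiableAt.differentiableWithinAt
  · have hB0 : 0 ≤ fredholmBound B n := by rw [fredholmBound]; positivity
    refine (hfd n w hw).le_of_lipschitzOn (C := ⟨4 * fredholmBound B n / r, by positivity⟩)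
      (isOpen_ball.mem_nhds hw) (LipschitzOnWith.of_dist_le_mul fun z hz u hu => ?_)
    rw [dist_eq_norm, dist_eq_norm]
    exact norm_sub_le_of_bounded_ball hr ((hterm n).mono hsub')
      (fun w hw => norm_fredholm_integrand_le (hk w (hsub' hw)) n) hz hu

end Fredholm

/-! ### Contour integrals and Cauchy's formula in convex domains. -/

section Loops

/-- A continuously differentiable closed curve. -/
structure IsClosedCurve (Γ : ℝ → ℂ) : Prop where
  contDiff : ContDiff ℝ 1 Γ
  closed : Γ 1 = Γ 0

lemma IsSmoothLoop.isClosedCurve {Γ : ℝ → ℂ} (h : IsSmoothLoop Γ) : IsClosedCurve Γ :=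
  ⟨h.smooth.of_le (by exact_mod_cast le_top), by simpa using h.periodic 0⟩

namespace IsClosedCurve

variable {Γ : ℝ → ℂ} (h : IsClosedCurve Γ)
include h

lemma continuous : Continuous Γ := h.contDiff.continuous

lemma continuous_deriv : Continuous (deriv Γ) := h.contDiff.continuous_deriv le_rfl

lemma hasDerivAt (t : ℝ) : HasDerivAt Γ (deriv Γ t) t :=
  (h.contDiff.differentiable one_ne_zero t).hasDerivAt

lemma intervalIntegrable {f : ℂ → ℂ} (hf : ContinuousOn f (Set.range Γ)) (a b : ℝ) :
    IntervalIntegrable (fun t => f (Γ t) * deriv Γ t) volume a b :=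
  ((hf.comp_continuous h.continuous fun t => ⟨t, rfl⟩).mul h.continuous_deriv).intervalIntegrable _ _

lemma loopInt_sub {f g : ℂ → ℂ} (hf : ContinuousOn f (Set.range Γ))
    (hg : ContinuousOn g (Set.range Γ)) :
    loopInt Γ (fun z => f z - g z) = loopInt Γ f - loopInt Γ g := by
  simp only [loopInt, sub_mul]
  exact intervalIntegral.integral_sub (h.intervalIntegrable hf _ _) (h.intervalIntegrable hg _ _)

lemma loopInt_sum {ι : Type*} (s : Finset ι) {f : ι → ℂ → ℂ}
    (hf : ∀ i ∈ s, ContinuousOn (f i) (Set.range Γ)) :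
    loopInt Γ (fun z => ∑ i ∈ s, f i z) = ∑ i ∈ s, loopInt Γ (f i) := by
  simp only [loopInt, Finset.sum_mul]
  exact intervalIntegral.integral_finsetSum fun i hi => h.intervalIntegrable (hf i hi) _ _

/-- The integral of a derivative over a closed curve vanishes. -/
lemma loopInt_eq_zero {f g : ℂ → ℂ} {U : Set ℂ} (hU : Set.range Γ ⊆ U)
    (hg : ∀ z ∈ U, HasDerivAt g (f z) z) (hf : ContinuousOn f U) : loopInt Γ f = 0 := by
  have := intervalIntegral.integral_eq_sub_of_hasDerivAt (a := 0) (b := 1)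
    (f := fun t => g (Γ t)) (f' := fun t => f (Γ t) * deriv Γ t)
    (fun t _ => (hg _ (hU ⟨t, rfl⟩)).comp_of_eq t (h.hasDerivAt t) rfl)
    (h.intervalIntegrable (hf.mono hU) _ _)
  rw [loopInt, this, h.closed, sub_self]

end IsClosedCurve

lemma loopInt_congr {Γ : ℝ → ℂ} {f g : ℂ → ℂ} (h : Set.EqOn f g (Set.range Γ)) :
    loopInt Γ f = loopInt Γ g := by
  simp only [loopInt]
  exact intervalIntegral.integral_congr fun t _ => by simp [h ⟨t, rfl⟩]

lemma loopInt_const_mul (Γ : ℝ → ℂ) (a : ℂ) (f : ℂ → ℂ) :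
    loopInt Γ (fun z => a * f z) = a * loopInt Γ f := by
  simp only [loopInt, mul_assoc, intervalIntegral.integral_const_mul]

lemma exists_primitive_of_convex {U : Set ℂ} (hU : IsOpen U) (hc : Convex ℝ U) {f : ℂ → ℂ}
    (hf : DifferentiableOn ℂ f U) : ∃ g : ℂ → ℂ, ∀ z ∈ U, HasDerivAt g (f z) z := by
  obtain ⟨g, hg⟩ := hc.exists_forall_hasDerivWithinAt hf
  exact ⟨g, fun z hz => (hg z hz).hasDerivAt (hU.mem_nhds hz)⟩

/-- Cauchy's integral formula for a loop in a convex open set. -/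
theorem cauchy_formula {Γ : ℝ → ℂ} (hΓ : IsClosedCurve Γ) {U : Set ℂ} (hU : IsOpen U)
    (hc : Convex ℝ U) (hΓU : Set.range Γ ⊆ U) {f : ℂ → ℂ} (hf : DifferentiableOn ℂ f U) {w : ℂ}
    (hwU : w ∈ U) (hw : w ∈ inside Γ) :
    (2 * Real.pi * Complex.I)⁻¹ * loopInt Γ (fun z => 1 / (z - w) * f z) = f w := by
  -- The slope of `f` at `w` extends holomorphically over `w`, so it has a primitive on the convex
  -- set `U` and integrates to zero. What remains is `f w` times the winding number, which is 1 by
  -- the definition of `inside`.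
  have hd : DifferentiableOn ℂ (dslope f w) U :=
    (Complex.differentiableOn_dslope (hU.mem_nhds hwU)).2 hf
  obtain ⟨g, hg⟩ := exists_primitive_of_convex hU hc hd
  have h0 := hΓ.loopInt_eq_zero hΓU hg hd.continuousOn
  have hne : ∀ z ∈ Set.range Γ, z - w ≠ 0 := fun z hz h =>
    hw.1 (by rwa [← sub_eq_zero.1 h])
  have hc1 : ContinuousOn (fun z : ℂ => (z - w)⁻¹) (Set.range Γ) :=
    (by fun_prop : ContinuousOn (fun z : ℂ => z - w) _).inv₀ hne
  have heq : Set.EqOn (dslope f w) (fun z => 1 / (z - w) * f z - f w * (z - w)⁻¹)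
      (Set.range Γ) := by
    intro z hz
    have hzw : z ≠ w := fun h => hne z hz (by simp [h])
    rw [dslope_of_ne _ hzw, slope_def_field]
    have := hne z hz
    field_simp
  rw [loopInt_congr heq, hΓ.loopInt_sub (g := fun z => f w * (z - w)⁻¹) ?_ (continuousOn_const.mul hc1), loopInt_const_mul,
    sub_eq_zero] at h0
  · rw [h0, mul_left_comm, hw.2, mul_one]
  · simp_rw [one_div]
    exact hc1.mul (hf.continuousOn.mono hΓU)

end Loops

/-! ### Cauchy's theorem in the strip without a rectangle. -/

section Annular

lemma exists_sub_eq_const {S : Set ℂ} (hS : IsOpen S) (hS' : Convex ℝ S) {f P Q : ℂ → ℂ}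
    (hP : ∀ z ∈ S, HasDerivAt P (f z) z) (hQ : ∀ z ∈ S, HasDerivAt Q (f z) z) :
    ∃ k, ∀ z ∈ S, P z - Q z = k := by
  have hd : ∀ z ∈ S, HasDerivAt (fun z => P z - Q z) 0 z := fun z hz =>
    (sub_self (f z)) ▸ (hP z hz).sub (hQ z hz)
  exact hS.exists_is_const_of_deriv_eq_zero hS'.isPreconnected
    (fun z hz => (hd z hz).differentiableAt.differentiableWithinAt) fun z hz => (hd z hz).deriv

/-- Primitives that differ by a constant on the intersection of their domains can be glued. -/
lemma exists_primitive_union {U V : Set ℂ} (hU : IsOpen U) (hV : IsOpen V) {f P Q : ℂ → ℂ} {k : ℂ}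
    (hP : ∀ z ∈ U, HasDerivAt P (f z) z) (hQ : ∀ z ∈ V, HasDerivAt Q (f z) z)
    (hk : ∀ z ∈ U ∩ V, P z - Q z = k) :
    ∃ R : ℂ → ℂ, (∀ z ∈ U, R z = P z) ∧ ∀ z ∈ U ∪ V, HasDerivAt R (f z) z := by
  classical
  refine ⟨fun z => if z ∈ U then P z else Q z + k, fun z hz => if_pos hz, fun z hz => ?_⟩
  by_cases hzU : z ∈ U
  · refine (hP z hzU).congr_of_eventuallyEq ?_
    filter_upwards [hU.mem_nhds hzU] with u hu using if_pos hu
  · have hzV := hz.resolve_left hzU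
    refine ((hQ z hzV).add_const k).congr_of_eventuallyEq ?_
    filter_upwards [hV.mem_nhds hzV] with u hu
    split_ifs with h
    · rw [← hk u ⟨h, hu⟩]; ring
    · rfl

/-- The strip without a rectangle around the origin. -/
def puncturedStrip (δ B : ℝ) : Set ℂ := strip δ \ rect δ B

lemma isOpen_strip (δ : ℝ) : IsOpen (strip δ) :=
  isOpen_lt (by fun_prop) (by fun_prop)

lemma convex_strip (δ : ℝ) : Convex ℝ (strip δ) := by
  have : strip δ = Complex.imLm ⁻¹' Set.Ioo (-(2 * δ)) (2 * δ) := by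
    ext z; simp [strip, abs_lt]
  rw [this]
  exact (convex_Ioo _ _).linear_preimage _

lemma isClosed_rect (δ A : ℝ) : IsClosed (rect δ A) :=
  IsClosed.inter (s₁ := {z : ℂ | |z.im| ≤ δ}) (s₂ := {z : ℂ | |z.re| ≤ A})
    (isClosed_le (by fun_prop) (by fun_prop)) (isClosed_le (by fun_prop) (by fun_prop))

lemma isOpen_puncturedStrip (δ B : ℝ) : IsOpen (puncturedStrip δ B) :=
  (isOpen_strip δ).sdiff (isClosed_rect δ B)

/-- The punctured strip is covered by four convex pieces: above, left of, below and right of the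
rectangle. The first three overlap in a chain (above and below are disjoint), so their primitives
glue to `P`. The piece on the right meets this chain in two separate corners, and `k - l` is the
monodromy of the primitive around the rectangle. -/
lemma exists_primitive_cut {δ B : ℝ} (hδ : 0 < δ) {f : ℂ → ℂ}
    (hf : DifferentiableOn ℂ f (puncturedStrip δ B)) :
    ∃ (P Q : ℂ → ℂ) (k l : ℂ),
      (∀ z ∈ strip δ ∩ ({z | δ < z.im} ∪ {z | z.re < -B} ∪ {z | z.im < -δ}),
        HasDerivAt P (f z) z) ∧
      (∀ z ∈ strip δ ∩ {z | B < z.re}, HasDerivAt Q (f z) z) ∧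
      (∀ z ∈ strip δ ∩ ({z | δ < z.im} ∩ {z | B < z.re}), P z - Q z = k) ∧
      (∀ z ∈ strip δ ∩ ({z | z.im < -δ} ∩ {z | B < z.re}), P z - Q z = l) := by
  have oS := isOpen_strip δ
  have cS := convex_strip δ
  have o1 : IsOpen {z : ℂ | δ < z.im} := isOpen_lt (by fun_prop) (by fun_prop)
  have o2 : IsOpen {z : ℂ | z.re < -B} := isOpen_lt (by fun_prop) (by fun_prop)
  have o3 : IsOpen {z : ℂ | z.im < -δ} := isOpen_lt (by fun_prop) (by fun_prop)
  have o4 : IsOpen {z : ℂ | B < z.re} := isOpen_lt (by fun_prop) (by fun_prop)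
  have c1 : Convex ℝ {z : ℂ | δ < z.im} := convex_halfSpace_im_gt δ
  have c2 : Convex ℝ {z : ℂ | z.re < -B} := convex_halfSpace_re_lt (-B)
  have c3 : Convex ℝ {z : ℂ | z.im < -δ} := convex_halfSpace_im_lt (-δ)
  have c4 : Convex ℝ {z : ℂ | B < z.re} := convex_halfSpace_re_gt B
  have prim : ∀ {H : Set ℂ}, IsOpen H → Convex ℝ H → (∀ z ∈ H, z ∉ rect δ B) →
      ∃ P : ℂ → ℂ, ∀ z ∈ strip δ ∩ H, HasDerivAt P (f z) z := fun ho hc hn =>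
    exists_primitive_of_convex (oS.inter ho) (cS.inter hc)
      (hf.mono fun z hz => ⟨hz.1, hn z hz.2⟩)
  obtain ⟨P1, h1⟩ := prim o1 c1 fun z hz h => by
    have := (abs_le.1 h.1).2; simp only [Set.mem_ofPred_eq] at hz; linarith
  obtain ⟨P2, h2⟩ := prim o2 c2 fun z hz h => by
    have := (abs_le.1 h.2).1; simp only [Set.mem_ofPred_eq] at hz; linarith
  obtain ⟨P3, h3⟩ := prim o3 c3 fun z hz h => by
    have := (abs_le.1 h.1).1; simp only [Set.mem_ofPred_eq] at hz; linarith
  obtain ⟨Q, h4⟩ := prim o4 c4 fun z hz h => by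
    have := (abs_le.1 h.2).2; simp only [Set.mem_ofPred_eq] at hz; linarith
  obtain ⟨k1, hk1⟩ := exists_sub_eq_const ((oS.inter o1).inter (oS.inter o2))
    ((cS.inter c1).inter (cS.inter c2)) (fun z hz => h1 z hz.1) (fun z hz => h2 z hz.2)
  obtain ⟨R, -, hR⟩ := exists_primitive_union (oS.inter o1) (oS.inter o2) h1 h2 hk1
  obtain ⟨k2, hk2⟩ := exists_sub_eq_const ((oS.inter o2).inter (oS.inter o3))
    ((cS.inter c2).inter (cS.inter c3)) (fun z hz => hR z (Or.inr hz.1)) (fun z hz => h3 z hz.2)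
  obtain ⟨P, -, hP⟩ := exists_primitive_union ((oS.inter o1).union (oS.inter o2))
    (oS.inter o3) hR h3 (k := k2) (by
      rintro z ⟨hz | hz, hz'⟩
      · have h1 := hz.2
        have h2 := hz'.2
        simp only [Set.mem_ofPred_eq] at h1 h2
        linarith
      · exact hk2 z ⟨hz, hz'⟩)
  obtain ⟨k, hk⟩ := exists_sub_eq_const ((oS.inter o1).inter (oS.inter o4))
    ((cS.inter c1).inter (cS.inter c4)) (fun z hz => hP z (Or.inl (Or.inl hz.1)))
    (fun z hz => h4 z hz.2)
  obtain ⟨l, hl⟩ := exists_sub_eq_const ((oS.inter o3).inter (oS.inter o4))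
    ((cS.inter c3).inter (cS.inter c4)) (fun z hz => hP z (Or.inr hz.1))
    (fun z hz => h4 z hz.2)
  refine ⟨P, Q, k, l, fun z hz => hP z ?_, h4, fun z hz => hk z ?_, fun z hz => hl z ?_⟩
  · rcases hz with ⟨h0, (h | h) | h⟩
    exacts [Or.inl (Or.inl ⟨h0, h⟩), Or.inl (Or.inr ⟨h0, h⟩), Or.inr ⟨h0, h⟩]
  · exact ⟨⟨hz.1, hz.2.1⟩, ⟨hz.1, hz.2.2⟩⟩
  · exact ⟨⟨hz.1, hz.2.1⟩, ⟨hz.1, hz.2.2⟩⟩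

lemma zero_notMem_puncturedStrip {δ B : ℝ} (hδ : 0 < δ) (hB : 0 < B) :
    (0 : ℂ) ∉ puncturedStrip δ B := fun h => h.2 (by simp [rect, hδ.le, hB.le])

/-- Up to a multiple of `1 / z`, a holomorphic function on the punctured strip has a primitive, as
soon as there is a loop around the origin. -/
lemma exists_residue {δ B : ℝ} (hδ : 0 < δ) (hB : 0 < B) {Γ : ℝ → ℂ} (hΓ : IsClosedCurve Γ)
    (hΓD : Set.range Γ ⊆ puncturedStrip δ B) (h0 : 0 ∈ inside Γ) {f : ℂ → ℂ}
    (hf : DifferentiableOn ℂ f (puncturedStrip δ B)) :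
    ∃ (r : ℂ) (g : ℂ → ℂ), ∀ z ∈ puncturedStrip δ B, HasDerivAt g (f z - r * z⁻¹) z := by
  have hD : ∀ z ∈ puncturedStrip δ B, z ∈ strip δ ∩ ({z | δ < z.im} ∪ {z | z.re < -B}
      ∪ {z | z.im < -δ}) ∪ strip δ ∩ {z | B < z.re} := by
    rintro z ⟨hz, hn⟩
    have : ¬(|z.im| ≤ δ ∧ |z.re| ≤ B) := hn
    rw [← Set.inter_union_distrib_left]
    refine ⟨hz, ?_⟩
    rw [abs_le, abs_le] at this
    simp only [Set.mem_union, Set.mem_ofPred_eq]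
    by_contra! h
    exact this ⟨⟨h.1.2, h.1.1.1⟩, ⟨h.1.1.2, h.2⟩⟩
  have oS := isOpen_strip δ
  have oV : IsOpen (strip δ ∩ ({z : ℂ | δ < z.im} ∪ {z | z.re < -B} ∪ {z | z.im < -δ})) :=
    oS.inter (((isOpen_lt (by fun_prop) (by fun_prop)).union
      (isOpen_lt (by fun_prop) (by fun_prop))).union (isOpen_lt (by fun_prop) (by fun_prop)))
  have o4 : IsOpen (strip δ ∩ {z : ℂ | B < z.re}) :=
    oS.inter (isOpen_lt (by fun_prop) (by fun_prop))
  have hcap : ∀ z ∈ (strip δ ∩ ({z : ℂ | δ < z.im} ∪ {z | z.re < -B} ∪ {z | z.im < -δ}))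
      ∩ (strip δ ∩ {z : ℂ | B < z.re}), z ∈ strip δ ∩ ({z | δ < z.im} ∩ {z | B < z.re}) ∨
      z ∈ strip δ ∩ ({z | z.im < -δ} ∩ {z | B < z.re}) := by
    rintro z ⟨⟨h, (h1 | h1) | h1⟩, -, h4⟩
    · exact Or.inl ⟨h, h1, h4⟩
    · simp only [Set.mem_ofPred_eq] at h1 h4; linarith
    · exact Or.inr ⟨h, h1, h4⟩
  have hinv : DifferentiableOn ℂ (fun z : ℂ => z⁻¹) (puncturedStrip δ B) := fun z hz =>
    (differentiableAt_inv fun h => zero_notMem_puncturedStrip hδ hB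
      (h ▸ hz)).differentiableWithinAt
  obtain ⟨P', Q', k', l', hP', hQ', hk', hl'⟩ := exists_primitive_cut hδ hinv
  -- Without monodromy `1 / z` would have a global primitive, and the loop `Γ` could not wind around
  -- 0.
  have hne : k' - l' ≠ 0 := by
    intro h
    obtain ⟨R, -, hR⟩ := exists_primitive_union oV o4 hP' hQ' (k := k') (fun z hz => by
      rcases hcap z hz with h1 | h1
      · exact hk' z h1
      · rw [hl' z h1, sub_eq_zero.1 h])
    have e := hΓ.loopInt_eq_zero hΓD (fun z hz => hR z (hD z hz)) hinv.continuousOn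
    have := h0.2
    simp [e] at this
  obtain ⟨P, Q, k, l, hP, hQ, hk, hl⟩ := exists_primitive_cut hδ hf
  -- With this quotient of monodromies, `f - r / z` has none, and its primitives glue.
  set r := (k - l) / (k' - l') with hr
  obtain ⟨R, -, hR⟩ := exists_primitive_union oV o4 (f := fun z => f z - r * z⁻¹)
    (P := fun z => P z - r * P' z) (Q := fun z => Q z - r * Q' z) (k := k - r * k')
    (fun z hz => (hP z hz).sub ((hP' z hz).const_mul r))
    (fun z hz => (hQ z hz).sub ((hQ' z hz).const_mul r)) (fun z hz => by
      rcases hcap z hz with h1 | h1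
      · rw [← hk z h1, ← hk' z h1]; ring
      · have e1 := hl z h1
        have e2 := hl' z h1
        have e3 : r * (k' - l') = k - l := by rw [hr]; field_simp
        linear_combination e1 - r * e2 + e3)
  exact ⟨r, R, fun z hz => hR z (hD z hz)⟩

/-- Cauchy's theorem on the punctured strip: all loops around the origin give the same integral. -/
theorem loopInt_eq_loopInt {δ B : ℝ} (hδ : 0 < δ) (hB : 0 < B) {Γ Γ' : ℝ → ℂ}
    (hΓ : IsClosedCurve Γ) (hΓD : Set.range Γ ⊆ puncturedStrip δ B) (h0 : 0 ∈ inside Γ)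
    (hΓ' : IsClosedCurve Γ') (hΓD' : Set.range Γ' ⊆ puncturedStrip δ B) (h0' : 0 ∈ inside Γ')
    {f : ℂ → ℂ} (hf : DifferentiableOn ℂ f (puncturedStrip δ B)) :
    loopInt Γ f = loopInt Γ' f := by
  have hinv : ContinuousOn (fun z : ℂ => z⁻¹) (puncturedStrip δ B) := fun z hz =>
    (continuousAt_inv₀ fun h => zero_notMem_puncturedStrip hδ hB (h ▸ hz)).continuousWithinAt
  obtain ⟨r, g, hg⟩ := exists_residue hδ hB hΓ hΓD h0 hf
  -- The residue `r` and the primitive `g` belong to the domain, so the same `r` serves for both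
  -- loops.
  have key : ∀ {Γ : ℝ → ℂ}, IsClosedCurve Γ → Set.range Γ ⊆ puncturedStrip δ B → 0 ∈ inside Γ →
      loopInt Γ f = r * (2 * Real.pi * Complex.I) := by
    intro Γ hΓ hΓD h0
    have e := hΓ.loopInt_eq_zero hΓD hg (hf.continuousOn.sub (continuousOn_const.mul hinv))
    rw [hΓ.loopInt_sub (g := fun z => r * z⁻¹) (hf.continuousOn.mono hΓD)
      (continuousOn_const.mul (hinv.mono hΓD)), loopInt_const_mul, sub_eq_zero] at e
    have h1 := h0.2
    simp only [sub_zero] at h1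
    rw [e, ← mul_one (2 * Real.pi * Complex.I), ← h1, mul_inv_cancel_left₀ (by simp)]
  rw [key hΓ hΓD h0, key hΓ' hΓD' h0']

end Annular

/-! ### Iterated loop integrals and change of loop in Fredholm determinants. -/

section MultipleLoops

/-- The iterated integral of a function of `n` variables over `n` copies of a loop. -/
def multiLoopInt (Γ : ℝ → ℂ) {n : ℕ} (G : (Fin n → ℂ) → ℂ) : ℂ :=
  ∫ t, G (fun i => Γ (t i)) * ∏ i, deriv Γ (t i)
    ∂Measure.pi (fun _ : Fin n => volume.restrict (Set.Icc (0 : ℝ) 1))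

lemma loopInt_eq_integral_Icc (Γ : ℝ → ℂ) (f : ℂ → ℂ) :
    loopInt Γ f = ∫ t in Set.Icc (0 : ℝ) 1, f (Γ t) * deriv Γ t := by
  rw [loopInt, intervalIntegral.integral_of_le zero_le_one, integral_Icc_eq_integral_Ioc]

lemma integrable_prod_pi_of_continuous {n : ℕ} {f : ℝ × (Fin n → ℝ) → ℂ} (hf : Continuous f) :
    Integrable f ((volume.restrict (Set.Icc (0 : ℝ) 1)).prod
      (Measure.pi (fun _ : Fin n => volume.restrict (Set.Icc (0 : ℝ) 1)))) := by
  rw [← Measure.restrict_pi_pi, Measure.prod_restrict]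
  exact hf.continuousOn.integrableOn_compact
    (isCompact_Icc.prod (isCompact_univ_pi fun _ => isCompact_Icc))

lemma multiLoopInt_succ {Γ : ℝ → ℂ} (hΓ : IsClosedCurve Γ) {n : ℕ} {G : (Fin (n + 1) → ℂ) → ℂ}
    (hG : Continuous fun t : Fin (n + 1) → ℝ => G (fun i => Γ (t i))) :
    multiLoopInt Γ G = ∫ s in Set.Icc (0 : ℝ) 1,
      multiLoopInt Γ (fun u => G (Fin.cons (Γ s) u)) * deriv Γ s := by
  have hd := hΓ.continuous_deriv
  have mp := (measurePreserving_piFinSuccAbove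
    (fun _ : Fin (n + 1) => volume.restrict (Set.Icc (0 : ℝ) 1)) 0).symm
  have hcons : ∀ (s : ℝ) (u : Fin n → ℝ), (fun i => Γ ((Fin.cons s u : Fin (n + 1) → ℝ) i))
      = (Fin.cons (Γ s) (fun i => Γ (u i)) : Fin (n + 1) → ℂ) := by
    intro s u
    funext i
    refine Fin.cases ?_ (fun j => ?_) i <;> simp
  have hcc : Continuous fun p : ℝ × (Fin n → ℝ) => (Fin.cons p.1 p.2 : Fin (n + 1) → ℝ) :=
    continuous_pi fun i => by refine Fin.cases ?_ (fun j => ?_) i <;> simp <;> fun_prop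
  rw [multiLoopInt, ← mp.integral_comp']
  have e : ∀ p : ℝ × (Fin n → ℝ), (MeasurableEquiv.piFinSuccAbove (fun _ : Fin (n + 1) => ℝ) 0).symm p
      = Fin.cons p.1 p.2 := fun p => by
    simp [MeasurableEquiv.piFinSuccAbove]
    rfl
  simp only [e]
  rw [integral_prod]
  · refine integral_congr_ae (Eventually.of_forall fun s => ?_)
    simp only [multiLoopInt]
    rw [← integral_mul_const]
    refine integral_congr_ae (Eventually.of_forall fun u => ?_)
    simp only [hcons, Fin.prod_univ_succ, Fin.cons_zero, Fin.cons_succ]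
    ring
  · refine integrable_prod_pi_of_continuous ?_
    exact (hG.mul (continuous_finsetProd _ fun i _ => hd.comp (continuous_apply i))).comp hcc

lemma integral_multiLoopInt_swap {Γ Γ' : ℝ → ℂ} (hΓ : IsClosedCurve Γ) (hΓ' : IsClosedCurve Γ')
    {n : ℕ} {G : ℂ → (Fin n → ℂ) → ℂ}
    (hG : Continuous fun p : ℝ × (Fin n → ℝ) => G (Γ p.1) (fun i => Γ' (p.2 i))) :
    ∫ s in Set.Icc (0 : ℝ) 1, multiLoopInt Γ' (G (Γ s)) * deriv Γ s
      = multiLoopInt Γ' (fun u => loopInt Γ (fun z => G z u)) := by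
  have hd := hΓ.continuous_deriv
  have hd' := hΓ'.continuous_deriv
  simp only [multiLoopInt, loopInt_eq_integral_Icc, ← integral_mul_const]
  rw [integral_integral_swap]
  · refine integral_congr_ae (Eventually.of_forall fun u => ?_)
    refine integral_congr_ae (Eventually.of_forall fun s => ?_)
    simp only
    ring
  · refine integrable_prod_pi_of_continuous ?_
    refine (hG.mul (continuous_finsetProd _ fun i _ => ?_)).mul (hd.comp continuous_fst)
    exact hd'.comp ((continuous_apply i).comp continuous_snd)

/-- Multiple loop integrals of separately holomorphic functions depend on the loop only through the
one-dimensional integrals. -/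
theorem multiLoopInt_eq {D : Set ℂ} {Γ Γ' : ℝ → ℂ}
    (hΓ : IsClosedCurve Γ) (hΓ' : IsClosedCurve Γ') (hΓD : Set.range Γ ⊆ D)
    (hΓD' : Set.range Γ' ⊆ D)
    (hC : ∀ f : ℂ → ℂ, DifferentiableOn ℂ f D → loopInt Γ f = loopInt Γ' f) (n : ℕ)
    (G : (Fin n → ℂ) → ℂ) (hGc : ContinuousOn G {u | ∀ i, u i ∈ D})
    (hGd : ∀ u : Fin n → ℂ, (∀ i, u i ∈ D) → ∀ i,
      DifferentiableOn ℂ (fun z => G (Function.update u i z)) D) :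
    multiLoopInt Γ G = multiLoopInt Γ' G := by
  induction n with
  | zero =>
    have : ∀ t : Fin 0 → ℝ, (fun i => Γ (t i)) = fun i => Γ' (t i) := fun t => Subsingleton.elim _ _
    simp [multiLoopInt, this]
  | succ n ih =>
    have hc : ∀ {Γ : ℝ → ℂ}, IsClosedCurve Γ → Set.range Γ ⊆ D →
        Continuous fun t : Fin (n + 1) → ℝ => G (fun i => Γ (t i)) := fun h hD =>
      hGc.comp_continuous (continuous_pi fun i => h.continuous.comp (continuous_apply i))
        fun t i => hD ⟨t i, rfl⟩
    have hcons : ∀ {z : ℂ} {u : Fin n → ℂ}, z ∈ D → (∀ i, u i ∈ D) →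
        ∀ i, (Fin.cons z u : Fin (n + 1) → ℂ) i ∈ D := fun hz hu i => by
      refine Fin.cases ?_ (fun j => ?_) i
      · simpa using hz
      · simpa using hu j
    have hcons_cont : Continuous fun p : ℂ × (Fin n → ℂ) => (Fin.cons p.1 p.2 : Fin (n + 1) → ℂ) :=
      continuous_pi fun i => by refine Fin.cases ?_ (fun j => ?_) i <;> simp <;> fun_prop
    have hswap : ∀ {Γ : ℝ → ℂ}, IsClosedCurve Γ → Set.range Γ ⊆ D →
        Continuous fun p : ℝ × (Fin n → ℝ) =>
          G (Fin.cons (Γ p.1) (fun i => Γ' (p.2 i))) := fun {Γ} h hD =>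
      hGc.comp_continuous (f := fun p : ℝ × (Fin n → ℝ) =>
          (Fin.cons (Γ p.1) (fun i => Γ' (p.2 i)) : Fin (n + 1) → ℂ))
        (hcons_cont.comp ((h.continuous.comp continuous_fst).prodMk (continuous_pi fun i =>
          hΓ'.continuous.comp ((continuous_apply i).comp continuous_snd))))
        fun p => hcons (hD ⟨_, rfl⟩) fun i => hΓD' ⟨_, rfl⟩
    -- The last `n` variables are moved to `Γ'` by induction, with the first one frozen on `Γ`;
    -- Fubini then makes the first variable the inner one, and `hC` moves it.
    rw [multiLoopInt_succ hΓ (hc hΓ hΓD), multiLoopInt_succ hΓ' (hc hΓ' hΓD')]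
    have h1 : ∀ s : ℝ, multiLoopInt Γ (fun u => G (Fin.cons (Γ s) u))
        = multiLoopInt Γ' (fun u => G (Fin.cons (Γ s) u)) := by
      intro s
      refine ih _ ?_ fun u hu i => ?_
      · exact hGc.comp (hcons_cont.comp (continuous_const.prodMk continuous_id)).continuousOn
          fun u hu => hcons (hΓD ⟨s, rfl⟩) hu
      · simpa only [Fin.cons_update] using hGd (Fin.cons (Γ s) u) (hcons (hΓD ⟨s, rfl⟩) hu) i.succ
    simp_rw [h1]
    rw [integral_multiLoopInt_swap (G := fun z u => G (Fin.cons z u)) hΓ hΓ' (hswap hΓ hΓD),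
      integral_multiLoopInt_swap (G := fun z u => G (Fin.cons z u)) hΓ' hΓ' (hswap hΓ' hΓD')]
    simp only [multiLoopInt]
    refine integral_congr_ae (Eventually.of_forall fun t => ?_)
    simp only
    rw [hC]
    have hz : Γ' 0 ∈ D := hΓD' ⟨0, rfl⟩
    simpa only [Fin.update_cons_zero] using
      hGd (Fin.cons (Γ' 0) fun i => Γ' (t i)) (hcons hz fun i => hΓD' ⟨_, rfl⟩) 0

/-- Fredholm determinants of kernels holomorphic in both variables depend on the loop only through
the one-dimensional integrals. -/
theorem loopFredholmDet_eq {D : Set ℂ} (hD : IsOpen D) {Γ Γ' : ℝ → ℂ}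
    (hΓ : IsClosedCurve Γ) (hΓ' : IsClosedCurve Γ') (hΓD : Set.range Γ ⊆ D)
    (hΓD' : Set.range Γ' ⊆ D)
    (hC : ∀ f : ℂ → ℂ, DifferentiableOn ℂ f D → loopInt Γ f = loopInt Γ' f) {V : ℂ → ℂ → ℂ}
    (hV : DifferentiableOn ℂ (fun p : ℂ × ℂ => V p.1 p.2) (D ×ˢ D)) :
    loopFredholmDet Γ V = loopFredholmDet Γ' V := by
  have hrw : ∀ (Γ : ℝ → ℂ) (n : ℕ), ∫ t in Set.univ.pi (fun _ : Fin n => Set.Icc (0 : ℝ) 1),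
      Matrix.det (Matrix.of fun i j : Fin n => V (Γ (t i)) (Γ (t j)) * deriv Γ (t j))
      = multiLoopInt Γ (fun u => Matrix.det (Matrix.of fun i j : Fin n => V (u i) (u j))) := by
    intro Γ n
    rw [multiLoopInt, volume_pi, Measure.restrict_pi_pi]
    refine integral_congr_ae (Eventually.of_forall fun t => ?_)
    simp only
    -- The factors `deriv Γ (t j)` scale the columns, so they leave the determinant as the product
    -- required by `multiLoopInt`.
    rw [mul_comm (Matrix.det _), ← Matrix.det_mul_row]
    simp only [Matrix.of_apply, mul_comm]
  simp only [loopFredholmDet, fredholmDet, hrw]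
  refine tsum_congr fun n => ?_
  congr 1
  refine multiLoopInt_eq hΓ hΓ' hΓD hΓD' hC n _ ?_ fun u hu k z hz => ?_
  · simp_rw [Matrix.det_apply]
    refine continuousOn_finsetSum _ fun σ _ => ContinuousOn.const_smul
      (continuousOn_finsetProd _ fun i _ => ?_) _
    exact hV.continuousOn.comp (f := fun u : Fin n → ℂ => (u (σ i), u i))
      (by fun_prop) fun u hu => ⟨hu _, hu _⟩
  · refine DifferentiableAt.differentiableWithinAt ?_
    simp_rw [Matrix.det_apply]
    refine DifferentiableAt.fun_sum fun σ _ => DifferentiableAt.const_smul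
      (DifferentiableAt.fun_finsetProd fun i _ => ?_) _
    have hup : ∀ j, Function.update u k z j ∈ D := fun j => by
      by_cases h : j = k
      · subst h; simpa using hz
      · simpa [h] using hu j
    have hdu : ∀ j, DifferentiableAt ℂ (fun z => Function.update u k z j) z := fun j => by
      by_cases h : j = k
      · subst h; simp
      · simp [h]
    exact (hV.differentiableAt ((hD.prod hD).mem_nhds
      (⟨hup _, hup _⟩ : (Function.update u k z (σ i), Function.update u k z i) ∈ D ×ˢ D))).comp z
      ((hdu (σ i)).prodMk (hdu i))

end MultipleLoops

/-! ### Ellipses: gauge, winding numbers and the regions between them. -/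

section Ellipse

/-- The real linear map that sends the ellipse with semi-axes `a`, `b` to the unit circle. -/
def axesScale (a b : ℝ) (ha : 0 < a) (hb : 0 < b) : ℂ ≃L[ℝ] ℂ :=
  LinearEquiv.toContinuousLinearEquiv
    { toFun := fun z => ⟨z.re / a, z.im / b⟩
      invFun := fun z => ⟨a * z.re, b * z.im⟩
      map_add' := fun z w => by apply Complex.ext <;> simp [add_div]
      map_smul' := fun r z => by apply Complex.ext <;> simp [mul_div_assoc]
      left_inv := fun z => by apply Complex.ext <;> simp <;> field_simp
      right_inv := fun z => by apply Complex.ext <;> simp <;> field_simp }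

variable {a b : ℝ} (ha : 0 < a) (hb : 0 < b)

lemma axesScale_apply (z : ℂ) : axesScale a b ha hb z = ⟨z.re / a, z.im / b⟩ := rfl

lemma axesScale_symm_apply (z : ℂ) : (axesScale a b ha hb).symm z = ⟨a * z.re, b * z.im⟩ := rfl

/-- The gauge of the ellipse with semi-axes `a` and `b`. -/
def ellipseNorm (z : ℂ) : ℝ := ‖axesScale a b ha hb z‖

/-- The ellipse with semi-axes `s a` and `s b`. -/
def ellipse (s t : ℝ) : ℂ :=
  (axesScale a b ha hb).symm (s * Complex.exp (2 * Real.pi * Complex.I * t))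

lemma norm_exp_two_pi_mul (t : ℝ) : ‖Complex.exp (2 * Real.pi * Complex.I * t)‖ = 1 := by
  rw [show (2 * Real.pi * Complex.I * t : ℂ) = ((2 * Real.pi * t : ℝ) : ℂ) * Complex.I by
    push_cast; ring]
  exact Complex.norm_exp_ofReal_mul_I _

lemma hasDerivAt_exp_two_pi_mul (u : ℂ) (t : ℝ) :
    HasDerivAt (fun t : ℝ => Complex.exp (u * t)) (u * Complex.exp (u * t)) t := by
  have : HasDerivAt (fun t : ℝ => u * (t : ℂ)) u t := by
    simpa using (Complex.ofRealCLM.hasDerivAt (x := t)).const_mul u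
  simpa [mul_comm] using this.cexp

lemma ellipseNorm_ellipse {s : ℝ} (hs : 0 < s) (t : ℝ) :
    ellipseNorm ha hb (ellipse ha hb s t) = s := by
  simp [ellipseNorm, ellipse, norm_exp_two_pi_mul, abs_of_pos hs]

lemma range_ellipse {s : ℝ} (hs : 0 < s) :
    Set.range (ellipse ha hb s) = {z | ellipseNorm ha hb z = s} := by
  ext z
  constructor
  · rintro ⟨t, rfl⟩
    exact ellipseNorm_ellipse ha hb hs t
  · intro hz
    set w := axesScale a b ha hb z with hw
    have hn : ‖w‖ = s := hz
    refine ⟨w.arg / (2 * Real.pi), ?_⟩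
    rw [ellipse, ContinuousLinearEquiv.symm_apply_eq, ← hw]
    conv_rhs => rw [← Complex.norm_mul_exp_arg_mul_I w, hn]
    congr 2
    have : (Real.pi : ℂ) ≠ 0 := by exact_mod_cast Real.pi_ne_zero
    push_cast
    field_simp

lemma hasDerivAt_ellipse (s t : ℝ) : HasDerivAt (ellipse ha hb s) ((axesScale a b ha hb).symm
    (s * (2 * Real.pi * Complex.I * Complex.exp (2 * Real.pi * Complex.I * t)))) t :=
  ((axesScale a b ha hb).symm : ℂ →L[ℝ] ℂ).hasFDerivAt.comp_hasDerivAt t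
    ((hasDerivAt_exp_two_pi_mul _ t).const_mul (s : ℂ))

lemma isSmoothLoop_ellipse {s : ℝ} (hs : 0 < s) : IsSmoothLoop (ellipse ha hb s) where
  smooth := by
    refine (axesScale a b ha hb).symm.contDiff.comp (contDiff_const.mul ?_)
    exact (contDiff_const.mul Complex.ofRealCLM.contDiff).cexp
  periodic := fun t => by
    simp only [ellipse]
    congr 2
    push_cast
    rw [mul_add, Complex.exp_add, mul_one, Complex.exp_two_pi_mul_I, mul_one]
  simple := fun x hx y hy h => by
    have hs' : (s : ℂ) ≠ 0 := by exact_mod_cast hs.ne'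
    have h1 := mul_left_cancel₀ hs' ((axesScale a b ha hb).symm.injective h)
    obtain ⟨n, hn⟩ := Complex.exp_eq_exp_iff_exists_int.1 h1
    have h2 : (2 * Real.pi * Complex.I : ℂ) ≠ 0 := by simp
    have h3 : (x : ℂ) = y + n := mul_left_cancel₀ h2 (by rw [hn]; ring)
    have h4 : x = y + n := by exact_mod_cast h3
    have h5 : (n : ℝ) < 1 := by linarith [hx.2, hy.1]
    have h6 : (-1 : ℝ) < n := by linarith [hx.1, hy.2]
    have h7 : n = 0 := by
      have : n < 1 := by exact_mod_cast h5
      have : -1 < n := by exact_mod_cast h6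
      omega
    simpa [h7] using h4
  regular := fun t => by
    rw [(hasDerivAt_ellipse ha hb s t).deriv]
    simp [hs.ne']

lemma ellipseNorm_real_mul (u : ℝ) (z : ℂ) :
    ellipseNorm ha hb (u * z) = |u| * ellipseNorm ha hb z := by
  rw [ellipseNorm, ellipseNorm, ← Complex.real_smul, map_smul, norm_smul, Real.norm_eq_abs]

/-- If `1 - w / z` were a nonpositive real number, then `w = t z` with `t ≥ 1`, and the gauge of `w`
would be at least that of `z`. -/
lemma one_sub_div_mem_slitPlane {w z : ℂ} (h : ellipseNorm ha hb w < ellipseNorm ha hb z) :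
    1 - w / z ∈ Complex.slitPlane := by
  have hz : z ≠ 0 := by
    rintro rfl
    rw [ellipseNorm, ellipseNorm, map_zero, norm_zero] at h
    exact absurd h (not_lt.2 (norm_nonneg _))
  rw [Complex.mem_slitPlane_iff_not_le_zero]
  intro hle
  rw [Complex.le_def] at hle
  have him : (w / z).im = 0 := by simpa using hle.2
  have hre : 1 ≤ (w / z).re := by simpa using hle.1
  have hw : w = ((w / z).re : ℝ) * z := by
    rw [show (((w / z).re : ℝ) : ℂ) = w / z from Complex.ext (by simp) (by simp [him])]
    field_simp
  rw [hw, ellipseNorm_real_mul, abs_of_nonneg (by linarith)] at h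
  have : 0 ≤ ellipseNorm ha hb z := norm_nonneg _
  nlinarith

lemma isOpen_ellipseNorm_lt (r : ℝ) : IsOpen {z | ellipseNorm ha hb z < r} :=
  isOpen_lt ((axesScale a b ha hb).continuous.norm) continuous_const

lemma convex_ellipseNorm_lt (r : ℝ) : Convex ℝ {z | ellipseNorm ha hb z < r} := by
  have : {z | ellipseNorm ha hb z < r}
      = (axesScale a b ha hb : ℂ →ₗ[ℝ] ℂ) ⁻¹' ball 0 r := by
    ext z; simp [ellipseNorm]
  rw [this]
  exact (convex_ball 0 r).linear_preimage _

/-- The ellipse is `s e^{2πit} (p + r e^{-4πit})` with `p = (a + b) / 2 > |r|`. The bracket stays in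
the right half-plane, so its principal logarithm is smooth and returns to its initial value; only
the factor `e^{2πit}` contributes. -/
lemma loopInt_ellipse_inv {s : ℝ} (hs : 0 < s) :
    loopInt (ellipse ha hb s) (fun z => z⁻¹) = 2 * Real.pi * Complex.I := by
  set p : ℝ := (a + b) / 2 with hp
  set r : ℝ := (a - b) / 2 with hr
  have hsymm : ∀ z, (axesScale a b ha hb).symm z = p * z + r * (starRingEnd ℂ) z := fun z => by
    rw [axesScale_symm_apply]
    apply Complex.ext <;> simp [hp, hr] <;> ring
  set h : ℝ → ℂ := fun t => p + r * Complex.exp (-(2 * (2 * Real.pi * Complex.I)) * t) with hh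
  have hΓ : ∀ t, ellipse ha hb s t = s * (Complex.exp (2 * Real.pi * Complex.I * t) * h t) := by
    intro t
    have h1 : (starRingEnd ℂ) (Complex.exp (2 * Real.pi * Complex.I * t))
        = Complex.exp (2 * Real.pi * Complex.I * t)
          * Complex.exp (-(2 * (2 * Real.pi * Complex.I)) * t) := by
      rw [← Complex.exp_add, ← Complex.exp_conj]
      congr 1
      simp only [map_mul, map_ofNat, Complex.conj_ofReal, Complex.conj_I]
      ring
    rw [ellipse, hsymm, map_mul, Complex.conj_ofReal, h1, hh]
    ring
  have hslit : ∀ t, h t ∈ Complex.slitPlane := by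
    intro t
    have hn : ‖Complex.exp (-(2 * (2 * Real.pi * Complex.I)) * t)‖ = 1 := by
      rw [show (-(2 * (2 * Real.pi * Complex.I)) * t : ℂ)
        = ((-(2 * (2 * Real.pi)) * t : ℝ) : ℂ) * Complex.I by push_cast; ring]
      exact Complex.norm_exp_ofReal_mul_I _
    have h1 := Complex.abs_re_le_norm (Complex.exp (-(2 * (2 * Real.pi * Complex.I)) * t))
    rw [hn, abs_le] at h1
    refine Complex.mem_slitPlane_iff.2 (Or.inl ?_)
    have : (h t).re = p + r * (Complex.exp (-(2 * (2 * Real.pi * Complex.I)) * t)).re := by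
      simp only [hh, Complex.add_re, Complex.ofReal_re, Complex.re_ofReal_mul]
    rw [this]
    set x := (Complex.exp (-(2 * (2 * Real.pi * Complex.I)) * t)).re
    rw [hp, hr]
    nlinarith [h1.1, h1.2, mul_nonneg ha.le (by linarith : 0 ≤ 1 + x),
      mul_nonneg hb.le (by linarith : 0 ≤ 1 - x)]
  have hder : ∀ t : ℝ, HasDerivAt h (r * (-(2 * (2 * Real.pi * Complex.I))
      * Complex.exp (-(2 * (2 * Real.pi * Complex.I)) * t))) t := fun t =>
    ((hasDerivAt_exp_two_pi_mul _ t).const_mul (r : ℂ)).const_add _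
  have hs' : (s : ℂ) ≠ 0 := by exact_mod_cast hs.ne'
  have hL : ∀ t, HasDerivAt (fun t : ℝ => 2 * Real.pi * Complex.I * t + Complex.log (h t))
      ((ellipse ha hb s t)⁻¹ * deriv (ellipse ha hb s) t) t := by
    intro t
    have d1 : HasDerivAt (fun t : ℝ => 2 * Real.pi * Complex.I * (t : ℂ))
        (2 * Real.pi * Complex.I) t := by
      simpa using (Complex.ofRealCLM.hasDerivAt (x := t)).const_mul (2 * Real.pi * Complex.I)
    have d2 := d1.add ((hder t).clog_real (hslit t))
    have d3 := ((hasDerivAt_exp_two_pi_mul (2 * Real.pi * Complex.I) t).mul (hder t)).const_mul (s : ℂ)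
    have d4 : deriv (ellipse ha hb s) t = _ :=
      (d3.congr_of_eventuallyEq (Eventually.of_forall hΓ)).deriv
    refine d2.congr_deriv ?_
    rw [d4, hΓ]
    have h1 := Complex.slitPlane_ne_zero (hslit t)
    have h2 := Complex.exp_ne_zero (2 * Real.pi * Complex.I * t)
    field_simp
  have hcc := (isSmoothLoop_ellipse ha hb hs).isClosedCurve
  rw [loopInt, intervalIntegral.integral_eq_sub_of_hasDerivAt (fun t _ => hL t)]
  · have h01 : h 1 = h 0 := by
      simp only [hh]
      congr 2
      rw [show (-(2 * (2 * Real.pi * Complex.I)) * ((1 : ℝ) : ℂ) : ℂ)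
        = ((-2 : ℤ) : ℂ) * (2 * Real.pi * Complex.I) by push_cast; ring,
        Complex.exp_int_mul_two_pi_mul_I]
      simp
    simp [h01]
  · refine hcc.intervalIntegrable (f := fun z => z⁻¹) (fun z hz => ?_) _ _
    refine (continuousAt_inv₀ ?_).continuousWithinAt
    rw [range_ellipse ha hb hs] at hz
    rintro rfl
    simp [ellipseNorm] at hz
    exact hs.ne hz

/-- For a point `w` of smaller gauge, `log (1 - w / z)` is a primitive of `1 / (z - w) - 1 / z`
along the ellipse, so the winding number is the one around 0. For `w` of larger gauge, `1 / (z - w)`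
is holomorphic on a convex set containing the ellipse, so the winding number is 0. -/
lemma inside_ellipse {s : ℝ} (hs : 0 < s) :
    inside (ellipse ha hb s) = {z | ellipseNorm ha hb z < s} := by
  have hcc := (isSmoothLoop_ellipse ha hb hs).isClosedCurve
  have hpi : (2 * Real.pi * Complex.I : ℂ) ≠ 0 := by simp
  ext w
  constructor
  · rintro ⟨h1, h2⟩
    rw [range_ellipse ha hb hs] at h1
    by_contra h3
    have h4 : s < ellipseNorm ha hb w := lt_of_le_of_ne (not_lt.1 h3) (Ne.symm h1)
    have hd : DifferentiableOn ℂ (fun z : ℂ => (z - w)⁻¹)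
        {z | ellipseNorm ha hb z < ellipseNorm ha hb w} := by
      intro z hz
      refine DifferentiableAt.differentiableWithinAt (DifferentiableAt.inv (by fun_prop) ?_)
      intro h
      rw [sub_eq_zero.1 h] at hz
      exact lt_irrefl (ellipseNorm ha hb w) hz
    obtain ⟨g, hg⟩ := exists_primitive_of_convex (isOpen_ellipseNorm_lt ha hb _)
      (convex_ellipseNorm_lt ha hb _) hd
    rw [hcc.loopInt_eq_zero ?_ hg hd.continuousOn] at h2
    · simp at h2
    · rw [range_ellipse ha hb hs]
      intro z hz
      simp only [Set.mem_ofPred_eq] at hz ⊢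
      rwa [hz]
  · intro hw
    have hr : w ∉ Set.range (ellipse ha hb s) := by
      rw [range_ellipse ha hb hs]
      exact fun h => (ne_of_lt hw) h
    refine ⟨hr, ?_⟩
    have h0 : ∀ z ∈ Set.range (ellipse ha hb s), z ≠ 0 ∧ z - w ≠ 0 := by
      intro z hz
      refine ⟨?_, fun h => hr (by rwa [← sub_eq_zero.1 h])⟩
      rintro rfl
      rw [range_ellipse ha hb hs] at hz
      simp [ellipseNorm] at hz
      exact hs.ne hz
    have c1 : ContinuousOn (fun z : ℂ => (z - w)⁻¹) (Set.range (ellipse ha hb s)) :=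
      (by fun_prop : ContinuousOn (fun z : ℂ => z - w) _).inv₀ fun z hz => (h0 z hz).2
    have c2 : ContinuousOn (fun z : ℂ => z⁻¹) (Set.range (ellipse ha hb s)) :=
      continuousOn_id.inv₀ fun z hz => (h0 z hz).1
    have e := hcc.loopInt_eq_zero (f := fun z => (z - w)⁻¹ - z⁻¹)
      (g := fun z => Complex.log (1 - w / z)) subset_rfl (fun z hz => by
        have hz0 := h0 z hz
        have hsl : 1 - w / z ∈ Complex.slitPlane := by
          refine one_sub_div_mem_slitPlane ha hb ?_
          rw [range_ellipse ha hb hs] at hz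
          rw [show ellipseNorm ha hb z = s from hz]
          exact hw
        have d := ((((hasDerivAt_inv hz0.1).const_mul w).const_sub 1).clog
          (by simpa [div_eq_mul_inv] using hsl))
        simp only [← div_eq_mul_inv] at d
        refine d.congr_deriv ?_
        have h2 := hz0.1
        have h3 := hz0.2
        rw [show 1 - w / z = (z - w) / z by field_simp]
        field_simp
        ring) (c1.sub c2)
    rw [hcc.loopInt_sub c1 c2, loopInt_ellipse_inv ha hb hs, sub_eq_zero] at e
    rw [e, inv_mul_cancel₀ hpi]

lemma annulus_ellipse {r s : ℝ} (hr : 0 < r) (hs : 0 < s) :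
    annulus (ellipse ha hb r) (ellipse ha hb s)
      = axesScale a b ha hb ⁻¹' (closedBall 0 s ∩ (ball 0 r)ᶜ) := by
  ext z
  simp only [annulus, range_ellipse ha hb hs, inside_ellipse ha hb hs, inside_ellipse ha hb hr,
    Set.mem_sdiff, Set.mem_union, Set.mem_ofPred_eq, Set.mem_preimage, Set.mem_inter_iff,
    mem_closedBall, dist_zero_right, Set.mem_compl_iff, mem_ball, le_iff_lt_or_eq, ellipseNorm]
  tauto

lemma interior_annulus_ellipse {r s : ℝ} (hr : 0 < r) (hs : 0 < s) :
    interior (annulus (ellipse ha hb r) (ellipse ha hb s))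
      = {z | r < ellipseNorm ha hb z ∧ ellipseNorm ha hb z < s} := by
  rw [annulus_ellipse ha hb hr hs, ← ContinuousLinearEquiv.coe_toHomeomorph,
    ← Homeomorph.preimage_interior, interior_inter, interior_compl, closure_ball _ hr.ne',
    interior_closedBall _ hs.ne']
  ext z
  simp [ellipseNorm, and_comm]

lemma frontier_annulus_ellipse {r s : ℝ} (hr : 0 < r) (hrs : r < s) :
    frontier (annulus (ellipse ha hb r) (ellipse ha hb s))
      = Set.range (ellipse ha hb r) ∪ Set.range (ellipse ha hb s) := by
  have hs := hr.trans hrs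
  have hcl : IsClosed (annulus (ellipse ha hb r) (ellipse ha hb s)) := by
    rw [annulus_ellipse ha hb hr hs]
    exact (isClosed_closedBall.inter isOpen_ball.isClosed_compl).preimage
      (axesScale a b ha hb).continuous
  rw [hcl.frontier_eq, interior_annulus_ellipse ha hb hr hs, annulus_ellipse ha hb hr hs,
    range_ellipse ha hb hr, range_ellipse ha hb hs]
  ext z
  simp only [ellipseNorm, Set.mem_sdiff, Set.mem_preimage, Set.mem_inter_iff, mem_closedBall,
    dist_zero_right, Set.mem_compl_iff, mem_ball, Set.mem_ofPred_eq, Set.mem_union, not_and, not_lt]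
  constructor
  · rintro ⟨⟨h1, h2⟩, h3⟩
    rcases h2.eq_or_lt with h | h
    · exact Or.inl h.symm
    · exact Or.inr (le_antisymm h1 (h3 h))
  · rintro (h | h)
    · exact ⟨⟨by linarith, h.ge⟩, fun h' => by linarith⟩
    · exact ⟨⟨h.le, by linarith⟩, fun _ => h.ge⟩

lemma isCompact_annulus_ellipse {r s : ℝ} (hr : 0 < r) (hs : 0 < s) :
    IsCompact (annulus (ellipse ha hb r) (ellipse ha hb s)) := by
  rw [annulus_ellipse ha hb hr hs, ← ContinuousLinearEquiv.coe_toHomeomorph]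
  exact (Homeomorph.isCompact_preimage _).2
    ((isCompact_closedBall 0 s).inter_right isOpen_ball.isClosed_compl)

lemma abs_im_le_ellipseNorm (z : ℂ) : |z.im| ≤ b * ellipseNorm ha hb z := by
  have h := Complex.abs_im_le_norm (axesScale a b ha hb z)
  rw [axesScale_apply] at h
  simp only [abs_div, abs_of_pos hb] at h
  rw [div_le_iff₀ hb] at h
  rw [mul_comm]
  exact h

end Ellipse

/-! ### The system of contours. -/

section ContourSystem

variable {q δ A : ℝ}

/-- The gauge is at most √2 on this rectangle, and √2 < 3 / 2. The half-width `A + q` is used so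
that one rectangle covers both `K_A` and the Fermi zone. -/
lemma ellipseNorm_lt_of_mem_rect (hq : 0 < q) (hδ : 0 < δ) (hA : 0 < A) {z : ℂ}
    (hz : z ∈ rect δ (A + q)) : ellipseNorm (add_pos hA hq) hδ z < 3 / 2 := by
  have h1 : |z.re / (A + q)| ≤ 1 := by
    rw [abs_div, abs_of_pos (add_pos hA hq), div_le_one (add_pos hA hq)]; exact hz.2
  have h2 : |z.im / δ| ≤ 1 := by
    rw [abs_div, abs_of_pos hδ, div_le_one hδ]; exact hz.1
  rw [abs_le] at h1 h2
  rw [ellipseNorm, axesScale_apply]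
  refine lt_of_pow_lt_pow_left₀ 2 (by norm_num) ?_
  rw [Complex.sq_norm, Complex.normSq_mk]
  nlinarith

lemma rect_mono {A B : ℝ} (h : A ≤ B) : rect δ A ⊆ rect δ B := fun _ hz => ⟨hz.1, hz.2.trans h⟩

lemma fermiZone_subset_rect (hδ : 0 < δ) : fermiZone q ⊆ rect δ q := by
  rintro _ ⟨x, hx, rfl⟩
  simp [rect, hδ.le, abs_le, hx.1, hx.2]

lemma mem_strip_of_ellipseNorm_lt (hq : 0 < q) (hδ : 0 < δ) (hA : 0 < A) {z : ℂ}
    (hz : ellipseNorm (add_pos hA hq) hδ z < 2) : z ∈ strip δ := by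
  have := abs_im_le_ellipseNorm (add_pos hA hq) hδ z
  simp only [strip, Set.mem_ofPred_eq]
  nlinarith

lemma isContourSystem_ellipse (hq : 0 < q) (hδ : 0 < δ) (hA : 0 < A) :
    IsContourSystem q δ A (ellipse (add_pos hA hq) hδ (3 / 2)) (ellipse (add_pos hA hq) hδ (8 / 5))
      (ellipse (add_pos hA hq) hδ (17 / 10)) (ellipse (add_pos hA hq) hδ (9 / 5)) := by
  have haq := add_pos hA hq
  have p1 : (0 : ℝ) < 3 / 2 := by norm_num
  have p2 : (0 : ℝ) < 8 / 5 := by norm_num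
  have p3 : (0 : ℝ) < 17 / 10 := by norm_num
  have p4 : (0 : ℝ) < 9 / 5 := by norm_num
  have hstrip : ∀ {s : ℝ}, 0 < s → s < 2 → Set.range (ellipse haq hδ s) ⊆ strip δ := by
    intro s h0 h2 z hz
    rw [range_ellipse haq hδ h0] at hz
    exact mem_strip_of_ellipseNorm_lt hq hδ hA (hz.trans_lt h2)
  have hun : ∀ {r s : ℝ}, 0 < r → r < s →
      Set.range (ellipse haq hδ r) ∪ inside (ellipse haq hδ r) ⊆ inside (ellipse haq hδ s) := by
    intro r s h0 h1 z hz
    rw [range_ellipse haq hδ h0, inside_ellipse haq hδ h0] at hz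
    rw [inside_ellipse haq hδ (h0.trans h1)]
    rcases hz with hz | hz
    · exact hz.trans_lt h1
    · exact lt_trans hz h1
  have hrect : rect δ (A + q) ⊆ inside (ellipse haq hδ (3 / 2)) := by
    rw [inside_ellipse haq hδ p1]
    exact fun z hz => ellipseNorm_lt_of_mem_rect hq hδ hA hz
  refine ⟨⟨isSmoothLoop_ellipse _ _ p1, hstrip p1 (by norm_num), ?_⟩,
    ⟨isSmoothLoop_ellipse _ _ p2, hstrip p2 (by norm_num), hun p1 (by norm_num)⟩,
    ⟨isSmoothLoop_ellipse _ _ p3, hstrip p3 (by norm_num), hun p2 (by norm_num)⟩,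
    ⟨isSmoothLoop_ellipse _ _ p4, hstrip p4 (by norm_num), ?_⟩, ?_,
    isCompact_annulus_ellipse _ _ p1 p3, frontier_annulus_ellipse _ _ p1 (by norm_num), ?_, ?_⟩
  · exact (rect_mono (by linarith)).trans hrect
  · refine Set.union_subset (hun p2 (by norm_num)) ?_
    exact (((fermiZone_subset_rect hδ).trans (rect_mono (by linarith))).trans hrect).trans
      (Set.subset_union_right.trans (hun p1 (by norm_num)))
  · intro z hz
    rw [annulus_ellipse haq hδ p1 p3] at hz
    have : ellipseNorm haq hδ z ≤ 17 / 10 := by simpa [ellipseNorm] using hz.1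
    exact mem_strip_of_ellipseNorm_lt hq hδ hA (by linarith)
  · rw [interior_annulus_ellipse haq hδ p1 p3, range_ellipse haq hδ p2]
    intro z hz
    have : ellipseNorm haq hδ z = 8 / 5 := hz
    exact ⟨by rw [this]; norm_num, by rw [this]; norm_num⟩
  -- The gauge of `z` is below 9 / 5, that of `ΓA s`; hence the quotient avoids the cut.
  · intro s z hz
    refine one_sub_div_mem_slitPlane haq hδ ?_
    rw [ellipseNorm_ellipse haq hδ p4]
    have := hun p2 (by norm_num : (8 / 5 : ℝ) < 9 / 5) hz
    rwa [inside_ellipse haq hδ p4] at this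

end ContourSystem

/-! ### The Lieb equation: bounds, holomorphy, dressed charge and dressed phase. -/

section Lieb

variable {c q : ℝ}

lemma IsLiebSolution.eq_liebSolve (hc : 0 < c) (hq : 0 < q) {g f : ℂ → ℂ}
    (hg : ContinuousOn (fun x : ℝ => g x) (Set.Icc (-q) q)) (hf : IsLiebSolution c q g f) {x : ℂ}
    (hx : |x.im| < c) : f x = liebSolve c q g x :=
  hf.unique hc hq (liebSolve_spec hc hq hg) hx

lemma sq_add_sq_eq (c : ℝ) (x : ℂ) :
    x ^ 2 + (c : ℂ) ^ 2 = (x - Complex.I * c) * (x + Complex.I * c) := by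
  linear_combination (c : ℂ) ^ 2 * Complex.I_sq

lemma sq_add_sq_ne_zero {x : ℂ} (hx : |x.im| < c) : x ^ 2 + (c : ℂ) ^ 2 ≠ 0 := by
  rw [sq_add_sq_eq]
  rw [abs_lt] at hx
  refine mul_ne_zero (fun h => ?_) fun h => ?_
  · have := congrArg Complex.im h
    simp at this
    linarith
  · have := congrArg Complex.im h
    simp at this
    linarith

lemma differentiableAt_liebK {x : ℂ} (hx : |x.im| < c) : DifferentiableAt ℂ (liebK c) x :=
  DifferentiableAt.div (by fun_prop) (by fun_prop) (sq_add_sq_ne_zero hx)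

lemma intervalIntegrable_liebK_mul (hq : 0 < q) {f : ℂ → ℂ}
    (hf : ContinuousOn (fun x : ℝ => f x) (Set.Icc (-q) q)) {x : ℂ} (hx : |x.im| < c) :
    IntervalIntegrable (fun τ : ℝ => liebK c (x - τ) * f τ) volume (-q) q := by
  refine ContinuousOn.intervalIntegrable ?_
  rw [Set.uIcc_of_le (by linarith)]
  refine ContinuousOn.mul (fun τ _ => ?_) hf
  exact ((differentiableAt_liebK (x := x - τ) (by simpa using hx)).continuousAt.comp
      (f := fun τ : ℝ => x - τ) (by fun_prop)).continuousWithinAt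

lemma IsLiebSolution.add (hq : 0 < q) {g₁ g₂ f₁ f₂ : ℂ → ℂ}
    (h₁ : IsLiebSolution c q g₁ f₁) (h₂ : IsLiebSolution c q g₂ f₂) :
    IsLiebSolution c q (fun x => g₁ x + g₂ x) (fun x => f₁ x + f₂ x) where
  cont := h₁.cont.add h₂.cont
  eqn x hx := by
    simp only [mul_add]
    rw [intervalIntegral.integral_add (intervalIntegrable_liebK_mul hq h₁.cont hx)
      (intervalIntegrable_liebK_mul hq h₂.cont hx), ← h₁.eqn x hx, ← h₂.eqn x hx]
    ring

lemma IsLiebSolution.const_mul {g f : ℂ → ℂ} (a : ℂ) (h : IsLiebSolution c q g f) :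
    IsLiebSolution c q (fun x => a * g x) (fun x => a * f x) where
  cont := h.cont.const_mul a
  eqn x hx := by
    simp only [mul_left_comm _ a, intervalIntegral.integral_const_mul]
    rw [← h.eqn x hx]
    ring

lemma IsLiebSolution.sub (hq : 0 < q) {g₁ g₂ f₁ f₂ : ℂ → ℂ}
    (h₁ : IsLiebSolution c q g₁ f₁) (h₂ : IsLiebSolution c q g₂ f₂) :
    IsLiebSolution c q (fun x => g₁ x - g₂ x) (fun x => f₁ x - f₂ x) := by
  simpa [sub_eq_add_neg] using h₁.add hq (h₂.const_mul (-1))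

lemma IsLiebSolution.sum (hq : 0 < q) {ι : Type*} (s : Finset ι) {g f : ι → ℂ → ℂ}
    (h : ∀ i, IsLiebSolution c q (g i) (f i)) :
    IsLiebSolution c q (fun x => ∑ i ∈ s, g i x) (fun x => ∑ i ∈ s, f i x) := by
  classical
  induction s using Finset.induction_on with
  | empty => exact ⟨by simpa using continuousOn_const, by simp⟩
  | insert i s hi ih => simpa [Finset.sum_insert hi] using (h i).add hq ih

/-- The norm of the integral operator with kernel `K / 2π`. -/
def liebRatio (c q : ℝ) : ℝ := 2 * Real.arctan (2 * q / c) / Real.pi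

lemma liebRatio_nonneg (hc : 0 < c) (hq : 0 < q) : 0 ≤ liebRatio c q := (lieb_ratio hc hq).1

lemma liebRatio_lt_one (hc : 0 < c) (hq : 0 < q) : liebRatio c q < 1 := (lieb_ratio hc hq).2

lemma IsLiebSolution.eq {g f : ℂ → ℂ} (h : IsLiebSolution c q g f) {x : ℂ} (hx : |x.im| < c) :
    f x = g x + (∫ τ in (-q)..q, liebK c (x - τ) * f τ) / (2 * Real.pi) := by
  rw [← h.eqn x hx]; ring

/-- At a maximum of `|f|` on `[-q, q]` the equation gives `max |f| ≤ B + ρ max |f|` with `ρ =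
liebRatio c q < 1`. -/
lemma IsLiebSolution.norm_le (hc : 0 < c) (hq : 0 < q) {g f : ℂ → ℂ} (h : IsLiebSolution c q g f)
    {B : ℝ} (hB : ∀ τ ∈ Set.Icc (-q) q, ‖g (τ : ℝ)‖ ≤ B) {τ : ℝ} (hτ : τ ∈ Set.Icc (-q) q) :
    ‖f τ‖ ≤ B / (1 - liebRatio c q) := by
  obtain ⟨t, ht, hmax⟩ := isCompact_Icc.exists_isMaxOn
    (Set.nonempty_Icc.2 (by linarith : -q ≤ q)) h.cont.norm
  have h1 := lieb_norm_le hc hq (h := fun τ : ℝ => f τ) (B := ‖f t‖) (fun τ hτ => hmax hτ) ht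
  have h2 : ‖f t‖ ≤ B + liebRatio c q * ‖f t‖ := by
    conv_lhs => rw [h.eq (x := t) (by simpa using hc)]
    exact (norm_add_le _ _).trans (add_le_add (hB t ht) h1)
  have h3 := liebRatio_lt_one hc hq
  rw [le_div_iff₀ (by linarith)]
  have h4 : ‖f τ‖ ≤ ‖f t‖ := hmax hτ
  nlinarith

lemma norm_liebK_le (hc : 0 < c) {x : ℂ} (hx : |x.im| ≤ c / 2) : ‖liebK c x‖ ≤ 8 / c := by
  have h1 : c / 2 ≤ ‖x - Complex.I * c‖ := by
    refine le_trans ?_ (Complex.abs_im_le_norm _)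
    simp only [Complex.sub_im, Complex.mul_im, Complex.I_re, Complex.I_im, Complex.ofReal_re,
      Complex.ofReal_im, zero_mul, one_mul, zero_add]
    rw [abs_le] at hx
    rw [abs_sub_comm]
    exact le_trans (by linarith) (le_abs_self _)
  have h2 : c / 2 ≤ ‖x + Complex.I * c‖ := by
    refine le_trans ?_ (Complex.abs_im_le_norm _)
    simp only [Complex.add_im, Complex.mul_im, Complex.I_re, Complex.I_im, Complex.ofReal_re,
      Complex.ofReal_im, zero_mul, one_mul, zero_add]
    rw [abs_le] at hx
    exact le_trans (by linarith) (le_abs_self _)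
  rw [liebK, sq_add_sq_eq, norm_div, norm_mul, norm_mul, Complex.norm_real,
    Real.norm_of_nonneg hc.le, Complex.norm_ofNat]
  calc 2 * c / (‖x - Complex.I * c‖ * ‖x + Complex.I * c‖) ≤ 2 * c / (c / 2 * (c / 2)) := by gcongr
    _ = 8 / c := by field_simp; norm_num

lemma mem_strip_quarter {x : ℂ} : x ∈ strip (c / 4) ↔ |x.im| < c / 2 := by
  rw [strip, Set.mem_ofPred_eq]; ring_nf

/-- The convolution with the Lieb kernel is holomorphic in a strip. -/
lemma differentiableOn_liebConv (hc : 0 < c) (hq : 0 < q) {u : ℝ → ℂ}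
    (hu : ContinuousOn u (Set.Icc (-q) q)) :
    DifferentiableOn ℂ (fun x => ∫ τ in (-q)..q, liebK c (x - τ) * u τ) (strip (c / 4)) := by
  obtain ⟨B, hB⟩ := isCompact_Icc.exists_bound_of_continuousOn hu
  have him : ∀ (x : ℂ) (τ : ℝ), (x - τ).im = x.im := by simp
  refine differentiableOn_intervalIntegral_of_bounded (by linarith) (isOpen_strip _)
    (B := 8 / c * B) (fun x hx => ?_) (fun τ hτ x hx => ?_) (fun τ hτ x hx => ?_)
  · refine ContinuousOn.aestronglyMeasurable (ContinuousOn.mul ?_ hu) measurableSet_Icc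
    intro τ _
    rw [mem_strip_quarter] at hx
    exact ((differentiableAt_liebK (c := c) (x := x - τ) (by rw [him]; linarith)).continuousAt.comp
      (f := fun τ : ℝ => x - τ) (by fun_prop)).continuousWithinAt
  · rw [mem_strip_quarter] at hx
    rw [norm_mul]
    gcongr
    · exact norm_liebK_le hc (by rw [him]; exact hx.le)
    · exact hB τ hτ
  · rw [mem_strip_quarter] at hx
    refine (DifferentiableAt.mul_const ?_ _).differentiableWithinAt
    change DifferentiableAt ℂ (liebK c ∘ fun x : ℂ => x - τ) x
    exact (differentiableAt_liebK (x := x - τ) (by rw [him]; linarith)).comp x (by fun_prop)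

/-- The equation holds off the real axis, where it expresses `f` as `g` plus a convolution that only
involves `f` on `[-q, q]`. The bound `IsLiebSolution.norm_le_strip` has the same origin. -/
lemma IsLiebSolution.differentiableOn (hc : 0 < c) (hq : 0 < q) {g f : ℂ → ℂ} {U : Set ℂ}
    (hU : U ⊆ strip (c / 4)) (hg : DifferentiableOn ℂ g U) (h : IsLiebSolution c q g f) :
    DifferentiableOn ℂ f U :=
  (hg.add (((differentiableOn_liebConv hc hq h.cont).mono hU).div_const _)).congr fun x hx =>
    h.eq (by have := mem_strip_quarter.1 (hU hx); linarith)

lemma norm_liebConv_le (hc : 0 < c) (hq : 0 < q) {u : ℝ → ℂ} {B : ℝ}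
    (hu : ∀ τ ∈ Set.Icc (-q) q, ‖u τ‖ ≤ B) {x : ℂ} (hx : |x.im| ≤ c / 2) :
    ‖∫ τ in (-q)..q, liebK c (x - τ) * u τ‖ ≤ 8 / c * B * (2 * q) := by
  have := intervalIntegral.norm_integral_le_of_norm_le_const (a := -q) (b := q)
    (f := fun τ : ℝ => liebK c (x - τ) * u τ) (C := 8 / c * B) (fun τ hτ => by
      rw [Set.uIoc_of_le (by linarith)] at hτ
      rw [norm_mul]
      gcongr
      · exact norm_liebK_le hc (by simpa using hx)
      · exact hu τ ⟨hτ.1.le, hτ.2⟩)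
  rwa [show |q - -q| = 2 * q by rw [abs_of_pos (by linarith)]; ring] at this

/-- A bound for the solution of the Lieb equation in terms of the driving term. -/
def liebConst (c q : ℝ) : ℝ := 1 + 8 / c * (2 * q) / (1 - liebRatio c q)

lemma liebConst_pos (hc : 0 < c) (hq : 0 < q) : 0 < liebConst c q := by
  have := liebRatio_lt_one hc hq
  have : 0 < 1 - liebRatio c q := by linarith
  rw [liebConst]
  positivity

lemma IsLiebSolution.norm_le_strip (hc : 0 < c) (hq : 0 < q) {g f : ℂ → ℂ}
    (h : IsLiebSolution c q g f) {B : ℝ} (hB : ∀ τ ∈ Set.Icc (-q) q, ‖g (τ : ℝ)‖ ≤ B) {x : ℂ}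
    (hx : x ∈ strip (c / 4)) (hxB : ‖g x‖ ≤ B) : ‖f x‖ ≤ liebConst c q * B := by
  rw [mem_strip_quarter] at hx
  have hB0 : 0 ≤ B := (norm_nonneg _).trans hxB
  have h1 := norm_liebConv_le hc hq (u := fun τ : ℝ => f τ) (fun τ hτ => h.norm_le hc hq hB hτ) hx.le
  have hr := liebRatio_lt_one hc hq
  have hr' : 0 < 1 - liebRatio c q := by linarith
  have h2pi : ‖(2 * Real.pi : ℂ)‖ = 2 * Real.pi := by
    rw [norm_mul, Complex.norm_real, Real.norm_of_nonneg Real.pi_pos.le]; simp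
  have hpi : (1 : ℝ) ≤ 2 * Real.pi := by linarith [Real.pi_gt_three]
  rw [h.eq (by linarith)]
  calc ‖g x + (∫ τ in (-q)..q, liebK c (x - τ) * f τ) / (2 * Real.pi)‖
      ≤ B + (8 / c * (B / (1 - liebRatio c q)) * (2 * q)) / (2 * Real.pi) := by
        refine (norm_add_le _ _).trans ?_
        rw [norm_div, h2pi]
        gcongr
    _ ≤ B + (8 / c * (B / (1 - liebRatio c q)) * (2 * q)) := by
        gcongr
        exact div_le_self (by positivity) hpi
    _ = _ := by rw [liebConst]; ring

/-- The Picard iterates of the Lieb equation. -/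
def picard (c q : ℝ) (g : ℂ → ℂ) : ℕ → ℂ → ℂ
  | 0 => fun _ => 0
  | k + 1 => fun x => g x + (∫ τ in (-q)..q, liebK c (x - τ) * picard c q g k τ) / (2 * Real.pi)

lemma ofReal_mem_strip {δ : ℝ} (hδ : 0 < δ) (x : ℝ) : (x : ℂ) ∈ strip δ := by
  simp [strip, hδ]

lemma continuousOn_picard (hc : 0 < c) (hq : 0 < q) {g : ℂ → ℂ}
    (hg : ContinuousOn (fun x : ℝ => g x) (Set.Icc (-q) q)) (k : ℕ) :
    ContinuousOn (fun x : ℝ => picard c q g k x) (Set.Icc (-q) q) := by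
  induction k with
  | zero => exact continuousOn_const
  | succ k ih =>
    refine hg.add (ContinuousOn.div_const ?_ _)
    exact (differentiableOn_liebConv hc hq ih).continuousOn.comp
      (f := fun x : ℝ => (x : ℂ)) (by fun_prop) fun x _ => ofReal_mem_strip (by positivity) x

/-- The iteration starts at 0, so the initial error is `f` itself; every step multiplies the error
by at most `liebRatio c q`. The rate depends on `g` only through `B`, which makes the convergence
uniform in parameters. -/
lemma norm_picard_sub_le (hc : 0 < c) (hq : 0 < q) {g f : ℂ → ℂ}
    (hg : ContinuousOn (fun x : ℝ => g x) (Set.Icc (-q) q)) (hf : IsLiebSolution c q g f) {B : ℝ}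
    (hB : ∀ τ ∈ Set.Icc (-q) q, ‖g (τ : ℝ)‖ ≤ B) (k : ℕ) {x : ℝ} (hx : x ∈ Set.Icc (-q) q) :
    ‖picard c q g k x - f x‖ ≤ liebRatio c q ^ k * (B / (1 - liebRatio c q)) := by
  induction k generalizing x with
  | zero => simpa [picard] using hf.norm_le hc hq hB hx
  | succ k ih =>
    have hx0 : |(x : ℂ).im| < c := by simpa using hc
    have e : picard c q g (k + 1) x - f x = (∫ τ in (-q)..q, liebK c ((x : ℂ) - (τ : ℂ))
        * (picard c q g k τ - f τ)) / (2 * Real.pi) := by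
      rw [hf.eq hx0, picard]
      simp only [mul_sub]
      rw [intervalIntegral.integral_sub
        (intervalIntegrable_liebK_mul hq (continuousOn_picard hc hq hg k) hx0)
        (intervalIntegrable_liebK_mul hq hf.cont hx0)]
      ring
    rw [e]
    refine (lieb_norm_le hc hq (h := fun τ : ℝ => picard c q g k τ - f τ) (fun τ hτ => ih hτ)
      hx).trans_eq ?_
    rw [← liebRatio]
    ring

/-- Solutions of the Lieb equation depend holomorphically on parameters of the driving term. -/
theorem differentiableOn_liebSolve_param (hc : 0 < c) (hq : 0 < q) {U : Set ℂ} (hU : IsOpen U)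
    {g f : ℂ → ℂ → ℂ} {B : ℝ}
    (hg : ∀ z ∈ U, ContinuousOn (fun x : ℝ => g z x) (Set.Icc (-q) q))
    (hB : ∀ z ∈ U, ∀ τ ∈ Set.Icc (-q) q, ‖g z (τ : ℝ)‖ ≤ B)
    (hd : ∀ τ ∈ Set.Icc (-q) q, DifferentiableOn ℂ (fun z => g z (τ : ℝ)) U)
    (hf : ∀ z ∈ U, IsLiebSolution c q (g z) (f z)) {x : ℂ} (hx : x ∈ strip (c / 4))
    (hdx : DifferentiableOn ℂ (fun z => g z x) U) : DifferentiableOn ℂ (fun z => f z x) U := by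
  have hr0 := liebRatio_nonneg hc hq
  have hr1 := liebRatio_lt_one hc hq
  have hr' : 0 < 1 - liebRatio c q := by linarith
  set R := B / (1 - liebRatio c q) with hR
  have him : ∀ {x : ℂ}, x ∈ strip (c / 4) → |x.im| < c := fun h => by
    have := mem_strip_quarter.1 h; linarith
  have conv : ∀ {v : ℂ → ℂ → ℂ} {B' : ℝ} {x : ℂ}, x ∈ strip (c / 4) →
      (∀ z ∈ U, ContinuousOn (fun x : ℝ => v z x) (Set.Icc (-q) q)) →
      (∀ z ∈ U, ∀ τ ∈ Set.Icc (-q) q, ‖v z (τ : ℝ)‖ ≤ B') →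
      (∀ τ ∈ Set.Icc (-q) q, DifferentiableOn ℂ (fun z => v z (τ : ℝ)) U) →
      DifferentiableOn ℂ (fun z => ∫ τ in (-q)..q, liebK c (x - τ) * v z τ) U := by
    intro v B' x hx hv hvB hvd
    refine differentiableOn_intervalIntegral_of_bounded (by linarith) hU
      (B := 8 / c * B') (fun z hz => ?_) (fun τ hτ z hz => ?_) (fun τ hτ => ?_)
    · have := (intervalIntegrable_liebK_mul hq (hv z hz) (him hx)).aestronglyMeasurable
      rwa [Measure.restrict_congr_set Ioc_ae_eq_Icc] at this
    · rw [norm_mul]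
      gcongr
      · exact norm_liebK_le hc (by simpa using (mem_strip_quarter.1 hx).le)
      · exact hvB z hz τ hτ
    · exact (hvd τ hτ).const_mul _
  have hp : ∀ k, ∀ z ∈ U, ∀ τ ∈ Set.Icc (-q) q, ‖picard c q (g z) k (τ : ℝ)‖ ≤ R + R := by
    intro k z hz τ hτ
    have h1 := norm_picard_sub_le hc hq (hg z hz) (hf z hz) (hB z hz) k hτ
    have h2 := (hf z hz).norm_le hc hq (hB z hz) hτ
    have hR0 : 0 ≤ R := (norm_nonneg _).trans h2
    have h3 : liebRatio c q ^ k * R ≤ R := mul_le_of_le_one_left hR0 (pow_le_one₀ hr0 hr1.le)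
    calc ‖picard c q (g z) k τ‖ = ‖(picard c q (g z) k τ - f z τ) + f z τ‖ := by ring_nf
      _ ≤ _ := (norm_add_le _ _).trans (add_le_add (h1.trans h3) h2)
  have hpd : ∀ k, ∀ τ ∈ Set.Icc (-q) q, DifferentiableOn ℂ (fun z => picard c q (g z) k (τ : ℝ)) U := by
    intro k
    induction k with
    | zero => exact fun τ _ => differentiableOn_const _
    | succ k ih =>
      intro τ hτ
      refine (hd τ hτ).add (DifferentiableOn.div_const ?_ _)
      exact conv (ofReal_mem_strip (by positivity) τ)
        (fun z hz => continuousOn_picard hc hq (hg z hz) k) (hp k) ih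
  have hfd : ∀ τ ∈ Set.Icc (-q) q, DifferentiableOn ℂ (fun z => f z (τ : ℝ)) U := by
    intro τ hτ
    -- On `[-q, q]` the solution is a uniform limit of holomorphic Picard iterates; off the interval
    -- the equation itself then gives holomorphy in `z`.
    have hlim : TendstoUniformlyOn (fun k z => picard c q (g z) k (τ : ℝ)) (fun z => f z (τ : ℝ))
        atTop U := by
      rw [Metric.tendstoUniformlyOn_iff]
      intro ε hε
      have : Tendsto (fun k => liebRatio c q ^ k * R) atTop (𝓝 (0 * R)) :=
        (tendsto_pow_atTop_nhds_zero_of_lt_one hr0 hr1).mul_const R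
      rw [zero_mul] at this
      filter_upwards [this.eventually_lt_const hε] with k hk z hz
      rw [dist_comm, dist_eq_norm]
      exact (norm_picard_sub_le hc hq (hg z hz) (hf z hz) (hB z hz) k hτ).trans_lt hk
    exact hlim.tendstoLocallyUniformlyOn.differentiableOn
      (Eventually.of_forall fun k => hpd k τ hτ) hU
  refine (hdx.add ((conv (B' := R) hx (fun z hz => (hf z hz).cont)
    (fun z hz τ hτ => (hf z hz).norm_le hc hq (hB z hz) hτ) hfd).div_const (2 * Real.pi))).congr ?_
  exact fun z hz => (hf z hz).eq (him hx)

/-! ### The phase -/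

/-- If the quotient were a real `w ≤ 0`, comparing imaginary parts would give `c + Im x = w (c - Im
x)`, with a positive left side and a nonpositive right side. -/
lemma phase_slitPlane {x : ℂ} (hx : |x.im| < c) :
    (Complex.I * c + x) / (Complex.I * c - x) ∈ Complex.slitPlane := by
  have hx' := abs_lt.1 hx
  have hne : Complex.I * c - x ≠ 0 := fun h => by
    have := congrArg Complex.im h
    simp at this
    linarith
  rw [Complex.mem_slitPlane_iff_not_le_zero]
  intro hle
  rw [Complex.le_def] at hle
  set w := (Complex.I * c + x) / (Complex.I * c - x) with hw
  have him : w.im = 0 := by simpa using hle.2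
  have hre : w.re ≤ 0 := by simpa using hle.1
  have e : Complex.I * c + x = w * (Complex.I * c - x) := by rw [hw]; field_simp
  have := congrArg Complex.im e
  simp [him] at this
  nlinarith

lemma differentiableAt_bareTheta {x : ℂ} (hx : |x.im| < c) :
    DifferentiableAt ℂ (bareTheta c) x := by
  have hx' := abs_lt.1 hx
  have hne : Complex.I * c - x ≠ 0 := fun h => by
    have := congrArg Complex.im h
    simp at this
    linarith
  have h : DifferentiableAt ℂ (fun x : ℂ => (Complex.I * c + x) / (Complex.I * c - x)) x :=
    DifferentiableAt.div (by fun_prop) (by fun_prop) hne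
  exact (h.clog (phase_slitPlane hx)).const_mul _

lemma norm_log_le {w : ℂ} {M : ℝ} (h1 : M⁻¹ ≤ ‖w‖) (h2 : ‖w‖ ≤ M) (hM : 0 < M) :
    ‖Complex.log w‖ ≤ Real.log M + Real.pi := by
  have h0 : 0 < ‖w‖ := lt_of_lt_of_le (by positivity) h1
  refine (Complex.norm_le_abs_re_add_abs_im _).trans (add_le_add ?_ ?_)
  · rw [Complex.log_re, abs_le, ← Real.log_inv]
    exact ⟨Real.log_le_log (by positivity) h1, Real.log_le_log h0 h2⟩
  · rw [Complex.log_im]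
    exact Complex.abs_arg_le_pi w

/-- In this strip the quotient under the logarithm has modulus between 1 / 3 and 3. -/
lemma norm_bareTheta_le (hc : 0 < c) {x : ℂ} (hx : |x.im| ≤ c / 2) :
    ‖bareTheta c x‖ ≤ Real.log 3 + Real.pi := by
  have hx' := abs_le.1 hx
  have hn1 : ‖Complex.I * c + x‖ ^ 2 = x.re ^ 2 + (c + x.im) ^ 2 := by
    rw [Complex.sq_norm, Complex.normSq_apply]; simp; ring
  have hn2 : ‖Complex.I * c - x‖ ^ 2 = x.re ^ 2 + (c - x.im) ^ 2 := by
    rw [Complex.sq_norm, Complex.normSq_apply]; simp; ring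
  have h1 : ‖Complex.I * c + x‖ ≤ 3 * ‖Complex.I * c - x‖ := by
    refine le_of_sq_le_sq ?_ (by positivity)
    rw [mul_pow, hn1, hn2]
    nlinarith [sq_nonneg x.re, mul_nonneg (by linarith : 0 ≤ c - 2 * x.im)
      (by linarith : 0 ≤ 2 * c - x.im)]
  have h2 : ‖Complex.I * c - x‖ ≤ 3 * ‖Complex.I * c + x‖ := by
    refine le_of_sq_le_sq ?_ (by positivity)
    rw [mul_pow, hn1, hn2]
    nlinarith [sq_nonneg x.re, mul_nonneg (by linarith : 0 ≤ c + 2 * x.im)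
      (by linarith : 0 ≤ 2 * c + x.im)]
  have h3 : 0 < ‖Complex.I * c - x‖ := by
    have : 0 < ‖Complex.I * c - x‖ ^ 2 := by
      rw [hn2]; nlinarith [sq_nonneg x.re, sq_nonneg (c - x.im)]
    exact lt_of_le_of_ne (norm_nonneg _) fun h => by simp [← h] at this
  rw [bareTheta, norm_mul, Complex.norm_I, one_mul]
  refine norm_log_le ?_ ?_ (by norm_num)
  · rw [norm_div, le_div_iff₀ h3, inv_mul_le_iff₀ (by norm_num)]
    exact h2
  · rw [norm_div, div_le_iff₀ h3]
    exact h1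

/-! ### The dressed charge -/

lemma isLiebSolution_dressedCharge (hc : 0 < c) (hq : 0 < q) :
    IsLiebSolution c q (fun _ => 1) (dressedCharge c q) :=
  liebSolve_spec hc hq continuousOn_const

/-- The kernel and the driving term are real on the real axis, so the reflected function solves the
same equation; uniqueness concludes. -/
lemma conj_dressedCharge (hc : 0 < c) (hq : 0 < q) {x : ℂ} (hx : |x.im| < c) :
    (starRingEnd ℂ) (dressedCharge c q ((starRingEnd ℂ) x)) = dressedCharge c q x := by
  have h := isLiebSolution_dressedCharge hc hq
  have h' : IsLiebSolution c q (fun _ => 1)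
      (fun x => (starRingEnd ℂ) (dressedCharge c q ((starRingEnd ℂ) x))) := by
    refine ⟨?_, fun x hx => ?_⟩
    · simp only [Complex.conj_ofReal]
      exact Complex.continuous_conj.comp_continuousOn h.cont
    · have e := congrArg (starRingEnd ℂ) (h.eqn ((starRingEnd ℂ) x) (by simpa using hx))
      rw [map_sub, map_div₀, intervalIntegral.integral_of_le (by linarith), ← integral_conj,
        ← intervalIntegral.integral_of_le (by linarith)] at e
      simp only [map_mul, map_one, map_ofNat, Complex.conj_ofReal] at e ⊢
      rw [← e]
      congr 3
      funext τ
      simp [liebK, map_ofNat]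
  exact h'.unique hc hq h hx

lemma dressedCharge_re (hc : 0 < c) (hq : 0 < q) (x : ℝ) :
    (((dressedCharge c q x).re : ℝ) : ℂ) = dressedCharge c q x := by
  have := conj_dressedCharge hc hq (x := x) (by simpa using hc)
  rw [Complex.conj_ofReal] at this
  exact (Complex.conj_eq_iff_re.1 this)

lemma re_liebK_nonneg (hc : 0 < c) {x : ℂ} (hx : |x.im| < c) : 0 ≤ (liebK c x).re := by
  have hx' := abs_lt.1 hx
  rw [liebK, Complex.div_re]
  have h1 : (x ^ 2 + (c : ℂ) ^ 2).re = x.re ^ 2 - x.im ^ 2 + c ^ 2 := by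
    simp [sq]
  have h2 : (2 * (c : ℂ)).re = 2 * c := by simp
  have h3 : (2 * (c : ℂ)).im = 0 := by simp
  rw [h1, h2, h3, zero_mul, zero_div, add_zero]
  refine div_nonneg (mul_nonneg (by positivity) ?_) (Complex.normSq_nonneg _)
  nlinarith [sq_nonneg x.re]

lemma dressedCharge_re_eq (hc : 0 < c) (hq : 0 < q) {x : ℂ} (hx : |x.im| < c) :
    (dressedCharge c q x).re = 1 + (∫ τ in (-q)..q, (liebK c (x - τ)).re
      * (dressedCharge c q τ).re) / (2 * Real.pi) := by
  have h := isLiebSolution_dressedCharge hc hq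
  have hint := intervalIntegrable_liebK_mul hq h.cont hx
  have e := congrArg Complex.re (h.eq hx)
  have h1 : (∫ τ in (-q)..q, liebK c (x - τ) * dressedCharge c q τ).re
      = ∫ τ in (-q)..q, (liebK c (x - τ)).re * (dressedCharge c q τ).re := by
    have := Complex.reCLM.intervalIntegral_comp_comm hint
    simp only [Complex.reCLM_apply] at this
    rw [← this]
    refine intervalIntegral.integral_congr fun τ _ => ?_
    rw [← dressedCharge_re hc hq τ, Complex.mul_re, Complex.ofReal_im, mul_zero, sub_zero,
      Complex.ofReal_re]
  rw [e, Complex.add_re, Complex.one_re, show (2 * Real.pi : ℂ) = ((2 * Real.pi : ℝ) : ℂ) by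
    push_cast; rfl, Complex.div_ofReal_re, h1]

/-- Minimum principle. If the minimum `m` over `[-q, q]` were negative, then, the kernel being
positive with integral at most `2π`, the equation at the minimum would give `m ≥ 1 + m`. -/
lemma dressedCharge_re_nonneg (hc : 0 < c) (hq : 0 < q) {x : ℝ} (hx : x ∈ Set.Icc (-q) q) :
    0 ≤ (dressedCharge c q x).re := by
  have h := isLiebSolution_dressedCharge hc hq
  obtain ⟨t, ht, hmin⟩ := isCompact_Icc.exists_isMinOn
    (Set.nonempty_Icc.2 (by linarith : -q ≤ q)) (Complex.continuous_re.comp_continuousOn h.cont)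
  refine le_trans ?_ (hmin hx)
  simp only [Function.comp]
  by_contra hneg
  push Not at hneg
  set m := (dressedCharge c q t).re with hm
  have hK : ∀ τ : ℝ, (liebK c ((t : ℂ) - τ)).re = 2 * c / ((t - τ) ^ 2 + c ^ 2) := fun τ => by
    rw [liebK_real, Complex.ofReal_re]
  have hKc : Continuous fun τ : ℝ => 2 * c / ((t - τ) ^ 2 + c ^ 2) :=
    Continuous.div (by fun_prop) (by fun_prop) fun τ => by positivity
  have h1 : (∫ τ in (-q)..q, 2 * c / ((t - τ) ^ 2 + c ^ 2)) * m
      ≤ ∫ τ in (-q)..q, (liebK c ((t : ℂ) - τ)).re * (dressedCharge c q τ).re := by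
    rw [← intervalIntegral.integral_mul_const]
    refine intervalIntegral.integral_mono_on (by linarith)
      ((hKc.mul continuous_const).intervalIntegrable _ _) ?_ fun τ hτ => ?_
    · simp only [hK]
      refine ContinuousOn.intervalIntegrable ?_
      rw [Set.uIcc_of_le (by linarith)]
      exact hKc.continuousOn.mul (Complex.continuous_re.comp_continuousOn h.cont)
    · rw [hK]
      have : m ≤ (dressedCharge c q τ).re := hmin hτ
      gcongr
  have h2 := integral_liebK_le hc ht
  have h3 := Real.arctan_lt_pi_div_two (2 * q / c)
  have h4 : (∫ τ in (-q)..q, 2 * c / ((t - τ) ^ 2 + c ^ 2)) ≤ 2 * Real.pi := by linarith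
  have h5 : 2 * Real.pi * m ≤ (∫ τ in (-q)..q, 2 * c / ((t - τ) ^ 2 + c ^ 2)) * m := by
    nlinarith
  have h6 := dressedCharge_re_eq hc hq (x := t) (by simpa using hc)
  have hpi := Real.pi_pos
  have h7 : m ≤ (∫ τ in (-q)..q, (liebK c ((t : ℂ) - τ)).re * (dressedCharge c q τ).re)
      / (2 * Real.pi) := by
    rw [le_div_iff₀ (by positivity)]; linarith
  linarith

/-- `Re Z` is 1 plus the integral of a product of two nonnegative functions, also off the real axis.
This lower bound is what lets `Re β` dominate the shift functional. -/
lemma one_le_norm_dressedCharge (hc : 0 < c) (hq : 0 < q) {x : ℂ} (hx : |x.im| < c) :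
    1 ≤ ‖dressedCharge c q x‖ := by
  refine le_trans ?_ (Complex.re_le_norm _)
  rw [dressedCharge_re_eq hc hq hx]
  have : 0 ≤ ∫ τ in (-q)..q, (liebK c (x - τ)).re * (dressedCharge c q τ).re :=
    intervalIntegral.integral_nonneg (by linarith) fun τ hτ =>
      mul_nonneg (re_liebK_nonneg hc (by simpa using hx)) (dressedCharge_re_nonneg hc hq hτ)
  have := div_nonneg this (by positivity : 0 ≤ 2 * Real.pi)
  linarith

lemma norm_dressedCharge_le (hc : 0 < c) (hq : 0 < q) {x : ℂ} (hx : x ∈ strip (c / 4)) :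
    ‖dressedCharge c q x‖ ≤ liebConst c q := by
  simpa using (isLiebSolution_dressedCharge hc hq).norm_le_strip hc hq (B := 1) (by simp) hx (by simp)

lemma differentiableOn_dressedCharge (hc : 0 < c) (hq : 0 < q) :
    DifferentiableOn ℂ (dressedCharge c q) (strip (c / 4)) :=
  (isLiebSolution_dressedCharge hc hq).differentiableOn hc hq subset_rfl (differentiableOn_const _)

/-! ### The dressed phase -/

variable {δ : ℝ}

lemma sub_im_lt (hδc : δ < c / 8) {x y : ℂ} (hx : x ∈ strip δ) (hy : y ∈ strip δ) :
    |(x - y).im| < c / 2 := by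
  have h1 := abs_lt.1 (show |x.im| < 2 * δ from hx)
  have h2 := abs_lt.1 (show |y.im| < 2 * δ from hy)
  rw [Complex.sub_im, abs_lt]
  constructor <;> linarith

lemma strip_subset_quarter (hδ : 0 < δ) (hδc : δ < c / 8) : strip δ ⊆ strip (c / 4) := fun z hz => by
  have : |z.im| < 2 * δ := hz
  rw [mem_strip_quarter]; linarith

lemma norm_two_pi : ‖(2 * Real.pi : ℂ)‖ = 2 * Real.pi := by
  rw [norm_mul, Complex.norm_real, Real.norm_of_nonneg Real.pi_pos.le]; simp

lemma norm_phase_driving_le (hc : 0 < c) (hδc : δ < c / 8) {x y : ℂ} (hx : x ∈ strip δ)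
    (hy : y ∈ strip δ) :
    ‖bareTheta c (x - y) / (2 * Real.pi)‖ ≤ Real.log 3 + Real.pi := by
  have h1 := norm_bareTheta_le hc (sub_im_lt hδc hx hy).le
  rw [norm_div, norm_two_pi]
  exact (div_le_self (norm_nonneg _) (by linarith [Real.pi_gt_three])).trans h1

lemma differentiableOn_phase_driving (hc : 0 < c) (hδc : δ < c / 8) {y : ℂ} (hy : y ∈ strip δ) :
    DifferentiableOn ℂ (fun x => bareTheta c (x - y) / (2 * Real.pi)) (strip δ) := fun x hx =>
  (((differentiableAt_bareTheta (x := x - y) (by linarith [sub_im_lt hδc hx hy])).comp x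
    (by fun_prop : DifferentiableAt ℂ (fun x => x - y) x)).div_const _).differentiableWithinAt

lemma differentiableOn_phase_driving_right (hc : 0 < c) (hδc : δ < c / 8) {x : ℂ}
    (hx : x ∈ strip δ) :
    DifferentiableOn ℂ (fun y => bareTheta c (x - y) / (2 * Real.pi)) (strip δ) := fun y hy =>
  (((differentiableAt_bareTheta (x := x - y) (by linarith [sub_im_lt hδc hx hy])).comp y
    (by fun_prop : DifferentiableAt ℂ (fun y => x - y) y)).div_const _).differentiableWithinAt

lemma DifferentiableOn.continuousOn_ofReal {f : ℂ → ℂ} (hδ : 0 < δ)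
    (hf : DifferentiableOn ℂ f (strip δ)) (S : Set ℝ) : ContinuousOn (fun x : ℝ => f x) S :=
  hf.continuousOn.comp (f := fun x : ℝ => (x : ℂ)) (by fun_prop) fun x _ => ofReal_mem_strip hδ x

lemma isLiebSolution_dressedPhase (hc : 0 < c) (hq : 0 < q) (hδ : 0 < δ) (hδc : δ < c / 8) {y : ℂ}
    (hy : y ∈ strip δ) : IsLiebSolution c q (fun x => bareTheta c (x - y) / (2 * Real.pi))
      (fun x => dressedPhase c q x y) :=
  liebSolve_spec hc hq
    (DifferentiableOn.continuousOn_ofReal hδ (differentiableOn_phase_driving hc hδc hy) _)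

/-- A bound for the dressed phase on a strip. -/
def phaseBound (c q : ℝ) : ℝ := liebConst c q * (Real.log 3 + Real.pi)

lemma phaseBound_nonneg (hc : 0 < c) (hq : 0 < q) : 0 ≤ phaseBound c q :=
  mul_nonneg (liebConst_pos hc hq).le (add_nonneg (Real.log_nonneg (by norm_num)) Real.pi_pos.le)

lemma norm_dressedPhase_le (hc : 0 < c) (hq : 0 < q) (hδ : 0 < δ) (hδc : δ < c / 8) {x y : ℂ}
    (hx : x ∈ strip δ) (hy : y ∈ strip δ) : ‖dressedPhase c q x y‖ ≤ phaseBound c q :=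
  (isLiebSolution_dressedPhase hc hq hδ hδc hy).norm_le_strip hc hq
    (fun τ _ => norm_phase_driving_le hc hδc (ofReal_mem_strip hδ τ) hy)
    (strip_subset_quarter hδ hδc hx) (norm_phase_driving_le hc hδc hx hy)

lemma differentiableOn_dressedPhase_left (hc : 0 < c) (hq : 0 < q) (hδ : 0 < δ) (hδc : δ < c / 8)
    {y : ℂ} (hy : y ∈ strip δ) : DifferentiableOn ℂ (fun x => dressedPhase c q x y) (strip δ) :=
  (isLiebSolution_dressedPhase hc hq hδ hδc hy).differentiableOn hc hq (strip_subset_quarter hδ hδc)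
    (differentiableOn_phase_driving hc hδc hy)

/-- The second argument is a parameter of the driving term, hence the parametric theorem. It is also
the integration variable on the loop, so this is the holomorphy needed by the residue theorem. -/
lemma differentiableOn_dressedPhase_right (hc : 0 < c) (hq : 0 < q) (hδ : 0 < δ) (hδc : δ < c / 8)
    {x : ℂ} (hx : x ∈ strip δ) : DifferentiableOn ℂ (fun y => dressedPhase c q x y) (strip δ) :=
  differentiableOn_liebSolve_param hc hq (isOpen_strip δ)
    (f := fun y x => dressedPhase c q x y) (B := Real.log 3 + Real.pi)
    (fun _ hy => DifferentiableOn.continuousOn_ofReal hδ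
      (differentiableOn_phase_driving hc hδc hy) _)
    (fun _ hy τ _ => norm_phase_driving_le hc hδc (ofReal_mem_strip hδ τ) hy)
    (fun τ _ => differentiableOn_phase_driving_right hc hδc (ofReal_mem_strip hδ τ))
    (fun _ hy => isLiebSolution_dressedPhase hc hq hδ hδc hy)
    (strip_subset_quarter hδ hδc hx) (differentiableOn_phase_driving_right hc hδc hx)

end Lieb

/-! ### Calculus of bounded functionals that are holomorphic along families. -/

section Tame

/-- Densities on the loop `Γ` bounded by `R`. -/
structure IsDensity (Γ : ℝ → ℂ) (R : ℝ) (ϖ : ℂ → ℂ) : Prop where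
  cont : ContinuousOn ϖ (Set.range Γ)
  bound : ∀ z ∈ Set.range Γ, ‖ϖ z‖ ≤ R

/-- Families of densities that depend holomorphically on finitely many parameters. -/
structure IsHolFamily (Γ : ℝ → ℂ) (R : ℝ) {ℓ : ℕ} (U : Set (Fin ℓ → ℂ))
    (ν : (Fin ℓ → ℂ) → ℂ → ℂ) : Prop where
  isOpen : IsOpen U
  density : ∀ w ∈ U, IsDensity Γ R (ν w)
  diff : ∀ z ∈ Set.range Γ, DifferentiableOn ℂ (fun w => ν w z) U

/-- A family of functionals of the density, uniformly bounded and holomorphic along holomorphic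
families of densities. -/
structure IsTame (Γ : ℝ → ℂ) (R : ℝ) {ι : Type*} (T : Set ι) (Ψ : ι → (ℂ → ℂ) → ℂ) : Prop where
  bound : ∃ B, ∀ i ∈ T, ∀ ϖ, IsDensity Γ R ϖ → ‖Ψ i ϖ‖ ≤ B
  diff : ∀ (ℓ : ℕ) (U : Set (Fin ℓ → ℂ)) (ν : (Fin ℓ → ℂ) → ℂ → ℂ), IsHolFamily Γ R U ν →
    ∀ i ∈ T, DifferentiableOn ℂ (fun w => Ψ i (ν w)) U

namespace IsTame

variable {Γ : ℝ → ℂ} {R : ℝ} {ι κ : Type*} {T : Set ι} {Ψ Ψ' : ι → (ℂ → ℂ) → ℂ}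

lemma exists_bound (h : IsTame Γ R T Ψ) :
    ∃ B, 0 ≤ B ∧ ∀ i ∈ T, ∀ ϖ, IsDensity Γ R ϖ → ‖Ψ i ϖ‖ ≤ B := by
  obtain ⟨B, hB⟩ := h.bound
  exact ⟨max B 0, le_max_right _ _, fun i hi ϖ hϖ => (hB i hi ϖ hϖ).trans (le_max_left _ _)⟩

lemma reindex (h : IsTame Γ R T Ψ) {S : Set κ} {f : κ → ι} (hf : Set.MapsTo f S T) :
    IsTame Γ R S (fun k => Ψ (f k)) where
  bound := h.bound.imp fun _ hB _ hk => hB _ (hf hk)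
  diff ℓ U ν hν _ hk := h.diff ℓ U ν hν _ (hf hk)

lemma const {k : ι → ℂ} {B : ℝ} (hk : ∀ i ∈ T, ‖k i‖ ≤ B) : IsTame Γ R T (fun i _ => k i) where
  bound := ⟨B, fun i hi _ _ => hk i hi⟩
  diff _ _ _ _ _ _ := differentiableOn_const _

/-- The generator of the calculus: the density enters all functionals below only through its values
on `Γ`. -/
lemma eval : IsTame Γ R (Set.range Γ) (fun z ϖ => ϖ z) where
  bound := ⟨R, fun _ hz _ hϖ => hϖ.bound _ hz⟩
  diff _ _ _ hν z hz := hν.diff z hz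

lemma add (h : IsTame Γ R T Ψ) (h' : IsTame Γ R T Ψ') :
    IsTame Γ R T (fun i ϖ => Ψ i ϖ + Ψ' i ϖ) where
  bound := by
    obtain ⟨B, hB⟩ := h.bound
    obtain ⟨B', hB'⟩ := h'.bound
    exact ⟨B + B', fun i hi ϖ hϖ => (norm_add_le _ _).trans
      (add_le_add (hB i hi ϖ hϖ) (hB' i hi ϖ hϖ))⟩
  diff ℓ U ν hν i hi := (h.diff ℓ U ν hν i hi).add (h'.diff ℓ U ν hν i hi)

lemma mul (h : IsTame Γ R T Ψ) (h' : IsTame Γ R T Ψ') :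
    IsTame Γ R T (fun i ϖ => Ψ i ϖ * Ψ' i ϖ) where
  bound := by
    obtain ⟨B, hB0, hB⟩ := h.exists_bound
    obtain ⟨B', hB'⟩ := h'.bound
    refine ⟨B * B', fun i hi ϖ hϖ => ?_⟩
    rw [norm_mul]
    exact mul_le_mul (hB i hi ϖ hϖ) (hB' i hi ϖ hϖ) (norm_nonneg _) hB0
  diff ℓ U ν hν i hi := (h.diff ℓ U ν hν i hi).mul (h'.diff ℓ U ν hν i hi)

lemma const_mul (h : IsTame Γ R T Ψ) (a : ℂ) : IsTame Γ R T (fun i ϖ => a * Ψ i ϖ) :=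
  (const (fun _ _ => le_rfl)).mul h

lemma neg (h : IsTame Γ R T Ψ) : IsTame Γ R T (fun i ϖ => -Ψ i ϖ) := by
  simpa using h.const_mul (-1)

lemma sub (h : IsTame Γ R T Ψ) (h' : IsTame Γ R T Ψ') :
    IsTame Γ R T (fun i ϖ => Ψ i ϖ - Ψ' i ϖ) := by
  simpa [sub_eq_add_neg] using h.add h'.neg

/-- Composition with a bounded holomorphic function. -/
lemma comp (h : IsTame Γ R T Ψ) {f : ℂ → ℂ} {V : Set ℂ} {B : ℝ} (hf : DifferentiableOn ℂ f V)
    (hB : ∀ x ∈ V, ‖f x‖ ≤ B) (hV : ∀ i ∈ T, ∀ ϖ, IsDensity Γ R ϖ → Ψ i ϖ ∈ V) :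
    IsTame Γ R T (fun i ϖ => f (Ψ i ϖ)) where
  bound := ⟨B, fun i hi ϖ hϖ => hB _ (hV i hi ϖ hϖ)⟩
  diff ℓ U ν hν i hi := hf.comp (h.diff ℓ U ν hν i hi) fun w hw => hV i hi _ (hν.density w hw)

lemma cexp (h : IsTame Γ R T Ψ) : IsTame Γ R T (fun i ϖ => Complex.exp (Ψ i ϖ)) where
  bound := by
    obtain ⟨B, hB⟩ := h.bound
    exact ⟨Real.exp B, fun i hi ϖ hϖ => (Complex.norm_exp_le_exp_norm _).trans
      (Real.exp_le_exp.2 (hB i hi ϖ hϖ))⟩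
  diff ℓ U ν hν i hi := (h.diff ℓ U ν hν i hi).cexp

lemma intervalIntegral {a b : ℝ} (hab : a ≤ b) {Ψ : ι × ℝ → (ℂ → ℂ) → ℂ}
    (h : IsTame Γ R (T ×ˢ Set.Icc a b) Ψ)
    (hm : ∀ i ∈ T, ∀ ϖ, IsDensity Γ R ϖ → ContinuousOn (fun t => Ψ (i, t) ϖ) (Set.Icc a b)) :
    IsTame Γ R T (fun i ϖ => ∫ t in a..b, Ψ (i, t) ϖ) where
  bound := by
    obtain ⟨B, hB⟩ := h.bound
    refine ⟨B * |b - a|, fun i hi ϖ hϖ => ?_⟩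
    refine intervalIntegral.norm_integral_le_of_norm_le_const fun t ht => ?_
    rw [Set.uIoc_of_le hab] at ht
    exact hB (i, t) ⟨hi, ht.1.le, ht.2⟩ ϖ hϖ
  diff ℓ U ν hν i hi := by
    obtain ⟨B, hB⟩ := h.bound
    exact differentiableOn_intervalIntegral_of_bounded hab hν.isOpen (B := B)
      (fun w hw => (hm i hi _ (hν.density w hw)).aestronglyMeasurable measurableSet_Icc)
      (fun t ht w hw => hB (i, t) ⟨hi, ht⟩ _ (hν.density w hw))
      (fun t ht => h.diff ℓ U ν hν (i, t) ⟨hi, ht⟩)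

lemma loopInt (hΓ : IsClosedCurve Γ) {Ψ : ι × ℂ → (ℂ → ℂ) → ℂ}
    (h : IsTame Γ R (T ×ˢ Set.range Γ) Ψ)
    (hm : ∀ i ∈ T, ∀ ϖ, IsDensity Γ R ϖ → Continuous (fun t => Ψ (i, Γ t) ϖ)) :
    IsTame Γ R T (fun i ϖ => NLS.loopInt Γ (fun z => Ψ (i, z) ϖ)) := by
  obtain ⟨S, hS⟩ := isCompact_Icc.exists_bound_of_continuousOn
    (hΓ.continuous_deriv.continuousOn (s := Set.Icc (0 : ℝ) 1))
  refine IsTame.intervalIntegral (Ψ := fun p ϖ => Ψ (p.1, Γ p.2) ϖ * deriv Γ p.2) zero_le_one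
    (mul (h.reindex (f := fun p : ι × ℝ => (p.1, Γ p.2)) fun p hp => ⟨hp.1, _, rfl⟩)
      (const fun p hp => hS _ hp.2)) fun i hi ϖ hϖ => ?_
  exact ((hm i hi ϖ hϖ).mul hΓ.continuous_deriv).continuousOn

lemma fredholmDet {Ψ : ℝ × ℝ → (ℂ → ℂ) → ℂ}
    (h : IsTame Γ R (Set.Icc (0 : ℝ) 1 ×ˢ Set.Icc (0 : ℝ) 1) Ψ)
    (hm : ∀ ϖ, IsDensity Γ R ϖ → Measurable (fun p => Ψ p ϖ)) :
    IsTame Γ R T (fun _ ϖ => NLS.fredholmDet 0 1 (fun s t => Ψ (s, t) ϖ)) where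
  bound := by
    obtain ⟨B, hB⟩ := h.bound
    exact ⟨_, fun i hi ϖ hϖ => norm_fredholmDet_le fun s hs t ht => hB (s, t) ⟨hs, ht⟩ ϖ hϖ⟩
  diff ℓ U ν hν i hi := by
    obtain ⟨B, hB⟩ := h.bound
    exact differentiableOn_fredholmDet hν.isOpen (fun w hw => hm _ (hν.density w hw))
      (fun w hw s hs t ht => hB (s, t) ⟨hs, ht⟩ _ (hν.density w hw))
      (fun s hs t ht => h.diff ℓ U ν hν (s, t) ⟨hs, ht⟩)

end IsTame

end Tame

/-! ### The shift functional and its Cauchy transform. -/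

section Functionals

/-- The loops on which the functionals are defined. -/
structure IsAdmissible (q δ : ℝ) (Γ ΓA : ℝ → ℂ) : Prop where
  curve : IsClosedCurve Γ
  subset : Set.range Γ ⊆ strip δ
  curveA : IsClosedCurve ΓA
  subsetA : Set.range ΓA ⊆ strip δ
  compact : IsCompact (Set.range Γ)
  compactA : IsCompact (Set.range ΓA)
  notMem : ∀ s, ∀ x ∈ Set.Icc (-q) q, (x : ℂ) ≠ ΓA s
  ne_zero : ∀ s, ΓA s ≠ 0
  log_domain : ∀ s t, 1 - Γ t / ΓA s ∈ Complex.slitPlane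

variable {c q δ : ℝ} {Γ ΓA : ℝ → ℂ} {R : ℝ} {ι : Type*} {T : Set ι}

lemma isTame_shiftFunctional (hc : 0 < c) (hq : 0 < q) (hδ : 0 < δ) (hδc : δ < c / 8)
    (hΓ : IsAdmissible q δ Γ ΓA) (β : ℂ) :
    IsTame Γ R (strip δ) (fun x ϖ => shiftFunctional c q Γ β ϖ x) := by
  refine IsTame.sub (IsTame.sub (IsTame.const_mul (IsTame.const (B := liebConst c q) ?_) _)
    (IsTame.const (B := phaseBound c q) ?_)) (IsTame.const_mul (IsTame.loopInt
      (Ψ := fun p ϖ => ϖ p.2 * dressedPhase c q p.1 p.2) hΓ.curve (IsTame.mul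
      (IsTame.eval.reindex (f := Prod.snd) fun p hp => hp.2)
      (IsTame.const (B := phaseBound c q) ?_)) ?_) _)
  · exact fun x hx => norm_dressedCharge_le hc hq (strip_subset_quarter hδ hδc hx)
  · exact fun x hx => norm_dressedPhase_le hc hq hδ hδc hx (ofReal_mem_strip hδ q)
  · exact fun p hp => norm_dressedPhase_le hc hq hδ hδc hp.1 (hΓ.subset hp.2)
  · intro x hx ϖ hϖ
    exact (hϖ.cont.comp_continuous hΓ.curve.continuous fun t => ⟨t, rfl⟩).mul
      ((differentiableOn_dressedPhase_right hc hq hδ hδc hx).continuousOn.comp_continuous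
        hΓ.curve.continuous fun t => hΓ.subset ⟨t, rfl⟩)

lemma differentiableOn_shiftFunctional (hc : 0 < c) (hq : 0 < q) (hδ : 0 < δ) (hδc : δ < c / 8)
    (hΓ : IsAdmissible q δ Γ ΓA) (β : ℂ) {ϖ : ℂ → ℂ} (hϖ : IsDensity Γ R ϖ) :
    DifferentiableOn ℂ (shiftFunctional c q Γ β ϖ) (strip δ) := by
  obtain ⟨S, hS⟩ := isCompact_Icc.exists_bound_of_continuousOn
    (hΓ.curve.continuous_deriv.continuousOn (s := Set.Icc (0 : ℝ) 1))
  have hS0 : 0 ≤ S := (norm_nonneg _).trans (hS 0 (by simp))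
  have hR0 : 0 ≤ R := (norm_nonneg _).trans (hϖ.bound _ ⟨0, rfl⟩)
  refine (((differentiableOn_dressedCharge hc hq).mono (strip_subset_quarter hδ hδc)).const_mul
    _).sub (differentiableOn_dressedPhase_left hc hq hδ hδc (ofReal_mem_strip hδ q)) |>.sub
    (DifferentiableOn.const_mul ?_ _)
  refine differentiableOn_intervalIntegral_of_bounded zero_le_one (isOpen_strip δ)
    (B := R * phaseBound c q * S) (fun x hx => ?_) (fun t ht x hx => ?_) fun t ht => ?_
  · refine Continuous.aestronglyMeasurable ?_
    exact ((hϖ.cont.comp_continuous hΓ.curve.continuous fun t => ⟨t, rfl⟩).mul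
      ((differentiableOn_dressedPhase_right hc hq hδ hδc hx).continuousOn.comp_continuous
        hΓ.curve.continuous fun t => hΓ.subset ⟨t, rfl⟩)).mul hΓ.curve.continuous_deriv
  · rw [norm_mul, norm_mul]
    have := phaseBound_nonneg hc hq
    gcongr
    · exact hϖ.bound _ ⟨t, rfl⟩
    · exact norm_dressedPhase_le hc hq hδ hδc hx (hΓ.subset ⟨t, rfl⟩)
    · exact hS t ht
  · exact ((differentiableOn_dressedPhase_left hc hq hδ hδc (hΓ.subset ⟨t, rfl⟩)).const_mul
      _).mul_const _

lemma continuous_shiftFunctional_ofReal (hc : 0 < c) (hq : 0 < q) (hδ : 0 < δ) (hδc : δ < c / 8)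
    (hΓ : IsAdmissible q δ Γ ΓA) (β : ℂ) {ϖ : ℂ → ℂ} (hϖ : IsDensity Γ R ϖ) :
    Continuous fun x : ℝ => shiftFunctional c q Γ β ϖ x :=
  (differentiableOn_shiftFunctional hc hq hδ hδc hΓ β hϖ).continuousOn.comp_continuous
    (by fun_prop) fun x => ofReal_mem_strip hδ x

/-- The distance `d` to the interval must not depend on the index, because the bound in `IsTame` is
uniform in it. -/
lemma isTame_cauchyT (hc : 0 < c) (hq : 0 < q) (hδ : 0 < δ) (hδc : δ < c / 8)
    (hΓ : IsAdmissible q δ Γ ΓA) (β γ : ℂ) {p : ι → ℂ} {d : ℝ} (hd : 0 < d)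
    (hp : ∀ i ∈ T, ∀ x ∈ Set.Icc (-q) q, d ≤ ‖(x : ℂ) - p i‖) :
    IsTame Γ R T (fun i ϖ => cauchyT q (fun x => γ * shiftFunctional c q Γ β ϖ x) (p i)) := by
  refine IsTame.const_mul (IsTame.intervalIntegral (by linarith)
    (Ψ := fun (j : ι × ℝ) ϖ => γ * shiftFunctional c q Γ β ϖ j.2 / ((j.2 : ℂ) - p j.1)) ?_ ?_) _
  · simp only [div_eq_mul_inv]
    refine IsTame.mul (IsTame.const_mul ((isTame_shiftFunctional hc hq hδ hδc hΓ β).reindex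
      (f := fun j : ι × ℝ => (j.2 : ℂ)) fun j _ => ofReal_mem_strip hδ _) _)
      (IsTame.const (B := d⁻¹) fun j hj => ?_)
    rw [norm_inv]
    gcongr
    exact hp _ hj.1 _ hj.2
  · intro i hi ϖ hϖ
    refine ContinuousOn.div ?_ (by fun_prop) fun x hx h => ?_
    · exact ((continuous_shiftFunctional_ofReal hc hq hδ hδc hΓ β hϖ).const_mul γ).continuousOn
    · have := hp i hi x hx
      rw [h, norm_zero] at this
      linarith

end Functionals

/-! ### The factors of the functional, its kernels and their determinants. -/

section Kernels

variable {c q δ : ℝ} {Γ ΓA : ℝ → ℂ} {R : ℝ} {ι : Type*} {T : Set ι}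

/-- This is where `δ < c / 8` is used: differences of points of the strip have imaginary part below
`4 δ < c / 2`, so the shift by `± i c` leaves them at distance at least `c / 2` from the real axis.
All shifted denominators and principal logarithms are controlled in this way. -/
lemma le_abs_im_shift {ε : ℂ} (hε : ε = 1 ∨ ε = -1) {w : ℂ} (hw : |w.im| ≤ c / 2) :
    c / 2 ≤ |(w + ε * Complex.I * c).im| := by
  rw [abs_le] at hw
  rcases hε with rfl | rfl
  · have : (w + 1 * Complex.I * c).im = w.im + c := by simp
    rw [this]
    exact le_trans (by linarith) (le_abs_self _)
  · have : (w + -1 * Complex.I * c).im = w.im - c := by simp [sub_eq_add_neg]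
    rw [this]
    exact le_trans (by linarith) (neg_le_abs _)

lemma mem_slitPlane_of_le_abs_im (hc : 0 < c) {w : ℂ} (h : c / 2 ≤ |w.im|) :
    w ∈ Complex.slitPlane := by
  refine Complex.mem_slitPlane_iff.2 (Or.inr fun h0 => ?_)
  rw [h0, abs_zero] at h
  linarith

lemma abs_im_le_of_mem_strip (hc : 0 < c) (hδc : δ < c / 8) {z : ℂ} (hz : z ∈ strip δ) :
    |z.im| ≤ c / 2 := by
  have : |z.im| < 2 * δ := hz
  linarith

lemma abs_sub_im_shift (hc : 0 < c) (hδc : δ < c / 8) {ε : ℂ} (hε : ε = 1 ∨ ε = -1)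
    {z : ℂ} (hz : z ∈ strip δ) (x : ℝ) : c / 2 ≤ ‖(x : ℂ) - (z + ε * Complex.I * c)‖ := by
  refine le_trans ?_ (Complex.abs_im_le_norm _)
  rw [Complex.sub_im, Complex.ofReal_im, zero_sub, abs_neg]
  exact le_abs_im_shift hε (abs_im_le_of_mem_strip hc hδc hz)

lemma I_shift_eq (x : ℂ) : x + Complex.I * c = x + 1 * Complex.I * c ∧
    x - Complex.I * c = x + -1 * Complex.I * c := by
  constructor <;> ring

lemma le_norm_sub_sub (hc : 0 < c) (x y : ℝ) : c ≤ ‖(x : ℂ) - y - Complex.I * c‖ := by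
  refine le_trans ?_ (Complex.abs_im_le_norm _)
  simp [abs_of_pos hc]

lemma IsTame.intervalIntegral_intervalIntegral {a b : ℝ} (hab : a ≤ b)
    {Ψ : ℝ × ℝ → (ℂ → ℂ) → ℂ} (h : IsTame Γ R (Set.Icc a b ×ˢ Set.Icc a b) Ψ)
    (hm : ∀ ϖ, IsDensity Γ R ϖ → Continuous fun p => Ψ p ϖ) :
    IsTame Γ R T (fun _ ϖ => ∫ x in a..b, ∫ y in a..b, Ψ (x, y) ϖ) := by
  have inner : IsTame Γ R (Set.Icc a b) (fun x ϖ => ∫ y in a..b, Ψ (x, y) ϖ) :=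
    IsTame.intervalIntegral hab h fun x _ ϖ hϖ =>
      ((hm ϖ hϖ).comp (by fun_prop : Continuous fun y : ℝ => (x, y))).continuousOn
  exact IsTame.intervalIntegral hab (inner.reindex (f := fun p : ι × ℝ => p.2) fun p hp => hp.2)
    fun i _ ϖ hϖ => (intervalIntegral.continuous_parametric_intervalIntegral_of_continuous'
      (f := fun x y : ℝ => Ψ (x, y) ϖ) (hm ϖ hϖ) _ _).continuousOn

lemma IsTame.loopInt_loopInt (hΓ : IsClosedCurve Γ) {Ψ : ℂ × ℂ → (ℂ → ℂ) → ℂ}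
    (h : IsTame Γ R (Set.range Γ ×ˢ Set.range Γ) Ψ)
    (hm : ∀ ϖ, IsDensity Γ R ϖ → Continuous fun p : ℝ × ℝ => Ψ (Γ p.1, Γ p.2) ϖ) :
    IsTame Γ R T (fun _ ϖ => NLS.loopInt Γ (fun y => NLS.loopInt Γ (fun z => Ψ (y, z) ϖ))) := by
  have inner : IsTame Γ R (Set.range Γ) (fun y ϖ => NLS.loopInt Γ (fun z => Ψ (y, z) ϖ)) := by
    refine IsTame.loopInt hΓ h fun y hy ϖ hϖ => ?_
    obtain ⟨s, rfl⟩ := hy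
    exact (hm ϖ hϖ).comp (by fun_prop : Continuous fun t : ℝ => (s, t))
  refine IsTame.loopInt hΓ (inner.reindex (f := fun p : ι × ℂ => p.2) fun p hp => hp.2)
    fun i _ ϖ hϖ => intervalIntegral.continuous_parametric_intervalIntegral_of_continuous'
      (f := fun s t : ℝ => Ψ (Γ s, Γ t) ϖ * deriv Γ t) ?_ _ _
  exact (hm ϖ hϖ).mul (hΓ.continuous_deriv.comp continuous_snd)

lemma isTame_cauchyC0 (hc : 0 < c) (hq : 0 < q) (hδ : 0 < δ) (hδc : δ < c / 8)
    (hΓ : IsAdmissible q δ Γ ΓA) (β γ : ℂ) :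
    IsTame Γ R T (fun _ ϖ => cauchyC0 c q (fun x => γ * shiftFunctional c q Γ β ϖ x)) := by
  have tν := (isTame_shiftFunctional (R := R) hc hq hδ hδc hΓ β).const_mul γ
  have hne : ∀ x y : ℝ, ((x : ℂ) - y - Complex.I * c) ^ 2 ≠ 0 := fun x y =>
    pow_ne_zero 2 fun h => by
      have := le_norm_sub_sub hc x y
      rw [h, norm_zero] at this
      linarith
  have key : IsTame Γ R (Set.Icc (-q) q ×ˢ Set.Icc (-q) q) (fun (p : ℝ × ℝ) ϖ =>
      (γ * shiftFunctional c q Γ β ϖ p.1) * (γ * shiftFunctional c q Γ β ϖ p.2)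
        * (((p.1 : ℂ) - p.2 - Complex.I * c) ^ 2)⁻¹) := by
    refine ((tν.reindex (f := fun p : ℝ × ℝ => (p.1 : ℂ)) ?_).mul
      (tν.reindex (f := fun p : ℝ × ℝ => (p.2 : ℂ)) ?_)).mul
      (IsTame.const (B := (c ^ 2)⁻¹) fun p _ => ?_)
    · exact fun _ _ => ofReal_mem_strip hδ _
    · exact fun _ _ => ofReal_mem_strip hδ _
    · rw [norm_inv, norm_pow]
      have := le_norm_sub_sub hc p.1 p.2
      gcongr
  refine (IsTame.intervalIntegral_intervalIntegral (by linarith) key fun ϖ hϖ => ?_).neg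
  have h := (continuous_shiftFunctional_ofReal hc hq hδ hδc hΓ β hϖ).const_mul γ
  exact ((h.comp continuous_fst).mul (h.comp continuous_snd)).mul
    (Continuous.inv₀ (by fun_prop) fun p => hne p.1 p.2)

/-- Continuity of the Cauchy transform along curves that avoid the interval. -/
lemma continuous_cauchyT {ν : ℂ → ℂ} (hν : Continuous fun x : ℝ => ν x) {p : ℝ → ℂ}
    (hp : Continuous p) (hne : ∀ t, ∀ x ∈ Set.Icc (-q) q, (x : ℂ) ≠ p t) (hq : 0 < q) :
    Continuous fun t => cauchyT q ν (p t) := by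
  have hq' : -q ≤ q := by linarith
  have e : ∀ t, cauchyT q ν (p t) = (2 * Real.pi * Complex.I)⁻¹ * ∫ x in (-q)..q,
      ν (Set.projIcc (-q) q hq' x : ℝ) / ((Set.projIcc (-q) q hq' x : ℝ) - p t) := by
    intro t
    rw [cauchyT]
    congr 1
    refine intervalIntegral.integral_congr fun x hx => ?_
    rw [Set.uIcc_of_le hq'] at hx
    simp only [Set.projIcc_of_mem hq' hx]
  simp only [e]
  refine continuous_const.mul
    (intervalIntegral.continuous_parametric_intervalIntegral_of_continuous' ?_ _ _)
  have hpr : Continuous fun y : ℝ × ℝ => ((Set.projIcc (-q) q hq' y.2 : Set.Icc (-q) q) : ℝ) :=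
    continuous_subtype_val.comp (continuous_projIcc.comp continuous_snd)
  refine Continuous.div (hν.comp hpr) ?_ fun y => sub_ne_zero.2 (hne _ _ (Subtype.prop _))
  exact (Complex.continuous_ofReal.comp hpr).sub (hp.comp continuous_fst)

lemma isTame_factor (hc : 0 < c) (hq : 0 < q) (hδ : 0 < δ) (hδc : δ < c / 8)
    (hΓ : IsAdmissible q δ Γ ΓA) (β γ : ℂ) {ε : ℂ} (hε : ε = 1 ∨ ε = -1) :
    IsTame Γ R T (fun _ ϖ => loopInt Γ (fun z => ϖ z *
      (2 * Real.pi * Complex.I * cauchyT q (fun x => γ * shiftFunctional c q Γ β ϖ x)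
          (z + ε * Complex.I * c)
        + Complex.log (z - q + ε * Complex.I * c)))) := by
  have hslit : ∀ z ∈ Set.range Γ, z - q + ε * Complex.I * c ∈ Complex.slitPlane := fun z hz =>
    mem_slitPlane_of_le_abs_im hc (le_abs_im_shift hε
      (by simpa using abs_im_le_of_mem_strip hc hδc (hΓ.subset hz)))
  have hlog : ContinuousOn (fun z : ℂ => Complex.log (z - q + ε * Complex.I * c)) (Set.range Γ) :=
    ContinuousOn.clog (by fun_prop) hslit
  obtain ⟨L, hL⟩ := hΓ.compact.exists_bound_of_continuousOn hlog
  refine IsTame.loopInt hΓ.curve (Ψ := fun p ϖ => ϖ p.2 *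
      (2 * Real.pi * Complex.I * cauchyT q (fun x => γ * shiftFunctional c q Γ β ϖ x)
          (p.2 + ε * Complex.I * c)
        + Complex.log (p.2 - q + ε * Complex.I * c)))
    (IsTame.mul (IsTame.eval.reindex (f := Prod.snd) fun p hp => hp.2)
      (IsTame.add (IsTame.const_mul (isTame_cauchyT hc hq hδ hδc hΓ β γ (d := c / 2)
        (by positivity) ?_) _) (IsTame.const (B := L) fun p hp => hL _ hp.2))) ?_
  · exact fun p hp x _ => abs_sub_im_shift hc hδc hε (hΓ.subset hp.2) x
  · intro i _ ϖ hϖ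
    refine (hϖ.cont.comp_continuous hΓ.curve.continuous fun t => ⟨t, rfl⟩).mul
      ((continuous_const.mul (continuous_cauchyT
        ((continuous_shiftFunctional_ofReal hc hq hδ hδc hΓ β hϖ).const_mul γ)
        (p := fun t => Γ t + ε * Complex.I * c)
        (hΓ.curve.continuous.add continuous_const) (fun t x _ h => ?_) hq)).add
      (hlog.comp_continuous hΓ.curve.continuous fun t => ⟨t, rfl⟩))
    have := abs_sub_im_shift hc hδc hε (hΓ.subset ⟨t, rfl⟩) x
    rw [h, sub_self, norm_zero] at this
    linarith

lemma sub_sub_mem_slitPlane (hδc : δ < c / 8) {y z : ℂ} (hc : 0 < c) (hy : y ∈ strip δ)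
    (hz : z ∈ strip δ) : z - y - Complex.I * c ∈ Complex.slitPlane := by
  rw [(I_shift_eq (z - y)).2]
  exact mem_slitPlane_of_le_abs_im hc (le_abs_im_shift (Or.inr rfl) (sub_im_lt hδc hz hy).le)

lemma isTame_double (hc : 0 < c) (hδc : δ < c / 8) (hΓ : IsAdmissible q δ Γ ΓA) :
    IsTame Γ R T (fun _ ϖ => loopInt Γ (fun y => loopInt Γ (fun z =>
          ϖ y * ϖ z * Complex.log (z - y - Complex.I * c)))) := by
  have hlog : ContinuousOn (fun p : ℂ × ℂ => Complex.log (p.2 - p.1 - Complex.I * c))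
      (Set.range Γ ×ˢ Set.range Γ) :=
    ContinuousOn.clog (by fun_prop) fun p hp =>
      sub_sub_mem_slitPlane hδc hc (hΓ.subset hp.1) (hΓ.subset hp.2)
  obtain ⟨L, hL⟩ := (hΓ.compact.prod hΓ.compact).exists_bound_of_continuousOn hlog
  have hcont : ∀ ϖ, IsDensity Γ R ϖ → Continuous fun p : ℝ × ℝ =>
      ϖ (Γ p.1) * ϖ (Γ p.2) * Complex.log (Γ p.2 - Γ p.1 - Complex.I * c) := by
    intro ϖ hϖ
    have h1 : Continuous fun t => ϖ (Γ t) :=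
      hϖ.cont.comp_continuous hΓ.curve.continuous fun t => ⟨t, rfl⟩
    have hΓc := hΓ.curve.continuous
    exact ((h1.comp continuous_fst).mul (h1.comp continuous_snd)).mul
      (hlog.comp_continuous (f := fun p : ℝ × ℝ => (Γ p.1, Γ p.2)) (by fun_prop)
        fun p => ⟨⟨_, rfl⟩, ⟨_, rfl⟩⟩)
  exact IsTame.loopInt_loopInt hΓ.curve (Ψ := fun p ϖ => ϖ p.1 * ϖ p.2
      * Complex.log (p.2 - p.1 - Complex.I * c))
    (((IsTame.eval.reindex (f := fun p : ℂ × ℂ => p.1) fun p hp => hp.1).mul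
      (IsTame.eval.reindex (f := fun p : ℂ × ℂ => p.2) fun p hp => hp.2)).mul
      (IsTame.const (B := L) fun p hp => hL p hp)) hcont

/-! ### The kernels -/

lemma two_pi_mul_norm {ε γ x : ℂ} (hε : ε = 1 ∨ ε = -1) :
    ‖-(2 * Real.pi * Complex.I * ε * γ * x)‖ = 2 * Real.pi * (‖γ‖ * ‖x‖) := by
  have : ‖ε‖ = 1 := by rcases hε with rfl | rfl <;> simp
  rw [norm_neg, norm_mul, norm_mul, norm_mul, norm_mul, norm_two_pi, Complex.norm_I, this]
  ring

/-- The exponent `u` has modulus `2π |γ| |x| ≤ 1 / 2`, which is the reason for the constant 1 / 16.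
Then `|e^u - 1 - u| ≤ |u|²` gives `|e^u - 1| ≥ |u| / 2 = π |γ| |x| ≥ |γ|`. -/
lemma le_norm_exp_sub_one {ε γ x : ℂ} (hε : ε = 1 ∨ ε = -1) (hx : 1 ≤ ‖x‖)
    (hγ : ‖γ‖ * ‖x‖ ≤ 1 / 16) :
    ‖γ‖ ≤ ‖Complex.exp (-(2 * Real.pi * Complex.I * ε * γ * x)) - 1‖ := by
  set u := -(2 * Real.pi * Complex.I * ε * γ * x) with hu
  have hn : ‖u‖ = 2 * Real.pi * (‖γ‖ * ‖x‖) := two_pi_mul_norm hε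
  have h3 := Real.pi_gt_three
  have h4 := Real.pi_lt_four
  have hγx : ‖γ‖ ≤ ‖γ‖ * ‖x‖ := le_mul_of_one_le_right (norm_nonneg _) hx
  have h0 : 0 ≤ ‖γ‖ * ‖x‖ := by positivity
  have hle : ‖u‖ ≤ 1 / 2 := by rw [hn]; nlinarith
  have h1 := Complex.norm_exp_sub_one_sub_id_le (x := u) (by linarith)
  have h2 : ‖u‖ ≤ ‖Complex.exp u - 1‖ + ‖Complex.exp u - 1 - u‖ := by
    calc ‖u‖ = ‖(Complex.exp u - 1) - (Complex.exp u - 1 - u)‖ := by ring_nf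
      _ ≤ _ := norm_sub_le _ _
  nlinarith [norm_nonneg u]

lemma exp_sub_one_ne_zero {ε γ x : ℂ} (hε : ε = 1 ∨ ε = -1) (hx : 1 ≤ ‖x‖)
    (hγ : ‖γ‖ * ‖x‖ ≤ 1 / 16) (hγ0 : γ ≠ 0) :
    Complex.exp (-(2 * Real.pi * Complex.I * ε * γ * x)) - 1 ≠ 0 := fun h => by
  have := le_norm_exp_sub_one hε hx hγ
  rw [h, norm_zero] at this
  exact hγ0 (norm_le_zero_iff.1 this)

lemma norm_expRatio_le {ε γ x : ℂ} (hε : ε = 1 ∨ ε = -1) (hx : 1 ≤ ‖x‖)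
    (hγ : ‖γ‖ * ‖x‖ ≤ 1 / 16) : ‖expRatio ε γ x‖ ≤ 1 := by
  rw [expRatio]
  split_ifs with h
  · have : ‖ε‖ = 1 := by rcases hε with rfl | rfl <;> simp
    rw [norm_inv, norm_neg, norm_mul, norm_mul, norm_mul, norm_two_pi, Complex.norm_I, this]
    refine inv_le_one_of_one_le₀ ?_
    nlinarith [Real.pi_gt_three]
  · rw [norm_div]
    exact div_le_one_of_le₀ (le_norm_exp_sub_one hε hx hγ) (norm_nonneg _)

lemma differentiableAt_expRatio {ε γ x : ℂ} (hε : ε = 1 ∨ ε = -1) (hx : 1 ≤ ‖x‖)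
    (hγ : ‖γ‖ * ‖x‖ ≤ 1 / 16) : DifferentiableAt ℂ (expRatio ε γ) x := by
  have hx0 : x ≠ 0 := fun h => by rw [h, norm_zero] at hx; linarith
  have hε0 : ε ≠ 0 := by rcases hε with rfl | rfl <;> simp
  by_cases h : γ = 0
  · have : expRatio ε γ = fun x => (-(2 * Real.pi * Complex.I * ε * x))⁻¹ := by
      funext x; simp [expRatio, h]
    rw [this]
    exact DifferentiableAt.inv (by fun_prop) (by simp [hx0, hε0])
  · have : expRatio ε γ = fun x =>
        γ / (Complex.exp (-(2 * Real.pi * Complex.I * ε * γ * x)) - 1) := by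
      funext x; simp [expRatio, h]
    rw [this]
    exact DifferentiableAt.div (by fun_prop) (by fun_prop) (exp_sub_one_ne_zero hε hx hγ h)

/-- The shift functional is bounded from below and small after multiplication by `γ`. -/
def IsGapped (c q δ : ℝ) (Γ : ℝ → ℂ) (R : ℝ) (β γ : ℂ) : Prop :=
  ∀ ϖ, IsDensity Γ R ϖ → ∀ x ∈ strip δ, 1 ≤ ‖shiftFunctional c q Γ β ϖ x‖ ∧
    ‖γ‖ * ‖shiftFunctional c q Γ β ϖ x‖ ≤ 1 / 16

lemma IsAdmissible.exists_dist (hq : 0 < q) (hΓ : IsAdmissible q δ Γ ΓA) :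
    ∃ d, 0 < d ∧ ∀ ω ∈ Set.range ΓA, ∀ x ∈ Set.Icc (-q) q, d ≤ ‖(x : ℂ) - ω‖ := by
  obtain ⟨p, hp, hmin⟩ := (hΓ.compactA.prod (isCompact_Icc (a := -q) (b := q))).exists_isMinOn
    ⟨(ΓA 0, q), ⟨0, rfl⟩, by constructor <;> linarith⟩
    (f := fun p : ℂ × ℝ => ‖(p.2 : ℂ) - p.1‖) (by fun_prop)
  refine ⟨_, ?_, fun ω hω x hx => hmin (show (ω, x) ∈ _ from ⟨hω, hx⟩)⟩
  obtain ⟨⟨s, hs⟩, hx⟩ := hp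
  rw [norm_pos_iff, sub_ne_zero, ← hs]
  exact hΓ.notMem s _ hx

/-- The gap serves only the last factor, `expRatio`; the others are bounded functions independent of
the density or exponentials of Cauchy transforms at points away from the interval. -/
lemma isTame_baseKernel (hc : 0 < c) (hq : 0 < q) (hδ : 0 < δ) (hδc : δ < c / 8)
    (hΓ : IsAdmissible q δ Γ ΓA) {β γ : ℂ} (hg : IsGapped c q δ Γ R β γ) {ε : ℂ}
    (hε : ε = 1 ∨ ε = -1) :
    IsTame Γ R (Set.range ΓA ×ˢ Set.range ΓA) (fun p ϖ =>
      baseKernel c q ε γ (shiftFunctional c q Γ β ϖ) p.1 p.2) := by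
  obtain ⟨d, hd, hdist⟩ := hΓ.exists_dist hq
  have hne : ∀ ω ∈ Set.range ΓA, ω - q + ε * Complex.I * c ≠ 0 := fun ω hω =>
    Complex.slitPlane_ne_zero (mem_slitPlane_of_le_abs_im hc (le_abs_im_shift hε
      (by simpa using abs_im_le_of_mem_strip hc hδc (hΓ.subsetA hω))))
  obtain ⟨B, hB⟩ := hΓ.compactA.exists_bound_of_continuousOn
    (f := fun ω => -(ε / (2 * Real.pi)) * ((ω - q) / (ω - q + ε * Complex.I * c)))
    (continuousOn_const.mul (ContinuousOn.div (by fun_prop) (by fun_prop) hne))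
  refine IsTame.mul (IsTame.mul (IsTame.mul (IsTame.const (B := B) fun p hp => hB _ hp.1)
    (IsTame.cexp (IsTame.sub (IsTame.const_mul (isTame_cauchyT hc hq hδ hδc hΓ β γ hd ?_) _)
    (IsTame.const_mul (isTame_cauchyT hc hq hδ hδc hΓ β γ (d := c / 2) (by positivity) ?_) _))))
    (IsTame.const (B := 8 / c) fun p hp => ?_)) (IsTame.comp (f := expRatio ε γ) (B := 1)
      (V := {x | 1 ≤ ‖x‖ ∧ ‖γ‖ * ‖x‖ ≤ 1 / 16})
      ((isTame_shiftFunctional hc hq hδ hδc hΓ β).reindex (f := Prod.fst)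
        fun p hp => hΓ.subsetA hp.1) ?_ ?_ ?_)
  · exact fun p hp x hx => hdist _ hp.1 x hx
  · exact fun p hp x _ => abs_sub_im_shift hc hδc hε (hΓ.subsetA hp.1) x
  · exact norm_liebK_le hc (sub_im_lt hδc (hΓ.subsetA hp.1) (hΓ.subsetA hp.2)).le
  · exact fun x hx => (differentiableAt_expRatio hε hx.1 hx.2).differentiableWithinAt
  · exact fun x hx => norm_expRatio_le hε hx.1 hx.2
  · exact fun p hp ϖ hϖ => hg ϖ hϖ _ (hΓ.subsetA hp.1)

lemma sub_shift_mem_slitPlane (hc : 0 < c) (hδc : δ < c / 8) {ε : ℂ} (hε : ε = 1 ∨ ε = -1)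
    {y z : ℂ} (hz : z ∈ strip δ) (hy : y ∈ strip δ) :
    z - y + ε * Complex.I * c ∈ Complex.slitPlane :=
  mem_slitPlane_of_le_abs_im hc (le_abs_im_shift hε (sub_im_lt hδc hz hy).le)

lemma isTame_loopInt_kernelLog (hc : 0 < c) (hδc : δ < c / 8)
    (hΓ : IsAdmissible q δ Γ ΓA) {ε : ℂ} (hε : ε = 1 ∨ ε = -1) :
    IsTame Γ R (Set.range ΓA) (fun ω ϖ => loopInt Γ (fun z => ϖ z * kernelLog c ε ω z)) := by
  -- The principal `log ω` may jump where `ΓA` crosses the negative axis, so it is bounded through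
  -- its real part and its argument and not by continuity on the compact loop.
  have c1 : ContinuousOn (fun ω : ℂ => Real.log ‖ω‖) (Set.range ΓA) := by
    refine ContinuousOn.log (by fun_prop) ?_
    rintro _ ⟨s, rfl⟩
    exact norm_ne_zero_iff.2 (hΓ.ne_zero s)
  have c2 : ContinuousOn (fun p : ℂ × ℂ => Complex.log (1 - p.2 / p.1))
      (Set.range ΓA ×ˢ Set.range Γ) := by
    refine ContinuousOn.clog (ContinuousOn.sub continuousOn_const
      (ContinuousOn.div (by fun_prop) (by fun_prop) ?_)) ?_
    · rintro ⟨_, _⟩ ⟨⟨s, rfl⟩, -⟩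
      exact hΓ.ne_zero s
    · rintro ⟨_, _⟩ ⟨⟨s, rfl⟩, ⟨t, rfl⟩⟩
      exact hΓ.log_domain s t
  have c3 : ContinuousOn (fun p : ℂ × ℂ => Complex.log (p.1 - p.2 + ε * Complex.I * c))
      (Set.range ΓA ×ˢ Set.range Γ) :=
    ContinuousOn.clog (by fun_prop) fun p hp =>
      sub_shift_mem_slitPlane hc hδc hε (hΓ.subsetA hp.1) (hΓ.subset hp.2)
  obtain ⟨B1, h1⟩ := hΓ.compactA.exists_bound_of_continuousOn c1
  obtain ⟨B2, h2⟩ := (hΓ.compactA.prod hΓ.compact).exists_bound_of_continuousOn c2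
  obtain ⟨B3, h3⟩ := (hΓ.compactA.prod hΓ.compact).exists_bound_of_continuousOn c3
  have hk : ∀ p ∈ Set.range ΓA ×ˢ Set.range Γ,
      ‖kernelLog c ε p.1 p.2‖ ≤ B1 + Real.pi + B2 + B3 := by
    intro p hp
    have e1 : ‖Complex.log p.1‖ ≤ B1 + Real.pi := by
      refine (Complex.norm_le_abs_re_add_abs_im _).trans (add_le_add ?_ ?_)
      · rw [Complex.log_re]; exact h1 _ hp.1
      · rw [Complex.log_im]; exact Complex.abs_arg_le_pi _
    exact (norm_sub_le _ _).trans
      (add_le_add ((norm_add_le _ _).trans (add_le_add e1 (h2 p hp))) (h3 p hp))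
  have key : IsTame Γ R (Set.range ΓA ×ˢ Set.range Γ)
      (fun p ϖ => ϖ p.2 * kernelLog c ε p.1 p.2) :=
    (IsTame.eval.reindex (f := fun p : ℂ × ℂ => p.2) fun p hp => hp.2).mul (IsTame.const hk)
  refine key.loopInt hΓ.curve fun ω hω ϖ hϖ => ?_
  have hΓc := hΓ.curve.continuous
  have k2 : Continuous fun t => Complex.log (1 - Γ t / ω) :=
    c2.comp_continuous (f := fun t : ℝ => (ω, Γ t)) (by fun_prop) fun t => ⟨hω, ⟨t, rfl⟩⟩
  have k3 : Continuous fun t => Complex.log (ω - Γ t + ε * Complex.I * c) :=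
    c3.comp_continuous (f := fun t : ℝ => (ω, Γ t)) (by fun_prop) fun t => ⟨hω, ⟨t, rfl⟩⟩
  have k1 : Continuous fun _ : ℝ => Complex.log ω := continuous_const
  exact (hϖ.cont.comp_continuous hΓc fun t => ⟨t, rfl⟩).mul ((k1.add k2).sub k3)

lemma isTame_functionalKernel (hc : 0 < c) (hq : 0 < q) (hδ : 0 < δ) (hδc : δ < c / 8)
    (hΓ : IsAdmissible q δ Γ ΓA) {β γ : ℂ} (hg : IsGapped c q δ Γ R β γ) {ε : ℂ}
    (hε : ε = 1 ∨ ε = -1) :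
    IsTame Γ R (Set.range ΓA ×ˢ Set.range ΓA) (fun p ϖ =>
      functionalKernel c q Γ ε γ β ϖ p.1 p.2) :=
  ((((isTame_loopInt_kernelLog hc hδc hΓ hε).const_mul _).cexp).reindex
    (f := fun p : ℂ × ℂ => p.1) fun _ hp => hp.1).mul
    (isTame_baseKernel hc hq hδ hδc hΓ hg hε)

/-- Because of the jump of `log ω` the exponent is treated as merely measurable in `ω`; the Fredholm
series needs no more. -/
lemma measurable_functionalKernel (hc : 0 < c) (hq : 0 < q) (hδ : 0 < δ) (hδc : δ < c / 8)
    (hΓ : IsAdmissible q δ Γ ΓA) {β γ : ℂ} (hg : IsGapped c q δ Γ R β γ) {ε : ℂ}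
    (hε : ε = 1 ∨ ε = -1) {ϖ : ℂ → ℂ} (hϖ : IsDensity Γ R ϖ) :
    Measurable fun p : ℝ × ℝ => functionalKernel c q Γ ε γ β ϖ (ΓA p.1) (ΓA p.2) := by
  have hΓc := hΓ.curve.continuous
  have hΓAc := hΓ.curveA.continuous
  have hν := (continuous_shiftFunctional_ofReal hc hq hδ hδc hΓ β hϖ).const_mul γ
  have m1 : Measurable fun s : ℝ => loopInt Γ (fun z => ϖ z * kernelLog c ε (ΓA s) z) := by
    simp only [loopInt_eq_integral_Icc]
    refine StronglyMeasurable.measurable (StronglyMeasurable.integral_prod_right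
      (f := fun s t : ℝ => ϖ (Γ t) * kernelLog c ε (ΓA s) (Γ t) * deriv Γ t)
      (Measurable.stronglyMeasurable ?_))
    have a1 : Measurable fun p : ℝ × ℝ => ϖ (Γ p.2) :=
      ((hϖ.cont.comp_continuous hΓc fun t => ⟨t, rfl⟩).comp continuous_snd).measurable
    have a2 : Measurable fun p : ℝ × ℝ => deriv Γ p.2 :=
      (hΓ.curve.continuous_deriv.comp continuous_snd).measurable
    have a3 : Measurable fun p : ℝ × ℝ => ΓA p.1 := (hΓAc.comp continuous_fst).measurable
    have a4 : Measurable fun p : ℝ × ℝ => Γ p.2 := (hΓc.comp continuous_snd).measurable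
    exact (a1.mul ((a3.clog.add ((measurable_const.sub (a4.div a3)).clog)).sub
      (((a3.sub a4).add measurable_const).clog))).mul a2
  have m2 : Continuous fun s : ℝ => (ΓA s - q) / (ΓA s - q + ε * Complex.I * c) :=
    Continuous.div (by fun_prop) (by fun_prop) fun s =>
      Complex.slitPlane_ne_zero (mem_slitPlane_of_le_abs_im hc (le_abs_im_shift hε
      (by simpa using abs_im_le_of_mem_strip hc hδc (hΓ.subsetA ⟨s, rfl⟩))))
  have m3 := continuous_cauchyT (ν := fun x => γ * shiftFunctional c q Γ β ϖ x) hν hΓAc hΓ.notMem hq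
  have m4 := continuous_cauchyT (ν := fun x => γ * shiftFunctional c q Γ β ϖ x) hν (hΓAc.add continuous_const)
    (p := fun s => ΓA s + ε * Complex.I * c) (fun s x _ h => by
      have := abs_sub_im_shift hc hδc hε (hΓ.subsetA ⟨s, rfl⟩) x
      rw [h, sub_self, norm_zero] at this
      linarith) hq
  have m5 : Continuous fun p : ℝ × ℝ => liebK c (ΓA p.1 - ΓA p.2) := by
    refine Continuous.div (by fun_prop) (by fun_prop) fun p => sq_add_sq_ne_zero ?_
    have := sub_im_lt hδc (hΓ.subsetA ⟨p.1, rfl⟩) (hΓ.subsetA ⟨p.2, rfl⟩)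
    linarith
  have m6 : Continuous fun s : ℝ => expRatio ε γ (shiftFunctional c q Γ β ϖ (ΓA s)) := by
    have h1 : ContinuousOn (expRatio ε γ) {x | 1 ≤ ‖x‖ ∧ ‖γ‖ * ‖x‖ ≤ 1 / 16} := fun x hx =>
      (differentiableAt_expRatio hε hx.1 hx.2).continuousAt.continuousWithinAt
    exact h1.comp_continuous
      ((differentiableOn_shiftFunctional hc hq hδ hδc hΓ β hϖ).continuousOn.comp_continuous hΓAc
        fun s => hΓ.subsetA ⟨s, rfl⟩) fun s => hg ϖ hϖ _ (hΓ.subsetA ⟨s, rfl⟩)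
  have m7 : Continuous fun s : ℝ => Complex.exp (2 * Real.pi * Complex.I
      * cauchyT q (fun x => γ * shiftFunctional c q Γ β ϖ x) (ΓA s)
        - 2 * Real.pi * Complex.I * cauchyT q (fun x => γ * shiftFunctional c q Γ β ϖ x)
          (ΓA s + ε * Complex.I * c)) :=
    Complex.continuous_exp.comp ((continuous_const.mul m3).sub (continuous_const.mul m4))
  have f : Measurable fun p : ℝ × ℝ => p.1 := measurable_fst
  exact (((measurable_const.mul m1).cexp).comp f).mul
    ((((measurable_const.mul (m2.measurable.comp f)).mul (m7.measurable.comp f)).mul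
      m5.measurable).mul (m6.measurable.comp f))

lemma isTame_loopFredholmDet (hc : 0 < c) (hq : 0 < q) (hδ : 0 < δ) (hδc : δ < c / 8)
    (hΓ : IsAdmissible q δ Γ ΓA) {β γ : ℂ} (hg : IsGapped c q δ Γ R β γ) {ε : ℂ}
    (hε : ε = 1 ∨ ε = -1) :
    IsTame Γ R T (fun _ ϖ => loopFredholmDet ΓA (functionalKernel c q Γ ε γ β ϖ)) := by
  obtain ⟨S, hS⟩ := isCompact_Icc.exists_bound_of_continuousOn
    (hΓ.curveA.continuous_deriv.continuousOn (s := Set.Icc (0 : ℝ) 1))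
  refine IsTame.fredholmDet (Ψ := fun p ϖ => functionalKernel c q Γ ε γ β ϖ (ΓA p.1) (ΓA p.2)
    * deriv ΓA p.2) (((isTame_functionalKernel hc hq hδ hδc hΓ hg hε).reindex
      (f := fun p : ℝ × ℝ => (ΓA p.1, ΓA p.2)) fun p _ => ⟨⟨_, rfl⟩, ⟨_, rfl⟩⟩).mul
      (IsTame.const (B := S) fun p hp => hS _ hp.2)) fun ϖ hϖ => ?_
  exact (measurable_functionalKernel hc hq hδ hδc hΓ hg hε hϖ).mul
    (hΓ.curveA.continuous_deriv.comp continuous_snd).measurable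

theorem isTame_smoothFunctional (hc : 0 < c) (hq : 0 < q) (hδ : 0 < δ) (hδc : δ < c / 8)
    (hΓ : IsAdmissible q δ Γ ΓA) {β γ : ℂ} (hg : IsGapped c q δ Γ R β γ) :
    IsTame Γ R T (fun _ ϖ => smoothFunctional c q Γ ΓA γ β ϖ) := by
  have hmem := ofReal_mem_strip hδ q
  have t1 : ∀ {ε : ℂ}, ε = 1 ∨ ε = -1 → IsTame Γ R T (fun _ ϖ =>
      cauchyT q (fun x => γ * shiftFunctional c q Γ β ϖ x) (q + ε * Complex.I * c)) := fun hε =>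
    isTame_cauchyT hc hq hδ hδc hΓ β γ (d := c / 2) (by positivity)
      fun _ _ x _ => abs_sub_im_shift hc hδc hε hmem x
  have key := (((((isTame_cauchyC0 (T := T) (R := R) hc hq hδ hδc hΓ β γ).cexp).mul
    (((isTame_factor hc hq hδ hδc hΓ β γ (Or.inl rfl)).const_mul
      (2 * Real.pi * Complex.I)⁻¹).neg.cexp.mul
      ((isTame_factor hc hq hδ hδc hΓ β γ (Or.inr rfl)).const_mul
        (2 * Real.pi * Complex.I)⁻¹).neg.cexp)).mul
    ((isTame_double hc hδc hΓ).const_mul ((2 * Real.pi * Complex.I)⁻¹ ^ 2)).neg.cexp).mul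
    ((isTame_loopFredholmDet hc hq hδ hδc hΓ hg (Or.inl rfl)).mul
      (isTame_loopFredholmDet hc hq hδ hδc hΓ hg (Or.inr rfl)))).mul
    (((((t1 (Or.inl rfl)).add (t1 (Or.inr rfl))).const_mul
      (2 * Real.pi * Complex.I)).neg.cexp).const_mul (liebDet c q ^ 2)⁻¹)
  refine (congrArg (IsTame Γ R T) ?_).mp key
  funext _ ϖ
  simp only [smoothFunctional, div_eq_mul_inv, mul_inv, ← Complex.exp_neg, I_shift_eq (q : ℂ)]

end Kernels

/-! ### From tame to regular functionals. -/

section Regular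

lemma norm_le_of_supNorm_le {α : Type*} {S : Set α} {f : α → ℂ} {C : ℝ} (hC : 0 ≤ C)
    (h : supNorm S f ≤ ENNReal.ofReal C) {x : α} (hx : x ∈ S) : ‖f x‖ ≤ C := by
  have h1 : ‖f x‖ₑ ≤ ENNReal.ofReal C := (le_iSup₂ (f := fun x _ => ‖f x‖ₑ) x hx).trans h
  rwa [← ofReal_norm, ENNReal.ofReal_le_ofReal_iff hC] at h1

lemma supNorm_le {α : Type*} {S : Set α} {f : α → ℂ} {C : ℝ} (h : ∀ x ∈ S, ‖f x‖ ≤ C) :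
    supNorm S f ≤ ENNReal.ofReal C :=
  iSup₂_le fun x hx => by
    rw [← ofReal_norm]
    exact ENNReal.ofReal_le_ofReal (h x hx)

lemma norm_le_toReal_supNorm {α : Type*} {S : Set α} {f : α → ℂ} (h : supNorm S f ≠ ∞) {x : α}
    (hx : x ∈ S) : ‖f x‖ ≤ (supNorm S f).toReal :=
  norm_le_of_supNorm_le ENNReal.toReal_nonneg (ENNReal.ofReal_toReal h).ge hx

lemma supNorm_sub_le {α : Type*} (S : Set α) (f g : α → ℂ) :
    supNorm S (f - g) ≤ supNorm S f + supNorm S g :=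
  iSup₂_le fun x hx => (enorm_sub_le).trans
    (add_le_add (le_iSup₂ (f := fun x _ => ‖f x‖ₑ) x hx) (le_iSup₂ (f := fun x _ => ‖g x‖ₑ) x hx))

variable {Γ : ℝ → ℂ} {R : ℝ}

lemma HolomorphicOn.continuousOn {M : Set ℂ} {f : ℂ → ℂ} (h : HolomorphicOn M f) :
    ContinuousOn f M := by
  obtain ⟨O, -, hM, hd⟩ := h
  exact hd.continuousOn.mono hM

lemma isHolFamily_line {f g : ℂ → ℂ} {B D r : ℝ} (hf : ContinuousOn f (Set.range Γ))
    (hg : ContinuousOn g (Set.range Γ)) (hB : ∀ z ∈ Set.range Γ, ‖g z‖ ≤ B)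
    (hD : ∀ z ∈ Set.range Γ, ‖f z - g z‖ ≤ D) (hr : 0 ≤ r) (hR : B + r * D ≤ R) :
    IsHolFamily Γ R {w : Fin 1 → ℂ | ‖w 0‖ < r} (fun w x => g x + w 0 * (f x - g x)) where
  isOpen := isOpen_lt (by fun_prop) continuous_const
  density w hw := by
    refine ⟨hg.add (continuousOn_const.mul (hf.sub hg)), fun z hz => ?_⟩
    refine (norm_add_le _ _).trans (le_trans (add_le_add (hB z hz) ?_) hR)
    rw [norm_mul]
    exact mul_le_mul (le_of_lt hw) (hD z hz) (norm_nonneg _) hr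
  diff z _ := by fun_prop

/-- Schwarz's lemma along the segment that joins two densities. -/
lemma IsTame.norm_sub_le_div {F : (ℂ → ℂ) → ℂ} (hF : IsTame Γ R Set.univ (fun (_ : Unit) => F))
    {M : ℝ} (hM : ∀ ϖ, IsDensity Γ R ϖ → ‖F ϖ‖ ≤ M)
    {f g : ℂ → ℂ} {B D r : ℝ} (hf : ContinuousOn f (Set.range Γ))
    (hg : ContinuousOn g (Set.range Γ)) (hB : ∀ z ∈ Set.range Γ, ‖g z‖ ≤ B)
    (hD : ∀ z ∈ Set.range Γ, ‖f z - g z‖ ≤ D) (hr : 1 < r) (hR : B + r * D ≤ R) :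
    ‖F f - F g‖ ≤ (2 * M + 1) / r := by
  have hfam := isHolFamily_line (R := R) hf hg hB hD (by linarith) hR
  have hd := hF.diff 1 _ _ hfam () trivial
  have hd' : DifferentiableOn ℂ (fun s : ℂ => F (fun x => g x + s * (f x - g x))) (ball 0 r) := by
    refine hd.comp (g := fun w : Fin 1 → ℂ => F (fun x => g x + w 0 * (f x - g x)))
      (f := fun s : ℂ => fun _ : Fin 1 => s) (by fun_prop) fun s hs => ?_
    simpa using hs
  have hbd : ∀ s ∈ ball (0 : ℂ) r, ‖F (fun x => g x + s * (f x - g x))‖ ≤ M := fun s hs =>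
    hM _ (hfam.density (fun _ => s) (by simpa using hs))
  have h0 : (0 : ℂ) ∈ ball (0 : ℂ) r := by simp; linarith
  have h1 : (1 : ℂ) ∈ ball (0 : ℂ) r := by simpa using hr
  have key := Complex.dist_le_div_mul_dist_of_mapsTo_ball (R₂ := 2 * M + 1) hd' (fun s hs => ?_) h1
  · simpa [dist_eq_norm] using key
  · rw [mem_closedBall, dist_eq_norm]
    have := norm_sub_le (F (fun x => g x + s * (f x - g x))) (F (fun x => g x + 0 * (f x - g x)))
    linarith [hbd s hs, hbd 0 h0]

/-- On the loop `g` is bounded by `C` and `f - g` by some `D < C`, so `g + s (f - g)` is a density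
bounded by `2 C ≤ R` for `|s| < C / D`. Schwarz's lemma on this disc, evaluated at `s = 1`, gives a
Lipschitz bound proportional to `D / C`. -/
theorem IsTame.isRegularFunctional {F : (ℂ → ℂ) → ℂ}
    (hF : IsTame Γ R Set.univ (fun (_ : Unit) => F)) {M : Set ℂ} {C : ℝ} (hC : 0 < C)
    (hCR : 2 * C ≤ R) (hM : IsCompact M) (hK : IsCompact (Set.range Γ))
    (hKM : Set.range Γ ⊆ interior M) : IsRegularFunctional M (Set.range Γ) C F where
  compact_left := hM
  compact_right := hK
  subset_interior := hKM
  pos := hC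
  lipschitz := by
    obtain ⟨B, hB0, hB⟩ := hF.exists_bound
    have hsub : Set.range Γ ⊆ M := hKM.trans interior_subset
    -- The added 1 keeps the Lipschitz constant positive when `B = 0`.
    refine ⟨(2 * B + 1) / C, by positivity, fun f g hf hg hfg => ?_⟩
    have hs := (supNorm_sub_le _ f g).trans_lt hfg
    have hg' : supNorm (Set.range Γ) g ≤ ENNReal.ofReal C := le_add_self.trans hfg.le
    have hne : supNorm (Set.range Γ) (f - g) ≠ ∞ := (hs.trans ENNReal.ofReal_lt_top).ne
    set D := (supNorm (Set.range Γ) (f - g)).toReal with hDdef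
    have hD0 : 0 ≤ D := ENNReal.toReal_nonneg
    have hDC : D < C := (ENNReal.lt_ofReal_iff_toReal_lt hne).1 hs
    have key : ∀ r, 1 < r → r * D ≤ C → ‖F f - F g‖ ≤ (2 * B + 1) / r := fun r hr hrD =>
      hF.norm_sub_le_div (fun ϖ hϖ => hB () trivial ϖ hϖ) (B := C) (D := D)
        (hf.continuousOn.mono hsub) (hg.continuousOn.mono hsub)
        (fun z hz => norm_le_of_supNorm_le hC.le hg' hz)
        (fun z hz => norm_le_toReal_supNorm hne hz) hr (by linarith)
    have main : ‖F f - F g‖ ≤ (2 * B + 1) / C * D := by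
      rcases hD0.eq_or_lt with h | h
      -- If `f = g` on the loop, the radius `r` of the disc is arbitrary, and `r → ∞` gives `F f = F
      -- g`.
      · rw [← h, mul_zero]
        refine le_of_forall_pos_le_add fun e he => ?_
        refine (key (1 + (2 * B + 1) / e) (by have : 0 < (2 * B + 1) / e := by positivity
                                              linarith) (by rw [← h]; linarith)).trans ?_
        rw [zero_add, div_le_iff₀ (by positivity), mul_add, mul_one, mul_div_cancel₀ _ he.ne']
        linarith
      · refine (key (C / D) ((one_lt_div h).2 hDC) (by field_simp; exact le_rfl)).trans_eq ?_
        field_simp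
    rw [← ofReal_norm, ← ENNReal.ofReal_toReal hne, ← ENNReal.ofReal_mul (by positivity)]
    exact ENNReal.ofReal_le_ofReal main
  holomorphic := by
    intro ℓ W ν hW _ ⟨O, hO, hMO, hd⟩ hlt
    have hsub : Set.range Γ ⊆ M := hKM.trans interior_subset
    refine hF.diff ℓ W (fun w x => ν x w) ⟨hW, fun w hw => ⟨?_, fun z hz => ?_⟩,
      fun z hz => ?_⟩ () trivial
    · exact hd.continuousOn.comp (f := fun z : ℂ => (z, w)) (by fun_prop)
        fun z hz => hMO ⟨hsub hz, hw⟩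
    · have := norm_le_of_supNorm_le hC.le hlt.le (x := (z, w)) ⟨hz, hw⟩
      simp only at this
      linarith
    · exact hd.comp (f := fun w : Fin ℓ → ℂ => (z, w)) (by fun_prop)
        fun w hw => hMO ⟨hsub hz, hw⟩

end Regular

/-! ### Identification of the form factor with the functional at `H`. -/

section Identity

variable {c q δ : ℝ} {Γ ΓA : ℝ → ℂ}

lemma continuousOn_one_div_sub {S : Set ℂ} {w : ℂ} (hw : w ∉ S) :
    ContinuousOn (fun x : ℂ => 1 / (x - w)) S :=
  ContinuousOn.div continuousOn_const (by fun_prop) fun _ hx h => hw (sub_eq_zero.1 h ▸ hx)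

/-- The residue theorem for `rationalH`. -/
theorem loopInt_rationalH_mul (hΓ : IsClosedCurve Γ) {U : Set ℂ} (hU : IsOpen U)
    (hc : Convex ℝ U) (hΓU : Set.range Γ ⊆ U) {n : ℕ} {y z : Fin n → ℂ}
    (hyU : ∀ a, y a ∈ U) (hzU : ∀ a, z a ∈ U) (hy : ∀ a, y a ∈ inside Γ)
    (hz : ∀ a, z a ∈ inside Γ) {f : ℂ → ℂ} (hf : DifferentiableOn ℂ f U) :
    (2 * Real.pi * Complex.I)⁻¹ * loopInt Γ (fun x => rationalH y z x * f x)
      = ∑ a, (f (y a) - f (z a)) := by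
  have hfc := hf.continuousOn.mono hΓU
  have h1 : ∀ a, ContinuousOn (fun x => 1 / (x - y a) * f x) (Set.range Γ) := fun a =>
    (continuousOn_one_div_sub (hy a).1).mul hfc
  have h2 : ∀ a, ContinuousOn (fun x => 1 / (x - z a) * f x) (Set.range Γ) := fun a =>
    (continuousOn_one_div_sub (hz a).1).mul hfc
  simp only [rationalH, Finset.sum_mul, sub_mul]
  rw [hΓ.loopInt_sum _ (f := fun a x => 1 / (x - y a) * f x - 1 / (x - z a) * f x)
    fun a _ => (h1 a).sub (h2 a), Finset.mul_sum]
  refine Finset.sum_congr rfl fun a _ => ?_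
  rw [hΓ.loopInt_sub (h1 a) (h2 a), mul_sub, cauchy_formula hΓ hU hc hΓU hf (hyU a) (hy a),
    cauchy_formula hΓ hU hc hΓU hf (hzU a) (hz a)]

lemma isLiebSolution_shiftFunction (hc : 0 < c) (hq : 0 < q) (hδ : 0 < δ) (hδc : δ < c / 8)
    (β : ℂ) {n : ℕ} {y z : Fin n → ℂ} (hy : ∀ a, y a ∈ strip δ) (hz : ∀ a, z a ∈ strip δ) :
    IsLiebSolution c q (fun x => Complex.I * β - 1 / 2 - bareTheta c (x - q) / (2 * Real.pi)
      - (2 * Real.pi : ℂ)⁻¹ * ∑ a, (bareTheta c (x - y a) - bareTheta c (x - z a)))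
      (fun x => (Complex.I * β - 1 / 2) * dressedCharge c q x - dressedPhase c q x q
        - ∑ a, (dressedPhase c q x (y a) - dressedPhase c q x (z a))) := by
  have h := (((isLiebSolution_dressedCharge hc hq).const_mul (Complex.I * β - 1 / 2)).sub hq
    (isLiebSolution_dressedPhase hc hq hδ hδc (ofReal_mem_strip hδ q))).sub hq
    (IsLiebSolution.sum hq Finset.univ fun a =>
      (isLiebSolution_dressedPhase hc hq hδ hδc (hy a)).sub hq
        (isLiebSolution_dressedPhase hc hq hδ hδc (hz a)))
  convert h using 2 with x
  · simp only [mul_one, Finset.mul_sum, mul_sub, div_eq_inv_mul]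

lemma shiftFunction_eq (hc : 0 < c) (hq : 0 < q) (hδ : 0 < δ) (hδc : δ < c / 8)
    (β : ℂ) {n : ℕ} {y z : Fin n → ℂ} (hy : ∀ a, y a ∈ strip δ) (hz : ∀ a, z a ∈ strip δ)
    {x : ℂ} (hx : x ∈ strip δ) :
    shiftFunction c q β y z x = (Complex.I * β - 1 / 2) * dressedCharge c q x
      - dressedPhase c q x q - ∑ a, (dressedPhase c q x (y a) - dressedPhase c q x (z a)) := by
  refine ((isLiebSolution_shiftFunction hc hq hδ hδc β hy hz).eq_liebSolve hc hq ?_ ?_).symm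
  · have hd : ∀ {w}, w ∈ strip δ →
        DifferentiableOn ℂ (fun x => bareTheta c (x - w) / (2 * Real.pi)) (strip δ) := fun hw =>
      differentiableOn_phase_driving hc hδc hw
    have h : DifferentiableOn ℂ (fun x : ℂ => Complex.I * β - 1 / 2
        - bareTheta c (x - q) / (2 * Real.pi)
        - (2 * Real.pi : ℂ)⁻¹ * ∑ a, (bareTheta c (x - y a) - bareTheta c (x - z a)))
        (strip δ) := by
      simp only [Finset.mul_sum, mul_sub, ← div_eq_inv_mul]
      exact ((differentiableOn_const _).sub (hd (ofReal_mem_strip hδ q))).sub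
        (DifferentiableOn.fun_sum fun a _ => (hd (hy a)).sub (hd (hz a)))
    exact DifferentiableOn.continuousOn_ofReal hδ h _
  · have : |x.im| < 2 * δ := hx
    linarith

/-- The residue theorem in the second argument of the dressed phase leaves `∑ (φ(x, y a) - φ(x, z
a))`, which by superposition and uniqueness is the corresponding part of the shift function. -/
theorem shiftFunctional_rationalH (hc : 0 < c) (hq : 0 < q) (hδ : 0 < δ) (hδc : δ < c / 8)
    (hΓ : IsClosedCurve Γ) (hΓδ : Set.range Γ ⊆ strip δ) (β : ℂ) {n : ℕ} {y z : Fin n → ℂ}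
    (hyδ : ∀ a, y a ∈ strip δ) (hzδ : ∀ a, z a ∈ strip δ) (hy : ∀ a, y a ∈ inside Γ)
    (hz : ∀ a, z a ∈ inside Γ) {x : ℂ} (hx : x ∈ strip δ) :
    shiftFunctional c q Γ β (rationalH y z) x = shiftFunction c q β y z x := by
  rw [shiftFunctional, shiftFunction_eq hc hq hδ hδc β hyδ hzδ hx,
    loopInt_rationalH_mul hΓ (isOpen_strip δ) (convex_strip δ) hΓδ hyδ hzδ hy hz
      (differentiableOn_dressedPhase_right hc hq hδ hδc hx)]

lemma cauchyT_congr {ν ν' : ℂ → ℂ} (h : ∀ x : ℝ, ν x = ν' x) : cauchyT q ν = cauchyT q ν' := by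
  funext x
  simp only [cauchyT, h]

lemma cauchyC0_congr {ν ν' : ℂ → ℂ} (h : ∀ x : ℝ, ν x = ν' x) :
    cauchyC0 c q ν = cauchyC0 c q ν' := by
  simp only [cauchyC0, h]

lemma isClosed_fermiZone (q : ℝ) : IsClosed (fermiZone q) :=
  (isCompact_Icc.image Complex.continuous_ofReal).isClosed

lemma differentiableAt_cauchyT (hq : 0 < q) {ν : ℂ → ℂ}
    (hν : ContinuousOn (fun x : ℝ => ν x) (Set.Icc (-q) q)) {x : ℂ} (hx : x ∉ fermiZone q) :
    DifferentiableAt ℂ (cauchyT q ν) x := by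
  have hq' : -q ≤ q := by linarith
  obtain ⟨r, hr, hball⟩ := Metric.isOpen_iff.1 (isClosed_fermiZone q).isOpen_compl x hx
  obtain ⟨B, hB⟩ := isCompact_Icc.exists_bound_of_continuousOn hν
  have hne : ∀ w ∈ ball x (r / 2), ∀ μ ∈ Set.Icc (-q) q, r / 2 ≤ ‖(μ : ℂ) - w‖ := by
    intro w hw μ hμ
    by_contra! h
    refine hball (show (μ : ℂ) ∈ ball x r from ?_) ⟨μ, hμ, rfl⟩
    rw [mem_ball, dist_eq_norm] at hw ⊢
    calc ‖(μ : ℂ) - x‖ = ‖((μ : ℂ) - w) + (w - x)‖ := by ring_nf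
      _ ≤ _ := norm_add_le _ _
      _ < r := by linarith
  have hne' : ∀ w ∈ ball x (r / 2), ∀ μ ∈ Set.Icc (-q) q, (μ : ℂ) - w ≠ 0 := fun w hw μ hμ h => by
    have := hne w hw μ hμ
    rw [h, norm_zero] at this
    linarith
  have hd : DifferentiableOn ℂ (fun w => ∫ μ in (-q)..q, ν μ / ((μ : ℂ) - w)) (ball x (r / 2)) := by
    refine differentiableOn_intervalIntegral_of_bounded hq' isOpen_ball (B := B / (r / 2))
      (fun w hw => ?_) (fun μ hμ w hw => ?_) fun μ hμ => ?_
    · exact (hν.div (by fun_prop) (hne' w hw)).aestronglyMeasurable measurableSet_Icc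
    · rw [norm_div]
      have := (norm_nonneg _).trans (hB μ hμ)
      exact div_le_div₀ this (hB μ hμ) (by linarith) (hne w hw μ hμ)
    · exact DifferentiableOn.div (by fun_prop) (by fun_prop) fun w hw => hne' w hw μ hμ
  exact (hd.differentiableAt (isOpen_ball.mem_nhds (mem_ball_self (by linarith)))).const_mul _

lemma notMem_fermiZone_of_im_ne_zero {x : ℂ} (hx : x.im ≠ 0) : x ∉ fermiZone q := by
  rintro ⟨t, -, rfl⟩
  exact hx (by simp)

lemma shift_notMem_fermiZone (hc : 0 < c) (hδc : δ < c / 8) {ε : ℂ} (hε : ε = 1 ∨ ε = -1) {x : ℂ}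
    (hx : x ∈ strip δ) : x + ε * Complex.I * c ∉ fermiZone q := by
  refine notMem_fermiZone_of_im_ne_zero fun h => ?_
  have := le_abs_im_shift hε (abs_im_le_of_mem_strip hc hδc hx)
  rw [h, abs_zero] at this
  linarith

lemma shift_mem_slitPlane (hc : 0 < c) (hδc : δ < c / 8) {ε : ℂ} (hε : ε = 1 ∨ ε = -1) {x : ℂ}
    (hx : x ∈ strip δ) (t : ℝ) : x - t + ε * Complex.I * c ∈ Complex.slitPlane :=
  mem_slitPlane_of_le_abs_im hc (le_abs_im_shift hε
    (by simpa using abs_im_le_of_mem_strip hc hδc hx))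

lemma exp_neg_sum_sub {n : ℕ} (f : ℂ → ℂ) (y z : Fin n → ℂ) :
    Complex.exp (-∑ a, (f (y a) - f (z a)))
      = ∏ a, Complex.exp (f (z a)) / Complex.exp (f (y a)) := by
  rw [← Finset.sum_neg_distrib, Complex.exp_sum]
  refine Finset.prod_congr rfl fun a _ => ?_
  rw [neg_sub, Complex.exp_sub]

/-- The data in which the residue theorem is applied: `U` is a convex domain that contains the
contours and all the poles. -/
structure IsResidueDomain (δ : ℝ) (U : Set ℂ) (Γ : ℝ → ℂ) {n : ℕ} (y z : Fin n → ℂ) : Prop where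
  curve : IsClosedCurve Γ
  isOpen : IsOpen U
  convex : Convex ℝ U
  subset : U ⊆ strip δ
  range_subset : Set.range Γ ⊆ U
  left_mem : ∀ a, y a ∈ U
  right_mem : ∀ a, z a ∈ U
  left_inside : ∀ a, y a ∈ inside Γ
  right_inside : ∀ a, z a ∈ inside Γ

namespace IsResidueDomain

variable {U : Set ℂ} {n : ℕ} {y z : Fin n → ℂ}

lemma loopInt_mul (h : IsResidueDomain δ U Γ y z) {f : ℂ → ℂ} (hf : DifferentiableOn ℂ f U) :
    (2 * Real.pi * Complex.I)⁻¹ * loopInt Γ (fun x => rationalH y z x * f x)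
      = ∑ a, (f (y a) - f (z a)) :=
  loopInt_rationalH_mul h.curve h.isOpen h.convex h.range_subset h.left_mem h.right_mem
    h.left_inside h.right_inside hf

lemma factor (h : IsResidueDomain δ U Γ y z) (hc : 0 < c) (hq : 0 < q) (hδc : δ < c / 8)
    {ν : ℂ → ℂ} (hν : ContinuousOn (fun x : ℝ => ν x) (Set.Icc (-q) q)) {ε : ℂ}
    (hε : ε = 1 ∨ ε = -1) :
    Complex.exp (-((2 * Real.pi * Complex.I)⁻¹ * loopInt Γ (fun x => rationalH y z x *
      (2 * Real.pi * Complex.I * cauchyT q ν (x + ε * Complex.I * c)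
        + Complex.log (x - q + ε * Complex.I * c)))))
      = ∏ a, ((z a - q + ε * Complex.I * c) / (y a - q + ε * Complex.I * c))
      * (Complex.exp (2 * Real.pi * Complex.I * cauchyT q ν (z a + ε * Complex.I * c))
        / Complex.exp (2 * Real.pi * Complex.I * cauchyT q ν (y a + ε * Complex.I * c))) := by
  have hslit : ∀ x ∈ U, x - q + ε * Complex.I * c ∈ Complex.slitPlane := fun x hx =>
    shift_mem_slitPlane hc hδc hε (h.subset hx) q
  rw [h.loopInt_mul (f := fun x => 2 * Real.pi * Complex.I * cauchyT q ν (x + ε * Complex.I * c)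
        + Complex.log (x - q + ε * Complex.I * c)) ?_,
    exp_neg_sum_sub (fun x => 2 * Real.pi * Complex.I * cauchyT q ν (x + ε * Complex.I * c)
        + Complex.log (x - q + ε * Complex.I * c))]
  · refine Finset.prod_congr rfl fun a _ => ?_
    rw [Complex.exp_add, Complex.exp_add,
      Complex.exp_log (Complex.slitPlane_ne_zero (hslit _ (h.left_mem a))),
      Complex.exp_log (Complex.slitPlane_ne_zero (hslit _ (h.right_mem a))), mul_div_mul_comm,
      mul_comm]
  · intro x hx
    refine DifferentiableAt.differentiableWithinAt (DifferentiableAt.add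
      (DifferentiableAt.const_mul ?_ _) (DifferentiableAt.clog (by fun_prop) (hslit x hx)))
    exact DifferentiableAt.comp x (f := fun x => x + ε * Complex.I * c)
      (differentiableAt_cauchyT hq hν (shift_notMem_fermiZone hc hδc hε (h.subset hx)))
      (by fun_prop)

lemma double (h : IsResidueDomain δ U Γ y z) (hc : 0 < c) (hδc : δ < c / 8) :
    Complex.exp (-((2 * Real.pi * Complex.I)⁻¹ ^ 2 *
        loopInt Γ (fun u => loopInt Γ (fun v =>
          rationalH y z u * rationalH y z v * Complex.log (v - u - Complex.I * c)))))
      = ∏ a, ∏ b, ((y a - z b - Complex.I * c) * (z a - y b - Complex.I * c))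
        / ((y a - y b - Complex.I * c) * (z a - z b - Complex.I * c)) := by
  have hslit : ∀ u ∈ U, ∀ v ∈ U, v - u - Complex.I * c ∈ Complex.slitPlane := fun u hu v hv =>
    sub_sub_mem_slitPlane hδc hc (h.subset hu) (h.subset hv)
  -- `G u` is the inner integral evaluated by residues. It is again holomorphic in `u` on `U`, so
  -- the residue theorem applies to the outer integral.
  set G : ℂ → ℂ := fun u => ∑ b, (Complex.log (y b - u - Complex.I * c)
    - Complex.log (z b - u - Complex.I * c)) with hG
  have hGd : DifferentiableOn ℂ G U := by
    refine DifferentiableOn.fun_sum fun b _ => DifferentiableOn.sub ?_ ?_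
    · exact DifferentiableOn.clog (by fun_prop) fun u hu => hslit u hu _ (h.left_mem b)
    · exact DifferentiableOn.clog (by fun_prop) fun u hu => hslit u hu _ (h.right_mem b)
  have inner : ∀ u ∈ Set.range Γ, loopInt Γ (fun v =>
      rationalH y z u * rationalH y z v * Complex.log (v - u - Complex.I * c))
      = (2 * Real.pi * Complex.I) * (rationalH y z u * G u) := by
    intro u hu
    have e : _ = G u := h.loopInt_mul (f := fun v => Complex.log (v - u - Complex.I * c))
      (DifferentiableOn.clog (by fun_prop) fun v hv => hslit u (h.range_subset hu) v hv)
    simp only [mul_assoc] at e ⊢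
    rw [loopInt_const_mul, ← e]
    have : Complex.I ≠ 0 := Complex.I_ne_zero
    have : (Real.pi : ℂ) ≠ 0 := by exact_mod_cast Real.pi_ne_zero
    field_simp
  rw [loopInt_congr inner, loopInt_const_mul, pow_two, mul_assoc, inv_mul_cancel_left₀ (by simp),
    h.loopInt_mul hGd, exp_neg_sum_sub G, Finset.prod_comm (f := fun a b => _ / _)]
  refine Finset.prod_congr rfl fun a _ => ?_
  simp only [hG]
  rw [Complex.exp_sum, Complex.exp_sum, ← Finset.prod_div_distrib]
  refine Finset.prod_congr rfl fun b _ => ?_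
  have hl : ∀ u ∈ U, ∀ v ∈ U, Complex.exp (Complex.log (v - u - Complex.I * c))
      = v - u - Complex.I * c := fun u hu v hv =>
    Complex.exp_log (Complex.slitPlane_ne_zero (hslit u hu v hv))
  rw [Complex.exp_sub, Complex.exp_sub, hl _ (h.left_mem a) _ (h.left_mem b),
    hl _ (h.left_mem a) _ (h.right_mem b), hl _ (h.right_mem a) _ (h.left_mem b),
    hl _ (h.right_mem a) _ (h.right_mem b), div_div_div_eq]
  ring

/-- Writing `log ω + log (1 - x / ω)` gives a determination of `ln (ω - x)` that is holomorphic in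
`x` on all of `U`, as the residue theorem requires. Its exponential is still `ω - x`, so the choice
of branch disappears from the result. -/
lemma kernel (h : IsResidueDomain δ U Γ y z) (hc : 0 < c) (hδc : δ < c / 8) {ω : ℂ}
    (hω : ω ∈ strip δ) (hlog : ∀ x ∈ U, 1 - x / ω ∈ Complex.slitPlane) (hω0 : ω ≠ 0) {ε : ℂ}
    (hε : ε = 1 ∨ ε = -1) :
    Complex.exp ((2 * Real.pi * Complex.I)⁻¹
      * loopInt Γ (fun x => rationalH y z x * kernelLog c ε ω x))
      = ∏ a, ((ω - y a) * (ω - z a + ε * Complex.I * c))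
      / ((ω - z a) * (ω - y a + ε * Complex.I * c)) := by
  have hslit : ∀ x ∈ U, ω - x + ε * Complex.I * c ∈ Complex.slitPlane := fun x hx =>
    sub_shift_mem_slitPlane hc hδc hε hω (h.subset hx)
  have hexp : ∀ x ∈ U, Complex.exp (kernelLog c ε ω x) = (ω - x) / (ω - x + ε * Complex.I * c) := by
    intro x hx
    rw [kernelLog, Complex.exp_sub, Complex.exp_add, Complex.exp_log hω0,
      Complex.exp_log (Complex.slitPlane_ne_zero (hlog x hx)),
      Complex.exp_log (Complex.slitPlane_ne_zero (hslit x hx)), mul_sub, mul_one,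
      mul_div_cancel₀ _ hω0]
  rw [h.loopInt_mul (f := kernelLog c ε ω) ?_, Complex.exp_sum]
  · refine Finset.prod_congr rfl fun a _ => ?_
    rw [Complex.exp_sub, hexp _ (h.left_mem a), hexp _ (h.right_mem a), div_div_div_eq]
    ring
  · refine DifferentiableOn.sub (DifferentiableOn.add (differentiableOn_const _) ?_) ?_
    · exact DifferentiableOn.clog (by fun_prop) hlog
    · exact DifferentiableOn.clog (by fun_prop) hslit

end IsResidueDomain

lemma baseKernel_congr {ε γ : ℂ} {F G : ℂ → ℂ} (h : ∀ x : ℝ, F x = G x) {ω : ℂ}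
    (hω : F ω = G ω) (ω' : ℂ) : baseKernel c q ε γ F ω ω' = baseKernel c q ε γ G ω ω' := by
  simp only [baseKernel, hω]
  rw [cauchyT_congr (q := q) (ν := fun x => γ * F x) (ν' := fun x => γ * G x)
    fun x => by rw [h x]]

lemma loopFredholmDet_congr {V V' : ℂ → ℂ → ℂ}
    (h : ∀ ω ∈ Set.range Γ, ∀ ω' ∈ Set.range Γ, V ω ω' = V' ω ω') :
    loopFredholmDet Γ V = loopFredholmDet Γ V' := by
  have : ∀ s t, V (Γ s) (Γ t) = V' (Γ s) (Γ t) := fun s t => h _ ⟨s, rfl⟩ _ ⟨t, rfl⟩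
  simp only [loopFredholmDet, this]

lemma differentiableOn_baseKernel (hc : 0 < c) (hq : 0 < q) (hδc : δ < c / 8)
    {D : Set ℂ} (hD : D ⊆ strip δ) (hDq : ∀ x ∈ D, x ∉ fermiZone q) {ε γ : ℂ}
    (hε : ε = 1 ∨ ε = -1) {F : ℂ → ℂ} (hF : ∀ x ∈ D, DifferentiableAt ℂ F x)
    (hFc : ContinuousOn (fun x : ℝ => F x) (Set.Icc (-q) q)) (h1 : ∀ x ∈ D, 1 ≤ ‖F x‖)
    (h2 : ∀ x ∈ D, ‖γ‖ * ‖F x‖ ≤ 1 / 16) :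
    DifferentiableOn ℂ (fun p : ℂ × ℂ => baseKernel c q ε γ F p.1 p.2) (D ×ˢ D) := by
  rintro ⟨ω, ω'⟩ ⟨hω, hω'⟩
  refine DifferentiableAt.differentiableWithinAt ?_
  have hν : ContinuousOn (fun x : ℝ => γ * F x) (Set.Icc (-q) q) := hFc.const_mul γ
  have hshift : ω - q + ε * Complex.I * c ≠ 0 :=
    Complex.slitPlane_ne_zero (shift_mem_slitPlane hc hδc hε (hD hω) q)
  have d1 : DifferentiableAt ℂ (fun x : ℂ => -(ε / (2 * Real.pi))
      * ((x - q) / (x - q + ε * Complex.I * c))) ω :=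
    by fun_prop (disch := exact hshift)
  have d2 : DifferentiableAt ℂ (fun x : ℂ => Complex.exp (2 * Real.pi * Complex.I
      * cauchyT q (fun x => γ * F x) x - 2 * Real.pi * Complex.I
      * cauchyT q (fun x => γ * F x) (x + ε * Complex.I * c))) ω := by
    refine DifferentiableAt.cexp (DifferentiableAt.sub (DifferentiableAt.const_mul
      (differentiableAt_cauchyT hq (ν := fun x => γ * F x) hν (hDq ω hω)) _)
      (DifferentiableAt.const_mul ?_ _))
    exact DifferentiableAt.comp ω (f := fun x => x + ε * Complex.I * c)
      (differentiableAt_cauchyT hq (ν := fun x => γ * F x) hν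
        (shift_notMem_fermiZone hc hδc hε (hD hω))) (by fun_prop)
  have d3 : DifferentiableAt ℂ (fun x : ℂ => expRatio ε γ (F x)) ω :=
    (differentiableAt_expRatio hε (h1 ω hω) (h2 ω hω)).comp ω (hF ω hω)
  have d4 : DifferentiableAt ℂ (fun p : ℂ × ℂ => liebK c (p.1 - p.2)) (ω, ω') := by
    have hK : DifferentiableAt ℂ (liebK c) (ω - ω') := differentiableAt_liebK (by
      have := sub_im_lt hδc (hD hω) (hD hω')
      linarith)
    exact hK.comp (ω, ω') (f := fun p : ℂ × ℂ => p.1 - p.2) (by fun_prop)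
  have lift : ∀ {f : ℂ → ℂ}, DifferentiableAt ℂ f ω →
      DifferentiableAt ℂ (fun p : ℂ × ℂ => f p.1) (ω, ω') := fun hf =>
    DifferentiableAt.comp (ω, ω') (f := Prod.fst) hf differentiableAt_fst
  exact (((lift d1).mul (lift d2)).mul d4).mul (lift d3)

lemma differentiableOn_formFactorKernel (hc : 0 < c) (hq : 0 < q) (hδc : δ < c / 8)
    {D : Set ℂ} (hD : D ⊆ strip δ) (hDq : ∀ x ∈ D, x ∉ fermiZone q) {ε γ β : ℂ}
    (hε : ε = 1 ∨ ε = -1) {n : ℕ} {y z : Fin n → ℂ} (hy : ∀ a, y a ∈ strip δ)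
    (hz : ∀ a, z a ∉ D)
    (hF : ∀ x ∈ D, DifferentiableAt ℂ (shiftFunction c q β y z) x)
    (hFc : ContinuousOn (fun x : ℝ => shiftFunction c q β y z x) (Set.Icc (-q) q))
    (h1 : ∀ x ∈ D, 1 ≤ ‖shiftFunction c q β y z x‖)
    (h2 : ∀ x ∈ D, ‖γ‖ * ‖shiftFunction c q β y z x‖ ≤ 1 / 16) :
    DifferentiableOn ℂ (fun p : ℂ × ℂ => formFactorKernel c q ε γ β y z p.1 p.2) (D ×ˢ D) := by
  refine DifferentiableOn.mul ?_
    (differentiableOn_baseKernel hc hq hδc hD hDq hε hF hFc h1 h2)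
  have hd : DifferentiableOn ℂ (fun ω : ℂ => ∏ a, ((ω - y a) * (ω - z a + ε * Complex.I * c))
      / ((ω - z a) * (ω - y a + ε * Complex.I * c))) D := by
    refine DifferentiableOn.fun_finsetProd fun a _ => ?_
    refine DifferentiableOn.div (by fun_prop) (by fun_prop) fun ω hω => mul_ne_zero ?_ ?_
    · exact fun h => hz a (sub_eq_zero.1 h ▸ hω)
    · exact Complex.slitPlane_ne_zero (sub_shift_mem_slitPlane hc hδc hε (hD hω) (hy a))
  exact hd.comp differentiableOn_fst fun p hp => hp.1

/-- The scalar factors agree by residues. The rectangle of half-width `B` collects the singularities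
of the form factor kernel that could obstruct moving the determinants between the two loops. -/
theorem smoothPart_eq_smoothFunctional (hc : 0 < c) (hq : 0 < q) (hδ : 0 < δ) (hδc : δ < c / 8)
    (hΓ : IsAdmissible q δ Γ ΓA) {U : Set ℂ} {n : ℕ} {y z : Fin n → ℂ}
    (h : IsResidueDomain δ U Γ y z) (hlog : ∀ s, ∀ x ∈ U, 1 - x / ΓA s ∈ Complex.slitPlane)
    {R : ℝ} {β γ : ℂ} (hH : IsDensity Γ R (rationalH y z)) (hg : IsGapped c q δ Γ R β γ)
    {B : ℝ} (hB : 0 < B) (hqB : fermiZone q ⊆ rect δ B) (hzB : ∀ a, z a ∈ rect δ B)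
    (hΓA : Set.range ΓA ⊆ puncturedStrip δ B) (h0 : 0 ∈ inside ΓA) {Γε : ℝ → ℂ}
    (hΓε : IsClosedCurve Γε) (hΓεD : Set.range Γε ⊆ puncturedStrip δ B) (h0ε : 0 ∈ inside Γε) :
    smoothPart c q Γε γ β y z = smoothFunctional c q Γ ΓA γ β (rationalH y z) := by
  have hyδ : ∀ a, y a ∈ strip δ := fun a => h.subset (h.left_mem a)
  have hzδ : ∀ a, z a ∈ strip δ := fun a => h.subset (h.right_mem a)
  have hF : ∀ x ∈ strip δ, shiftFunctional c q Γ β (rationalH y z) x = shiftFunction c q β y z x :=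
    fun x hx => shiftFunctional_rationalH hc hq hδ hδc hΓ.curve hΓ.subset β hyδ hzδ
      h.left_inside h.right_inside hx
  have hFr : ∀ x : ℝ, shiftFunctional c q Γ β (rationalH y z) x = shiftFunction c q β y z x :=
    fun x => hF x (ofReal_mem_strip hδ x)
  have hFd : DifferentiableOn ℂ (shiftFunction c q β y z) (strip δ) :=
    (differentiableOn_shiftFunctional hc hq hδ hδc hΓ β hH).congr fun x hx => (hF x hx).symm
  have hFc : ContinuousOn (fun x : ℝ => shiftFunction c q β y z x) (Set.Icc (-q) q) :=
    DifferentiableOn.continuousOn_ofReal hδ hFd _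
  have hD : puncturedStrip δ B ⊆ strip δ := Set.sdiff_subset
  have eT := cauchyT_congr (q := q) (ν := fun x => γ * shiftFunctional c q Γ β (rationalH y z) x)
    (ν' := fun x => γ * shiftFunction c q β y z x) fun x => by rw [hFr x]
  have e0 := cauchyC0_congr (c := c) (q := q)
    (ν := fun x => γ * shiftFunctional c q Γ β (rationalH y z) x)
    (ν' := fun x => γ * shiftFunction c q β y z x) fun x => by rw [hFr x]
  have hdet : ∀ {ε : ℂ}, ε = 1 ∨ ε = -1 →
      loopFredholmDet ΓA (functionalKernel c q Γ ε γ β (rationalH y z))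
        = loopFredholmDet Γε (formFactorKernel c q ε γ β y z) := by
    intro ε hε
    -- The order matters: `hlog` identifies the two kernels only for `ω` on `ΓA`. There the
    -- functional kernel is replaced by the form factor kernel, which is holomorphic on the
    -- punctured strip and can be carried to `Γε`.
    rw [loopFredholmDet_congr (V' := formFactorKernel c q ε γ β y z)]
    · refine loopFredholmDet_eq (isOpen_puncturedStrip δ B) hΓ.curveA hΓε hΓA hΓεD
        (fun f hf => loopInt_eq_loopInt hδ hB hΓ.curveA hΓA h0 hΓε hΓεD h0ε hf)
        (differentiableOn_formFactorKernel hc hq hδc hD (fun x hx hx' => hx.2 (hqB hx')) hε hyδ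
          (fun a ha => ha.2 (hzB a))
          (fun x hx => hFd.differentiableAt ((isOpen_strip δ).mem_nhds (hD hx))) hFc
          (fun x hx => ?_) fun x hx => ?_)
      · rw [← hF x (hD hx)]; exact (hg _ hH x (hD hx)).1
      · rw [← hF x (hD hx)]; exact (hg _ hH x (hD hx)).2
    · rintro _ ⟨s, rfl⟩ ω' -
      rw [functionalKernel, formFactorKernel,
        h.kernel hc hδc (hΓ.subsetA ⟨s, rfl⟩) (hlog s) (hΓ.ne_zero s) hε,
        baseKernel_congr hFr (hF _ (hΓ.subsetA ⟨s, rfl⟩))]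
  have hν : ContinuousOn (fun x : ℝ => γ * shiftFunction c q β y z x) (Set.Icc (-q) q) :=
    hFc.const_mul γ
  have f1 := h.factor hc hq hδc (ν := fun x => γ * shiftFunction c q β y z x) hν (Or.inl rfl)
  have f2 := h.factor hc hq hδc (ν := fun x => γ * shiftFunction c q β y z x) hν (Or.inr rfl)
  simp only [smoothPart, smoothFunctional]
  rw [eT, e0, hdet (Or.inl rfl), hdet (Or.inr rfl), h.double hc hδc, f1, f2, neg_mul,
    Complex.exp_neg, div_eq_mul_inv, div_eq_mul_inv, mul_inv]
  ac_rfl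

end Identity

/-! ### Quantitative choice of the constants. -/

section Main

variable {c q δ A : ℝ} {Γ ΓA : ℝ → ℂ}

lemma IsSmoothLoop.isCompact_range (h : IsSmoothLoop Γ) : IsCompact (Set.range Γ) :=
  h.periodic.compact_of_continuous one_ne_zero h.isClosedCurve.continuous

lemma loopLength_nonneg (Γ : ℝ → ℂ) : 0 ≤ loopLength Γ :=
  intervalIntegral.integral_nonneg zero_le_one fun _ _ => norm_nonneg _

lemma norm_loopInt_le (hΓ : IsClosedCurve Γ) {f : ℂ → ℂ} {B : ℝ}
    (hB : ∀ z ∈ Set.range Γ, ‖f z‖ ≤ B) : ‖loopInt Γ f‖ ≤ B * loopLength Γ := by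
  rw [loopLength, ← intervalIntegral.integral_const_mul]
  refine intervalIntegral.norm_integral_le_of_norm_le zero_le_one
    (Eventually.of_forall fun t _ => ?_) ?_
  · rw [norm_mul]
    exact mul_le_mul_of_nonneg_right (hB _ ⟨t, rfl⟩) (norm_nonneg _)
  · exact (continuous_const.mul hΓ.continuous_deriv.norm).intervalIntegrable _ _

lemma isCompact_rect (δ A : ℝ) : IsCompact (rect δ A) := by
  have : rect δ A = Set.Icc (-A) A ×ℂ Set.Icc (-δ) δ := by
    ext z
    simp [rect, Complex.mem_reProdIm, abs_le, and_comm]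
  rw [this]
  exact isCompact_Icc.reProdIm isCompact_Icc

lemma setDist_le {S T : Set ℂ} {x y : ℂ} (hx : x ∈ S) (hy : y ∈ T) : setDist S T ≤ dist x y := by
  refine csInf_le ⟨0, ?_⟩ ⟨x, hx, y, hy, rfl⟩
  rintro _ ⟨x, -, y, -, rfl⟩
  exact dist_nonneg

lemma setDist_pos {S T : Set ℂ} (hS : IsCompact S) (hT : IsCompact T) (hS0 : S.Nonempty)
    (hT0 : T.Nonempty) (hST : Disjoint S T) : 0 < setDist S T := by
  have hc : IsCompact (Set.image2 dist S T) := by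
    rw [← Set.image_prod]
    exact (hS.prod hT).image continuous_dist
  obtain ⟨x, hx, y, hy, hxy⟩ := hc.sInf_mem (hS0.image2 hT0)
  rw [setDist, ← hxy, dist_pos]
  rintro rfl
  exact Set.disjoint_left.1 hST hx hy

lemma disjoint_range_inside (Γ : ℝ → ℂ) : Disjoint (inside Γ) (Set.range Γ) :=
  Set.disjoint_left.2 fun _ hx hx' => hx.1 hx'

lemma norm_rationalH_le {n : ℕ} {y z : Fin n → ℂ} {d : ℝ} {x : ℂ} (hd : 0 < d)
    (hy : ∀ a, d ≤ dist (y a) x) (hz : ∀ a, d ≤ dist (z a) x) :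
    ‖rationalH y z x‖ ≤ n * (2 / d) := by
  have h1 : ∀ w, d ≤ dist w x → ‖1 / (x - w)‖ ≤ 1 / d := fun w hw => by
    rw [norm_div, norm_one]
    refine one_div_le_one_div_of_le hd ?_
    rwa [← dist_eq_norm, dist_comm]
  refine (norm_sum_le_of_le _ fun a _ => (norm_sub_le _ _).trans
    (add_le_add (h1 _ (hy a)) (h1 _ (hz a)))).trans_eq ?_
  rw [Finset.sum_const, Finset.card_univ, Fintype.card_fin, nsmul_eq_mul]
  ring

lemma IsContourSystem.isAdmissible {Γin Γout : ℝ → ℂ} (h : IsContourSystem q δ A Γin Γ Γout ΓA)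
    (hq : 0 < q) : IsAdmissible q δ Γ ΓA where
  curve := h.loop_mid.loop.isClosedCurve
  subset := h.loop_mid.subset
  curveA := h.loop_A.loop.isClosedCurve
  subsetA := h.loop_A.subset
  compact := h.loop_mid.loop.isCompact_range
  compactA := h.loop_A.loop.isCompact_range
  notMem s x hx hxs := (h.loop_A.around (Or.inr ⟨x, hx, rfl⟩)).1 ⟨s, hxs.symm⟩
  ne_zero s hs := (h.loop_A.around (Or.inr ⟨0, by constructor <;> linarith, rfl⟩)).1
    ⟨s, by simpa using hs⟩
  log_domain s t := h.log_domain s _ (Or.inl ⟨t, rfl⟩)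

lemma isDensity_of_holomorphicOn {M : Set ℂ} {C R : ℝ} {ϖ : ℂ → ℂ} (hM : Set.range Γ ⊆ M)
    (hC : 0 ≤ C) (hCR : C ≤ R) (h : HolomorphicOn M ϖ)
    (hϖ : supNorm (Set.range Γ) ϖ ≤ ENNReal.ofReal C) : IsDensity Γ R ϖ :=
  ⟨h.continuousOn.mono hM, fun _ hz => (norm_le_of_supNorm_le hC hϖ hz).trans hCR⟩

/-- A bound for the part of the shift functional that does not depend on `β`. -/
def shiftBound (c q : ℝ) (Γ : ℝ → ℂ) (R : ℝ) : ℝ :=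
  phaseBound c q + R * phaseBound c q * loopLength Γ

lemma norm_shiftFunctional_sub_le (hc : 0 < c) (hq : 0 < q) (hδ : 0 < δ) (hδc : δ < c / 8)
    (hΓ : IsAdmissible q δ Γ ΓA) (β : ℂ) {R : ℝ} (hR : 0 ≤ R) {ϖ : ℂ → ℂ} (hϖ : IsDensity Γ R ϖ)
    {x : ℂ} (hx : x ∈ strip δ) :
    ‖shiftFunctional c q Γ β ϖ x - (Complex.I * β - 1 / 2) * dressedCharge c q x‖
      ≤ shiftBound c q Γ R := by
  have e : shiftFunctional c q Γ β ϖ x - (Complex.I * β - 1 / 2) * dressedCharge c q x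
      = -(dressedPhase c q x q + (2 * Real.pi * Complex.I)⁻¹
        * loopInt Γ (fun z => ϖ z * dressedPhase c q x z)) := by
    rw [shiftFunctional]; ring
  have hpi : ‖(2 * Real.pi * Complex.I : ℂ)⁻¹‖ ≤ 1 := by
    rw [norm_inv, norm_mul, norm_two_pi, Complex.norm_I, mul_one]
    exact inv_le_one_of_one_le₀ (by linarith [Real.pi_gt_three])
  rw [e, norm_neg]
  refine (norm_add_le _ _).trans (add_le_add
    (norm_dressedPhase_le hc hq hδ hδc hx (ofReal_mem_strip hδ q)) ?_)
  rw [norm_mul]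
  refine (mul_le_of_le_one_left (norm_nonneg _) hpi).trans
    (norm_loopInt_le hΓ.curve fun z hz => ?_)
  rw [norm_mul]
  exact mul_le_mul (hϖ.bound z hz) (norm_dressedPhase_le hc hq hδ hδc hx (hΓ.subset hz))
    (norm_nonneg _) hR

/-- The imaginary part of `iβ - 1/2` is `Re β`, and `|Z| ≥ 1`, so the leading term has modulus at
least `Re β` and exceeds the remainder by at least 1. The upper bounds `N` on `|β|` and `liebConst`
on `|Z|` decide how small `γ` must be. -/
lemma isGapped_of_le (hc : 0 < c) (hq : 0 < q) (hδ : 0 < δ) (hδc : δ < c / 8)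
    (hΓ : IsAdmissible q δ Γ ΓA) {β γ : ℂ} {R N : ℝ} (hR : 0 ≤ R)
    (hβ : 1 + shiftBound c q Γ R ≤ β.re) (hN : ‖β‖ ≤ N)
    (hγ : ‖γ‖ * ((N + 1 / 2) * liebConst c q + shiftBound c q Γ R) ≤ 1 / 16) :
    IsGapped c q δ Γ R β γ := by
  intro ϖ hϖ x hx
  have h := norm_shiftFunctional_sub_le hc hq hδ hδc hΓ β hR hϖ hx
  set G := shiftFunctional c q Γ β ϖ x
  set W := (Complex.I * β - 1 / 2) * dressedCharge c q x with hW
  have hxim : |x.im| < c := by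
    have : |x.im| < 2 * δ := hx
    linarith
  have hZ := one_le_norm_dressedCharge hc hq hxim
  have hZ' := norm_dressedCharge_le hc hq (strip_subset_quarter hδ hδc hx)
  have hlow : β.re ≤ ‖Complex.I * β - 1 / 2‖ := by
    refine le_trans ?_ (Complex.abs_im_le_norm _)
    have : (Complex.I * β - 1 / 2).im = β.re := by simp
    rw [this]
    exact le_abs_self _
  have hup : ‖Complex.I * β - 1 / 2‖ ≤ N + 1 / 2 := by
    refine (norm_sub_le _ _).trans (add_le_add ?_ ?_)
    · rwa [norm_mul, Complex.norm_I, one_mul]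
    · norm_num
  have hWn : ‖W‖ = ‖Complex.I * β - 1 / 2‖ * ‖dressedCharge c q x‖ := norm_mul _ _
  have hW1 : β.re ≤ ‖W‖ := hlow.trans (hWn ▸ le_mul_of_one_le_right (norm_nonneg _) hZ)
  have hW2 : ‖W‖ ≤ (N + 1 / 2) * liebConst c q :=
    hWn ▸ mul_le_mul hup hZ' (norm_nonneg _) ((norm_nonneg _).trans hup)
  have h1 : ‖W‖ - ‖G‖ ≤ ‖G - W‖ := by
    rw [norm_sub_rev]; exact norm_sub_norm_le _ _
  have h2 : ‖G‖ - ‖W‖ ≤ ‖G - W‖ := norm_sub_norm_le _ _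
  refine ⟨by linarith, le_trans ?_ hγ⟩
  exact mul_le_mul_of_nonneg_left (by linarith) (norm_nonneg _)

end Main

end NLS

end

theorem mainTheorem11 (c q δ A : ℝ) (m : ℕ)
    (hc : 0 < c) (hq : 0 < q) (hδ : 0 < δ) (hδc : δ < c / 8) (hA : 0 < A) :
    ∃ Γin Γ Γout ΓA : ℝ → ℂ, NLS.IsContourSystem q δ A Γin Γ Γout ΓA ∧
    ∃ b η : ℝ, 0 < b ∧ 0 < η ∧
    ∀ β₀ : ℂ, b ≤ β₀.re → 0 < β₀.im → β₀.im ≤ η →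
    ∃ C g : ℝ, 0 < C ∧ 0 < g ∧
      A < C * (Real.pi * NLS.setDist (Set.range Γin ∪ Set.range Γout) (Set.range Γ)
        / (NLS.loopLength Γin + NLS.loopLength Γout
          + 2 * Real.pi * NLS.setDist (Set.range Γin ∪ Set.range Γout) (Set.range Γ))) ∧
      (∀ n ≤ m, ∀ y z : Fin n → ℂ, (∀ a, y a ∈ NLS.rect δ A) → (∀ a, z a ∈ NLS.rect δ A) →
        NLS.HolomorphicOn (NLS.annulus Γin Γout) (NLS.rationalH y z) ∧
        NLS.supNorm (Set.range Γ) (NLS.rationalH y z) < ENNReal.ofReal C) ∧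
      ∀ γ₀ : ℝ, 0 < γ₀ → γ₀ ≤ g → ∀ β ∈ NLS.betaDomain β₀,
        (∀ ϖ : ℂ → ℂ, NLS.HolomorphicOn (NLS.annulus Γin Γout) ϖ →
          NLS.supNorm (Set.range Γ) ϖ ≤ ENNReal.ofReal C →
          NLS.supNorm (NLS.strip δ) (fun x => γ₀ * NLS.shiftFunctional c q Γ β ϖ x)
              < ENNReal.ofReal (1 / 2) ∧
          ∀ x ∈ NLS.strip δ, NLS.shiftFunctional c q Γ β ϖ x ≠ 0) ∧
        ∀ γ : ℂ, ‖γ‖ ≤ γ₀ →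
          NLS.IsRegularFunctional (NLS.annulus Γin Γout) (Set.range Γ) C
            (NLS.smoothFunctional c q Γ ΓA γ β) ∧
          ∀ n ≤ m, ∀ y z : Fin n → ℂ,
            (∀ a, y a ∈ NLS.rect δ A) → (∀ a, z a ∈ NLS.rect δ A) →
            ∀ ε : ℝ, 0 < ε → (∀ a, z a ∈ NLS.rect δ (q + ε)) →
            ∀ Γε : ℝ → ℂ, NLS.IsLoopAround (NLS.strip δ) (NLS.rect δ (q + ε)) Γε →
              NLS.smoothPart c q Γε γ β y z
                = NLS.smoothFunctional c q Γ ΓA γ β (NLS.rationalH y z) := by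
  have hS := NLS.isContourSystem_ellipse hq hδ hA
  have haq := add_pos hA hq
  have hinside := @NLS.inside_ellipse _ _ haq hδ
  have hrange := @NLS.range_ellipse _ _ haq hδ
  have hnorm := @NLS.ellipseNorm_ellipse _ _ haq hδ
  have hlogdom := @NLS.one_sub_div_mem_slitPlane _ _ haq hδ
  have hrect : ∀ {z}, z ∈ NLS.rect δ A → NLS.ellipseNorm haq hδ z < 3 / 2 := fun hz =>
    NLS.ellipseNorm_lt_of_mem_rect hq hδ hA (NLS.rect_mono (by linarith) hz)
  set Γin := NLS.ellipse haq hδ (3 / 2) with hΓin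
  set Γ := NLS.ellipse haq hδ (8 / 5) with hΓdef
  set Γout := NLS.ellipse haq hδ (17 / 10) with hΓout
  set ΓA := NLS.ellipse haq hδ (9 / 5) with hΓA
  have hadm := hS.isAdmissible hq
  set d := NLS.setDist (Set.range Γin ∪ Set.range Γout) (Set.range Γ) with hd
  have hd0 : 0 < d := by
    refine NLS.setDist_pos (hS.loop_in.loop.isCompact_range.union
      hS.loop_out.loop.isCompact_range) hadm.compact ⟨Γin 0, Or.inl ⟨0, rfl⟩⟩ ⟨Γ 0, 0, rfl⟩ ?_
    rw [← hS.annulus_frontier]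
    exact (disjoint_interior_frontier.mono_left hS.mid_subset).symm
  have hin : NLS.rect δ A ⊆ NLS.inside Γin := hS.loop_in.around
  have hmid : NLS.rect δ A ⊆ NLS.inside Γ := fun z hz => hS.loop_mid.around (Or.inr (hin hz))
  set D := NLS.setDist (NLS.rect δ A) (Set.range Γ) with hD
  have hD0 : 0 < D := NLS.setDist_pos (NLS.isCompact_rect δ A) hadm.compact
    ⟨0, by simp [NLS.rect, hδ.le, hA.le]⟩ ⟨Γ 0, 0, rfl⟩
    ((NLS.disjoint_range_inside Γ).mono_left hmid)
  set L := NLS.loopLength Γin + NLS.loopLength Γout with hL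
  have hL0 : 0 ≤ L := add_nonneg (NLS.loopLength_nonneg _) (NLS.loopLength_nonneg _)
  have hpi := Real.pi_pos
  -- The first term is the threshold of the geometric inequality, the second bounds `H` on the loop
  -- for at most `m` pairs, and the 1 makes both inequalities strict. `C` does not involve `β₀`.
  set C := A * ((L + 2 * Real.pi * d) / (Real.pi * d)) + m * (2 / D) + 1 with hC
  have hC1 : 0 < A * ((L + 2 * Real.pi * d) / (Real.pi * d)) := by positivity
  have hC2 : 0 ≤ m * (2 / D) := by positivity
  have hC0 : 0 < C := by linarith
  have hsub : Set.range Γ ⊆ NLS.annulus Γin Γout := hS.mid_subset.trans interior_subset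
  have hHol : ∀ {n : ℕ} {y z : Fin n → ℂ}, (∀ a, y a ∈ NLS.rect δ A) →
      (∀ a, z a ∈ NLS.rect δ A) → NLS.HolomorphicOn (NLS.annulus Γin Γout) (NLS.rationalH y z) := by
    intro n y z hy hz
    refine ⟨(NLS.rect δ A)ᶜ, (NLS.isClosed_rect δ A).isOpen_compl, fun x hx hx' =>
      hx.2 (hin hx'), DifferentiableOn.fun_sum fun a _ => DifferentiableOn.sub ?_ ?_⟩
    · exact DifferentiableOn.div (by fun_prop) (by fun_prop) fun x hx h =>
        hx (sub_eq_zero.1 h ▸ hy a)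
    · exact DifferentiableOn.div (by fun_prop) (by fun_prop) fun x hx h =>
        hx (sub_eq_zero.1 h ▸ hz a)
  have hHsup : ∀ {n : ℕ} {y z : Fin n → ℂ}, n ≤ m → (∀ a, y a ∈ NLS.rect δ A) →
      (∀ a, z a ∈ NLS.rect δ A) →
      NLS.supNorm (Set.range Γ) (NLS.rationalH y z) < ENNReal.ofReal C := by
    intro n y z hn hy hz
    refine (NLS.supNorm_le (C := m * (2 / D)) fun x hx => ?_).trans_lt
      ((ENNReal.ofReal_lt_ofReal_iff hC0).2 (by linarith))
    refine (NLS.norm_rationalH_le (d := D) hD0 (fun a => ?_) fun a => ?_).trans ?_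
    · exact NLS.setDist_le (hy a) hx
    · exact NLS.setDist_le (hz a) hx
    · gcongr
  have hb0 : 0 ≤ NLS.shiftBound c q Γ (2 * C) := by
    have h1 := NLS.phaseBound_nonneg hc hq
    have h2 := NLS.loopLength_nonneg Γ
    unfold NLS.shiftBound
    positivity
  have hl0 := NLS.liebConst_pos hc hq
  -- Regularity with constant `C` needs densities up to `2 C`, hence the bound `b` on `Re β₀`. The
  -- value `η = 1` is arbitrary: `Im β₀` only enters the bound `N` on `|β|`, and through it `g`.
  refine ⟨Γin, Γ, Γout, ΓA, hS, 1 + NLS.shiftBound c q Γ (2 * C), 1, by linarith, one_pos,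
    fun β₀ hb hi _ => ?_⟩
  set N := 10 * β₀.re + β₀.im with hN
  have hN0 : 0 < N := by linarith
  set g := 1 / (16 * ((N + 1 / 2) * NLS.liebConst c q + NLS.shiftBound c q Γ (2 * C))) with hg
  have hg0 : 0 < g := by positivity
  refine ⟨C, g, hC0, hg0, ?_, fun n hn y z hy hz => ⟨hHol hy hz, hHsup hn hy hz⟩,
    fun γ₀ hγ₀ hγg β hβ => ?_⟩
  · have : A = A * ((L + 2 * Real.pi * d) / (Real.pi * d))
        * (Real.pi * d / (L + 2 * Real.pi * d)) := by
      have : L + 2 * Real.pi * d ≠ 0 := by positivity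
      field_simp
    conv_lhs => rw [this]
    have : 0 < Real.pi * d / (L + 2 * Real.pi * d) := by positivity
    exact mul_lt_mul_of_pos_right (by linarith) this
  have hgap : ∀ γ : ℂ, ‖γ‖ ≤ γ₀ → NLS.IsGapped c q δ Γ (2 * C) β γ := by
    intro γ hγ
    refine NLS.isGapped_of_le hc hq hδ hδc hadm (N := N) (by linarith) (hb.trans hβ.1) ?_ ?_
    · refine (Complex.norm_le_abs_re_add_abs_im _).trans (add_le_add ?_ hβ.2.2)
      rw [abs_of_nonneg (by linarith [hβ.1])]
      exact hβ.2.1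
    · refine (mul_le_mul_of_nonneg_right (hγ.trans hγg) (by positivity)).trans_eq ?_
      rw [hg]
      have : (N + 1 / 2) * NLS.liebConst c q + NLS.shiftBound c q Γ (2 * C) ≠ 0 := by positivity
      field_simp
  refine ⟨fun ϖ hϖ hϖC => ?_, fun γ hγ => ⟨?_, fun n hn y z hy hz ε hε hzε Γε hΓε => ?_⟩⟩
  · have hG := hgap γ₀ (by rw [Complex.norm_real, Real.norm_of_nonneg hγ₀.le]) ϖ
      (NLS.isDensity_of_holomorphicOn hsub hC0.le (by linarith) hϖ hϖC)
    refine ⟨(NLS.supNorm_le (C := 1 / 16) fun x hx => ?_).trans_lt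
      ((ENNReal.ofReal_lt_ofReal_iff (by norm_num)).2 (by norm_num)), fun x hx h0 => ?_⟩
    · rw [norm_mul]
      exact (hG x hx).2
    · have := (hG x hx).1
      rw [h0, norm_zero] at this
      linarith
  · exact (NLS.isTame_smoothFunctional hc hq hδ hδc hadm (hgap γ hγ)).isRegularFunctional hC0 le_rfl
      hS.annulus_compact hadm.compact hS.mid_subset
  -- The rectangle to remove must lie inside both loops: `ΓA` surrounds half-width `A + q`, and `Γε`
  -- surrounds half-width `q + ε`. The minimum still contains the Fermi zone and all `z a`.
  · have hB : 0 < min (q + ε) (A + q) := lt_min (by linarith) (by linarith)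
    have hqB : q ≤ min (q + ε) (A + q) := le_min (by linarith) (by linarith)
    have hBA : NLS.rect δ (min (q + ε) (A + q)) ⊆ NLS.inside ΓA := by
      rw [hΓA, hinside (by norm_num)]
      intro z hz
      have := NLS.ellipseNorm_lt_of_mem_rect hq hδ hA (NLS.rect_mono (min_le_right _ _) hz)
      exact this.trans (by norm_num)
    have hBε : NLS.rect δ (min (q + ε) (A + q)) ⊆ NLS.inside Γε :=
      (NLS.rect_mono (min_le_left _ _)).trans hΓε.around
    have h0B : (0 : ℂ) ∈ NLS.rect δ (min (q + ε) (A + q)) := by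
      refine ⟨by simpa using hδ.le, by simpa using ⟨by linarith, by linarith⟩⟩
    refine NLS.smoothPart_eq_smoothFunctional hc hq hδ hδc hadm
      -- The interior of `ΓA`: convex, large enough to contain `Γ`, and such that `1 - x / ΓA s`
      -- avoids the cut for all its points `x`.
      (U := {z | NLS.ellipseNorm haq hδ z < 9 / 5})
      ⟨hadm.curve, NLS.isOpen_ellipseNorm_lt haq hδ _, NLS.convex_ellipseNorm_lt haq hδ _,
        fun z hz => NLS.mem_strip_of_ellipseNorm_lt hq hδ hA
          (lt_trans (show _ < _ from hz) (by norm_num)),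
        fun z hz => ?_, fun a => (hrect (hy a)).trans (by norm_num),
        fun a => (hrect (hz a)).trans (by norm_num), fun a => hmid (hy a), fun a => hmid (hz a)⟩
      (fun s x hx => hlogdom ?_)
      (NLS.isDensity_of_holomorphicOn hsub hC0.le (by linarith) (hHol hy hz) (hHsup hn hy hz).le)
      (hgap γ hγ) hB ((NLS.fermiZone_subset_rect hδ).trans (NLS.rect_mono hqB))
      (fun a => ⟨(hz a).1, le_min (hzε a).2 ((hz a).2.trans (by linarith))⟩)
      (fun z hz => ⟨hadm.subsetA hz, fun h => (hBA h).1 hz⟩) (hBA h0B)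
      hΓε.loop.isClosedCurve (fun z hz => ⟨hΓε.subset hz, fun h => (hBε h).1 hz⟩) (hBε h0B)
    · rw [hΓdef, hrange (by norm_num)] at hz
      rw [Set.mem_ofPred_eq] at hz ⊢
      rw [hz]; norm_num
    · rw [hnorm (by norm_num)]
      exact hx
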